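/- Let $P$ be a simple polygon in the Euclidean plane with vertices $v_1,\dots,v_n$ ($n\ge 3$, indices cyclic): consecutive vertices are distinct, consecutive edges meet only in their common vertex, and non-consecutive edges are disjoint. Regard $P$ as the closed region consisting of the boundary polygon $\partial P$ together with the bounded part of its complement. A vertex $v_k$ is called reflex if its interior angle (the angle between the edges $\overline{v_{k-1}v_k}$ and $\overline{v_kv_{k+1}}$ facing the inside of $P$, a number in $(0,2\pi)$) is at least $\pi$. Let $v_i, v_j$ be distinct vertices of $P$, and let $B\subset\partial P$ be one of the two polygonal paths in $\partial P$ from $v_i$ to $v_j$. Then $B$ has minimal length among all continuous paths in $P$ from $v_i$ to $v_j$ if and only if every interior vertex of $B$ (every vertex of $P$ on $B$ other than $v_i$ and $v_j$) is reflex. Moreover, in that case $B$ is the only shortest path: every path of minimal length in $P$ from $v_i$ to $v_j$ has image $B$. -/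

import Mathlib

open Set Filter Topology

/-- The Euclidean plane. -/
abbrev Plane : Type := EuclideanSpace ℝ (Fin 2)

/-- The length of a path: the supremum of the lengths of its inscribed polygonal lines
(it is `⊤` for a path that is not rectifiable). -/
noncomputable def pathLength {x y : Plane} (γ : Path x y) : ENNReal :=
  eVariationOn (γ : unitInterval → Plane) univ

/-- `γ` is a path of minimal length among all paths with the same endpoints that stay in `K`. -/
def IsShortestPathIn (K : Set Plane) {x y : Plane} (γ : Path x y) : Prop :=
  (∀ t, γ t ∈ K) ∧ ∀ δ : Path x y, (∀ t, δ t ∈ K) → pathLength γ ≤ pathLength δ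

/-- The polygonal path with successive vertices `w 0, w 1, …, w m`. -/
noncomputable def polygonalPath (w : ℕ → Plane) : (m : ℕ) → Path (w 0) (w m)
  | 0 => Path.refl (w 0)
  | m + 1 => (polygonalPath w m).trans (Path.segment (w m) (w (m + 1)))

/-- The open angular sector with apex `p` between the ray from `p` through `a` and the ray
from `p` through `b`. When the two rays are not collinear this is the side of the angle `a p b`
on which the angle is less than `π`. -/
def openSector (a p b : Plane) : Set Plane :=
  {x | ∃ s t : ℝ, 0 < s ∧ 0 < t ∧ x = p + s • (a - p) + t • (b - p)}

namespace Polygon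

/-- A closed polygon in the plane, with cyclically ordered vertices, is simple: consecutive
vertices are distinct, consecutive edges meet only in their common vertex, and edges that are not
consecutive do not meet. An angle equal to `π` at a vertex is allowed. -/
structure IsSimple {n : ℕ} (P : Polygon Plane n) : Prop where
  three_le : 3 ≤ n
  nondegenerate : P.HasNondegenerateEdges
  consecutive : ∀ i : Fin n,
    P.edgeSet ℝ i ∩ P.edgeSet ℝ (finRotate n i) = {P (finRotate n i)}
  nonconsecutive : ∀ i j : Fin n, j ≠ i → j ≠ finRotate n i → i ≠ finRotate n j →
    Disjoint (P.edgeSet ℝ i) (P.edgeSet ℝ j)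

/-- The open set enclosed by the polygon: the points off the boundary whose connected component
in the complement of the boundary is bounded. -/
def inside {n : ℕ} (P : Polygon Plane n) : Set Plane :=
  {x | x ∈ (P.boundary ℝ)ᶜ ∧ Bornology.IsBounded (connectedComponentIn (P.boundary ℝ)ᶜ x)}

/-- The closed region bounded by the polygon: its boundary together with its inside. -/
def region {n : ℕ} (P : Polygon Plane n) : Set Plane :=
  P.boundary ℝ ∪ P.inside

open Classical in
/-- The interior angle at the `k`-th vertex, i.e. the one of the two angles between the edges at
that vertex which faces the inside. The unoriented angle between the edges (in `[0, π]`) is taken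
if its sector lies inside the polygon near the vertex, and its complement to `2π` otherwise.
(For an unoriented angle `π` both values agree.) -/
noncomputable def interiorAngle {n : ℕ} (P : Polygon Plane n) (k : Fin n) : ℝ :=
  let a := P ((finRotate n).symm k)
  let b := P (finRotate n k)
  if ∀ᶠ x in 𝓝[openSector a (P k) b] (P k), x ∈ P.inside then
    EuclideanGeometry.angle a (P k) b
  else
    2 * Real.pi - EuclideanGeometry.angle a (P k) b

/-- A vertex is reflex if its interior angle is at least `π`. -/
def IsReflex {n : ℕ} (P : Polygon Plane n) (k : Fin n) : Prop :=
  Real.pi ≤ P.interiorAngle k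

/-- The polygonal path `v_i, v_{i+1}, …, v_j` along the boundary (indices taken cyclically). -/
noncomputable def forwardArc {n : ℕ} [NeZero n] (P : Polygon Plane n) (i j : Fin n) :
    Path (P i) (P j) :=
  (polygonalPath (fun t => P (i + Fin.ofNat n t)) (j - i).val).cast (by simp) (by simp)

/-- `B` is one of the two polygonal paths from `v_i` to `v_j` in the boundary: either
`v_i, v_{i+1}, …, v_j`, or `v_i, v_{i-1}, …, v_j`, the reverse of the path
`v_j, v_{j+1}, …, v_i`. -/
def IsBoundaryArc {n : ℕ} [NeZero n] (P : Polygon Plane n) {i j : Fin n}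
    (B : Path (P i) (P j)) : Prop :=
  B = P.forwardArc i j ∨ B = (P.forwardArc j i).symm

/-- The `k`-th vertex is an interior vertex of the boundary path `B` from `v_i` to `v_j`:
it lies on `B` and is not one of its endpoints. -/
def IsInteriorVertex {n : ℕ} (P : Polygon Plane n) {i j : Fin n}
    (B : Path (P i) (P j)) (k : Fin n) : Prop :=
  k ≠ i ∧ k ≠ j ∧ P k ∈ range B

end Polygon

/-! If an interior vertex of `B` is not reflex, the sector of angle less than `π` at it lies inside
the polygon nearby, and cutting the corner off by a short segment through that sector gives a
strictly shorter path (`exists_shorter`).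

Conversely, let all interior vertices of `B` be reflex. From each of them some direction leads into
the polygon at an angle of at least `π / 2` with both edges: a normal at a straight vertex,
otherwise the reversed bisector of the small angle (`exists_direction`). Following it to the next
boundary point gives a chord. It ends on the other boundary arc (`exists_chord`) and separates the
two arcs within the polygon (`false_of_isPreconnected_of_chord`). Hence every competing path meets
these chords in order (`exists_isCrossing`). The chords at the ends of an edge lie on either side of
the strip orthogonal to that edge, so the part of the path between them is at least as long as the
edge. Summation gives minimality (`sum_edist_le`), and equality forces the path to run along each
edge (`range_eq`).

The topology rests on winding numbers of closed polygonal lines: `loopAngle` is `2π` times such a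
number. It is constant on connected sets off the line, vanishes on unbounded ones and jumps across
an edge. If a chord returned to `B`, it would form a loop with a piece of `B`. At a vertex of this
loop farthest from the line of the chord, the sector between the edges lies outside the polygon, so
the winding number is zero there; beyond the vertex it is zero as well, although the two sides must
differ (`false_of_chord_returns`). For separation, the winding numbers of the two loops into which a
chord divides the boundary add up to a nonzero constant on the inside, and each vanishes on the open
arc that belongs to the other loop. -/

namespace PlanePolygon

/-! ### Vector algebra in the plane -/

/-- The determinant of two vectors of the plane. -/
noncomputable def cross (u v : Plane) : ℝ := u 0 * v 1 - u 1 * v 0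

/-- Rotation by a quarter turn. -/
noncomputable def rot (u : Plane) : Plane := !₂[-u 1, u 0]

/-- The identification of the plane with `ℂ`. -/
noncomputable def toC (x : Plane) : ℂ := ⟨x 0, x 1⟩

theorem plane_ext {x y : Plane} (h0 : x 0 = y 0) (h1 : x 1 = y 1) : x = y := by
  ext i
  fin_cases i
  · exact h0
  · exact h1

@[simp] theorem rot_zero_apply (u : Plane) : rot u 0 = -u 1 := rfl
@[simp] theorem rot_one_apply (u : Plane) : rot u 1 = u 0 := rfl
@[simp] theorem toC_re (x : Plane) : (toC x).re = x 0 := rfl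
@[simp] theorem toC_im (x : Plane) : (toC x).im = x 1 := rfl

theorem toC_sub (x y : Plane) : toC (x - y) = toC x - toC y := by
  apply Complex.ext <;> simp

theorem toC_injective : Function.Injective toC := fun _ _ h =>
  plane_ext (congrArg Complex.re h) (congrArg Complex.im h)

theorem toC_sub_ne_zero {x y : Plane} (h : x ≠ y) : toC x - toC y ≠ 0 :=
  sub_ne_zero.2 fun h' => h (toC_injective h')

theorem continuous_toC : Continuous toC := by
  have : toC = fun x => Complex.equivRealProdCLM.symm (x 0, x 1) := by
    funext x
    apply Complex.ext <;> simp
  rw [this]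
  fun_prop

theorem cross_add_right (u v w : Plane) : cross u (v + w) = cross u v + cross u w := by
  simp [cross]; ring

theorem cross_sub_right (u v w : Plane) : cross u (v - w) = cross u v - cross u w := by
  simp [cross]; ring

theorem cross_smul_right (u v : Plane) (c : ℝ) : cross u (c • v) = c * cross u v := by
  simp [cross]; ring

theorem cross_add_left (u v w : Plane) : cross (u + v) w = cross u w + cross v w := by
  simp [cross]; ring

theorem cross_smul_left (u v : Plane) (c : ℝ) : cross (c • u) v = c * cross u v := by
  simp [cross]; ring

theorem cross_self (u : Plane) : cross u u = 0 := by simp [cross]; ring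

theorem cross_swap (u v : Plane) : cross u v = -cross v u := by simp [cross]; ring

theorem rot_smul (c : ℝ) (u : Plane) : rot (c • u) = c • rot u := by
  apply plane_ext <;> simp

theorem cross_rot_pos {u : Plane} (h : u ≠ 0) : 0 < cross u (rot u) := by
  have : cross u (rot u) = u 0 * u 0 + u 1 * u 1 := by simp [cross]
  rw [this]
  by_contra! h'
  apply h
  have h0 := mul_self_nonneg (u 0)
  have h1 := mul_self_nonneg (u 1)
  exact plane_ext (mul_self_eq_zero.1 (by linarith)) (mul_self_eq_zero.1 (by linarith))

/-- Cramer's rule in the plane. -/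
theorem cross_decomp (u v x : Plane) :
    cross u v • x = cross x v • u + cross u x • v := by
  apply plane_ext <;> simp [cross] <;> ring

theorem exists_smul_of_cross_eq_zero {u v : Plane} (hu : u ≠ 0) (h : cross u v = 0) :
    ∃ c : ℝ, v = c • u := by
  have h1 := cross_rot_pos hu
  have h2 := cross_decomp u (rot u) v
  rw [h, zero_smul, add_zero] at h2
  refine ⟨(cross u (rot u))⁻¹ * cross v (rot u), ?_⟩
  rw [mul_smul, ← h2, smul_smul, inv_mul_cancel₀ h1.ne', one_smul]

/-! ### Angles subtended by segments -/

/-- The angle in `(-π, π]` through which the segment from `a` to `b` turns, as seen from `x`. -/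
noncomputable def sightAngle (a b x : Plane) : ℝ :=
  ((toC b - toC x) / (toC a - toC x)).arg

/-- A ratio `z` that is real and nonpositive would make `x` the convex combination of `a` and `b`
with weights `-z / (1 - z)` and `1 / (1 - z)`. So the cut of `Complex.arg` is met only on the
segment. -/
theorem ratio_mem_slitPlane {a b x : Plane} (h : x ∉ segment ℝ a b) :
    (toC b - toC x) / (toC a - toC x) ∈ Complex.slitPlane := by
  have ha : toC a - toC x ≠ 0 := toC_sub_ne_zero fun h' => h (h' ▸ left_mem_segment ℝ a b)
  by_contra hz
  rw [Complex.mem_slitPlane_iff] at hz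
  push Not at hz
  set z := (toC b - toC x) / (toC a - toC x) with hzdef
  obtain ⟨hre, him⟩ := hz
  have hb : toC b - toC x = z * (toC a - toC x) := by
    rw [hzdef, div_mul_cancel₀ _ ha]
  have h0 := congrArg Complex.re hb
  have h1 := congrArg Complex.im hb
  simp [him] at h0 h1
  have hpos : 0 < 1 - z.re := by linarith
  apply h
  refine ⟨-z.re / (1 - z.re), 1 / (1 - z.re), div_nonneg (by linarith) hpos.le,
    by positivity, by field_simp; ring, ?_⟩
  apply plane_ext
  · simp
    field_simp
    linarith
  · simp
    field_simp
    linarith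

theorem continuousAt_sightAngle {a b x : Plane} (h : x ∉ segment ℝ a b) :
    ContinuousAt (sightAngle a b) x := by
  have ha : toC a - toC x ≠ 0 := toC_sub_ne_zero fun h' => h (h' ▸ left_mem_segment ℝ a b)
  unfold sightAngle
  refine ContinuousAt.comp (g := Complex.arg)
    (f := fun x => (toC b - toC x) / (toC a - toC x))
    (Complex.continuousAt_arg (ratio_mem_slitPlane h)) ?_
  exact (continuousAt_const.sub continuous_toC.continuousAt).div
    (continuousAt_const.sub continuous_toC.continuousAt) ha

theorem coe_sightAngle {a b x : Plane} (ha : a ≠ x) (hb : b ≠ x) :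
    (sightAngle a b x : Real.Angle) =
      ((toC b - toC x).arg : Real.Angle) - ((toC a - toC x).arg : Real.Angle) :=
  Complex.arg_div_coe_angle (toC_sub_ne_zero hb) (toC_sub_ne_zero ha)

theorem sightAngle_self (a x : Plane) : sightAngle a a x = 0 := by
  unfold sightAngle
  by_cases h : toC a - toC x = 0 <;> simp [h]

theorem sightAngle_swap {a b x : Plane} (h : x ∉ segment ℝ a b) :
    sightAngle b a x = -sightAngle a b x := by
  unfold sightAngle
  have h1 := ratio_mem_slitPlane h
  rw [← inv_div, Complex.arg_inv, if_neg (Complex.mem_slitPlane_iff_arg.1 h1).1]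

/-- The ratio equals `1 + (b - a) / (a - x)`, which tends to `1`, where `arg` is continuous. -/
theorem tendsto_sightAngle (a b : Plane) :
    Tendsto (sightAngle a b) (Bornology.cobounded Plane) (𝓝 0) := by
  have hC : Tendsto (fun x => toC a - toC x) (Bornology.cobounded Plane)
      (Bornology.cobounded ℂ) := by
    rw [← tendsto_norm_atTop_iff_cobounded]
    have h1 : ∀ x, ‖toC a - toC x‖ = ‖a - x‖ := by
      intro x
      rw [← toC_sub, EuclideanSpace.norm_eq, Complex.norm_eq_sqrt_sq_add_sq]
      simp [Fin.sum_univ_two]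
    simp_rw [h1]
    rw [tendsto_norm_atTop_iff_cobounded]
    exact tendsto_const_sub_cobounded a
  have h2 : Tendsto (fun x => 1 + (toC b - toC a) * (toC a - toC x)⁻¹)
      (Bornology.cobounded Plane) (𝓝 (1 + (toC b - toC a) * 0)) :=
    (tendsto_inv₀_cobounded.comp hC |>.const_mul _).const_add _
  rw [mul_zero, add_zero] at h2
  have h3 := (Complex.continuousAt_arg (x := 1) (by simp)).tendsto.comp h2
  rw [Complex.arg_one] at h3
  refine h3.congr' ?_
  have h4 : ∀ᶠ x in Bornology.cobounded Plane, x ≠ a := by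
    have : Bornology.IsBounded ({a} : Set Plane) := Bornology.isBounded_singleton
    filter_upwards [Bornology.isBounded_def.1 this] with x hx using hx
  filter_upwards [h4] with x hx
  have := toC_sub_ne_zero hx.symm
  simp only [Function.comp, sightAngle]
  congr 1
  field_simp
  ring

/-- The sight angle of a segment jumps when the eye crosses the segment, so a function that is the
sum of it and of a continuous function takes different values on both sides. -/
theorem eventually_ne_of_jump {a b y : Plane} {f g : Plane → ℝ} (hab : a ≠ b)
    (hy : y ∈ openSegment ℝ a b) (hf : ∀ x, f x = sightAngle a b x + g x)
    (hg : ContinuousAt g y) :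
    ∀ᶠ ε : ℝ in 𝓝[≠] 0, f (y + ε • rot (b - a)) ≠ f (y - ε • rot (b - a)) := by
  obtain ⟨α, β, hα, hβ, hαβ, rfl⟩ := hy
  set n := rot (b - a)
  set y := α • a + β • b
  have t1 : Tendsto (fun ε : ℝ => g (y + ε • n) - g (y - ε • n)) (𝓝 0) (𝓝 (g y - g y)) := by
    have e1 : Tendsto (fun ε : ℝ => y + ε • n) (𝓝 0) (𝓝 y) := by
      have : Continuous (fun ε : ℝ => y + ε • n) := by fun_prop
      simpa using this.tendsto 0
    have e2 : Tendsto (fun ε : ℝ => y - ε • n) (𝓝 0) (𝓝 y) := by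
      have : Continuous (fun ε : ℝ => y - ε • n) := by fun_prop
      simpa using this.tendsto 0
    exact (hg.tendsto.comp e1).sub (hg.tendsto.comp e2)
  rw [sub_self] at t1
  have t2 : ∀ᶠ ε : ℝ in 𝓝 0, |g (y + ε • n) - g (y - ε • n)| < Real.pi :=
    (t1.abs.eventually_lt_const (by simpa using Real.pi_pos))
  have t3 : ∀ᶠ ε : ℝ in 𝓝 0, ε ^ 2 < α * β :=
    ((continuous_pow 2).tendsto (0 : ℝ)).eventually_lt_const (by simpa using mul_pos hα hβ)
  filter_upwards [nhdsWithin_le_nhds t2, nhdsWithin_le_nhds t3, self_mem_nhdsWithin]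
    with ε h2 h3 h4
  set e := toC b - toC a
  have he : e ≠ 0 := toC_sub_ne_zero hab.symm
  -- After division by `e` the vector `b - a` becomes `1` and `n` becomes `I`. From the mirrored eye
  -- the ratio is the conjugate of `z`, so the two sight angles are `arg z` and `-arg z`.
  set z : ℂ := (α - ε * Complex.I) / (-β - ε * Complex.I) with hz
  have hden : (-β - ε * Complex.I : ℂ) ≠ 0 := by
    intro h
    have := congrArg Complex.re h
    simp at this
    exact hβ.ne' this
  have hα' : α = 1 - β := by linarith
  have w1 : sightAngle a b (y + ε • n) = z.arg := by
    unfold sightAngle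
    congr 1
    have p1 : toC b - toC (y + ε • n) = (α - ε * Complex.I) * e := by
      apply Complex.ext <;> simp [y, n, e, hα'] <;> ring
    have p2 : toC a - toC (y + ε • n) = (-β - ε * Complex.I) * e := by
      apply Complex.ext <;> simp [y, n, e, hα'] <;> ring
    rw [p1, p2, mul_div_mul_right _ _ he]
  have w2 : sightAngle a b (y - ε • n) = ((starRingEnd ℂ) z).arg := by
    unfold sightAngle
    congr 1
    have p1 : toC b - toC (y - ε • n) = (starRingEnd ℂ) (α - ε * Complex.I) * e := by
      apply Complex.ext <;> simp [y, n, e, hα'] <;> ring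
    have p2 : toC a - toC (y - ε • n) = (starRingEnd ℂ) (-β - ε * Complex.I) * e := by
      apply Complex.ext <;> simp [y, n, e, hα'] <;> ring
    rw [p1, p2, mul_div_mul_right _ _ he, hz, map_div₀]
  -- The numerator of the real part is `ε ^ 2 - α * β`. A negative real part makes `|arg z|` exceed
  -- `π / 2`, so the sight angle jumps by more than `π`, while `g` varies by less.
  have hre : z.re < 0 := by
    rw [hz, Complex.div_re]
    simp only [Complex.sub_re, Complex.sub_im, Complex.neg_re, Complex.neg_im, Complex.ofReal_re,
      Complex.ofReal_im, Complex.mul_re, Complex.mul_im, Complex.I_re, Complex.I_im]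
    rw [← add_div]
    refine div_neg_of_neg_of_pos ?_ (Complex.normSq_pos.2 hden)
    nlinarith
  have hne : z.arg ≠ Real.pi := by
    intro h
    have him := (Complex.arg_eq_pi_iff.1 h).2
    rw [hz, Complex.div_im] at him
    have hn := (Complex.normSq_pos.2 hden).ne'
    simp only [Complex.sub_re, Complex.sub_im, Complex.neg_re, Complex.neg_im, Complex.ofReal_re,
      Complex.ofReal_im, Complex.mul_re, Complex.mul_im, Complex.I_re, Complex.I_im] at him
    field_simp at him
    apply h4
    have : ε * (α + β) = 0 := by linarith
    simpa [hαβ] using this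
  have habs : Real.pi / 2 < |z.arg| := by
    by_contra! h
    exact absurd (Complex.abs_arg_le_pi_div_two_iff.1 h) (by linarith)
  rw [hf, hf, w1, w2, Complex.arg_conj, if_neg hne]
  intro h
  have : g (y + ε • n) - g (y - ε • n) = -(2 * z.arg) := by linarith
  rw [this, abs_neg, abs_mul, abs_two] at h2
  linarith

/-! ### Winding numbers of closed polygonal lines -/

/-- The total angle through which the closed polygonal line `z 0, …, z N, q, z 0` turns,
as seen from `x`. -/
noncomputable def loopAngle (z : ℕ → Plane) (N : ℕ) (q x : Plane) : ℝ :=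
  ∑ t ∈ Finset.range N, sightAngle (z t) (z (t + 1)) x + sightAngle (z N) q x +
    sightAngle q (z 0) x

/-- The closed polygonal line `z 0, …, z N, q, z 0` as a set. -/
def loopTrace (z : ℕ → Plane) (N : ℕ) (q : Plane) : Set Plane :=
  (⋃ t ∈ Finset.range N, segment ℝ (z t) (z (t + 1))) ∪ segment ℝ (z N) q ∪ segment ℝ q (z 0)

theorem isCompact_segment (a b : Plane) : IsCompact (segment ℝ a b) := by
  rw [segment_eq_image_lineMap]
  exact isCompact_Icc.image AffineMap.lineMap_continuous

theorem isCompact_loopTrace (z : ℕ → Plane) (N : ℕ) (q : Plane) : IsCompact (loopTrace z N q) :=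
  (((Finset.range N).isCompact_biUnion fun _ _ => isCompact_segment _ _).union
    (isCompact_segment _ _)).union (isCompact_segment _ _)

section loop

variable {z : ℕ → Plane} {N : ℕ} {q x : Plane}

theorem notMem_loopTrace : x ∉ loopTrace z N q ↔
    (∀ t < N, x ∉ segment ℝ (z t) (z (t + 1))) ∧ x ∉ segment ℝ (z N) q ∧ x ∉ segment ℝ q (z 0) := by
  simp [loopTrace, and_assoc]

/-- Modulo `2π` each sight angle is a difference of arguments, and the sum telescopes around the
loop. -/
theorem coe_loopAngle (hx : x ∉ loopTrace z N q) : (loopAngle z N q x : Real.Angle) = 0 := by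
  obtain ⟨h1, h2, h3⟩ := notMem_loopTrace.1 hx
  have hN : ∀ M ≤ N, ((∑ t ∈ Finset.range M, sightAngle (z t) (z (t + 1)) x : ℝ) : Real.Angle) =
      ((toC (z M) - toC x).arg : Real.Angle) - ((toC (z 0) - toC x).arg : Real.Angle) := by
    intro M
    induction M with
    | zero => simp
    | succ M ih =>
      intro hM
      rw [Finset.sum_range_succ, Real.Angle.coe_add, ih (by omega), coe_sightAngle]
      · abel
      · rintro rfl
        exact h1 M (by omega) (left_mem_segment ℝ _ _)
      · rintro rfl
        exact h1 M (by omega) (right_mem_segment ℝ _ _)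
  have hq : q ≠ x := by
    rintro rfl
    exact h2 (right_mem_segment ℝ _ _)
  rw [loopAngle, Real.Angle.coe_add, Real.Angle.coe_add, hN N le_rfl, coe_sightAngle _ hq,
    coe_sightAngle hq]
  · abel
  · rintro rfl
    exact h3 (right_mem_segment ℝ _ _)
  · rintro rfl
    exact h2 (left_mem_segment ℝ _ _)

theorem loopAngle_mem_zmultiples (hx : x ∉ loopTrace z N q) :
    loopAngle z N q x ∈ AddSubgroup.zmultiples (2 * Real.pi) := by
  obtain ⟨n, hn⟩ := Real.Angle.coe_eq_zero_iff.1 (coe_loopAngle hx)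
  exact ⟨n, hn⟩

theorem continuousAt_loopAngle (hx : x ∉ loopTrace z N q) : ContinuousAt (loopAngle z N q) x := by
  obtain ⟨h1, h2, h3⟩ := notMem_loopTrace.1 hx
  refine ContinuousAt.add (ContinuousAt.add ?_ (continuousAt_sightAngle h2))
    (continuousAt_sightAngle h3)
  exact tendsto_finsetSum _ fun t ht => continuousAt_sightAngle (h1 t (Finset.mem_range.1 ht))

theorem isDiscrete_angles : IsDiscrete (AddSubgroup.zmultiples (2 * Real.pi) : Set ℝ) :=
  SetLike.isDiscrete_iff_discreteTopology.2 inferInstance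

/-- Off the trace the total angle is continuous with values in the discrete group of multiples of
`2π`. -/
theorem loopAngle_eq_of_isPreconnected {S : Set Plane} (hS : IsPreconnected S)
    (hd : Disjoint S (loopTrace z N q)) {x y : Plane} (hx : x ∈ S) (hy : y ∈ S) :
    loopAngle z N q x = loopAngle z N q y :=
  hS.constant_of_mapsTo isDiscrete_angles
    (fun _ hx => (continuousAt_loopAngle (disjoint_left.1 hd hx)).continuousWithinAt)
    (fun _ hx => loopAngle_mem_zmultiples (disjoint_left.1 hd hx)) hx hy

theorem loopAngle_eq_zero_of_abs_lt (hx : x ∉ loopTrace z N q)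
    (hlt : |loopAngle z N q x| < 2 * Real.pi) : loopAngle z N q x = 0 := by
  obtain ⟨n, hn⟩ := loopAngle_mem_zmultiples hx
  simp only [zsmul_eq_mul] at hn
  rw [← hn] at hlt ⊢
  rw [abs_mul, abs_of_pos Real.two_pi_pos] at hlt
  have h4 : |(n : ℝ)| < 1 := by
    by_contra! h
    nlinarith [Real.two_pi_pos]
  have h5 : n = 0 := by
    rw [← Int.cast_abs] at h4
    exact Int.abs_lt_one_iff.1 (by exact_mod_cast h4)
  simp [h5]

/-- All sight angles tend to `0` at infinity, so an unbounded set contains a point whose total angle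
is below `2π` in absolute value, hence zero. -/
theorem loopAngle_eq_zero_of_unbounded {S : Set Plane} (hS : IsPreconnected S)
    (hd : Disjoint S (loopTrace z N q)) (hb : ¬ Bornology.IsBounded S) (hx : x ∈ S) :
    loopAngle z N q x = 0 := by
  have h1 : Tendsto (loopAngle z N q) (Bornology.cobounded Plane) (𝓝 0) := by
    have : Tendsto (loopAngle z N q) (Bornology.cobounded Plane)
        (𝓝 (∑ t ∈ Finset.range N, (0 : ℝ) + 0 + 0)) :=
      ((tendsto_finsetSum _ fun t _ => tendsto_sightAngle _ _).add (tendsto_sightAngle _ _)).add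
        (tendsto_sightAngle _ _)
    simpa using this
  have h2 : ∀ᶠ y in Bornology.cobounded Plane, |loopAngle z N q y| < 2 * Real.pi :=
    h1.abs.eventually_lt_const (by simpa using Real.pi_pos)
  have h3 : ∃ y ∈ S, |loopAngle z N q y| < 2 * Real.pi := by
    by_contra! h
    apply hb
    rw [Bornology.isBounded_def]
    filter_upwards [h2] with y hy hyS
    exact absurd hy (not_lt.2 (h y hyS))
  obtain ⟨y, hy, hlt⟩ := h3
  rw [loopAngle_eq_of_isPreconnected hS hd hx hy]
  exact loopAngle_eq_zero_of_abs_lt (disjoint_left.1 hd hy) hlt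

/-- The total angle of a closed polygonal line changes when the eye crosses an edge, away from
the other edges. -/
theorem loopAngle_jump {t : ℕ} (ht : t < N) {y : Plane} (hne : z t ≠ z (t + 1))
    (hy : y ∈ openSegment ℝ (z t) (z (t + 1)))
    (h1 : ∀ s < N, s ≠ t → y ∉ segment ℝ (z s) (z (s + 1))) (h2 : y ∉ segment ℝ (z N) q)
    (h3 : y ∉ segment ℝ q (z 0)) {a : Plane} {c : ℝ} (hc : c ≠ 0)
    (ha : a = c • (z (t + 1) - z t)) :
    ∀ᶠ ε : ℝ in 𝓝[≠] 0,
      loopAngle z N q (y + ε • rot a) ≠ loopAngle z N q (y - ε • rot a) := by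
  have key := eventually_ne_of_jump (f := loopAngle z N q)
    (g := fun x => ∑ s ∈ (Finset.range N).erase t, sightAngle (z s) (z (s + 1)) x +
      sightAngle (z N) q x + sightAngle q (z 0) x) hne hy (fun x => by
        rw [loopAngle, ← Finset.add_sum_erase _ _ (Finset.mem_range.2 ht)]
        ring)
    (((tendsto_finsetSum _ fun s hs => continuousAt_sightAngle (h1 s
      (Finset.mem_range.1 (Finset.mem_of_mem_erase hs)) (Finset.ne_of_mem_erase hs))).add
      (continuousAt_sightAngle h2)).add (continuousAt_sightAngle h3))
  -- `key` moves along `rot (z (t + 1) - z t)`; rescaling `ε` by `c` turns this into motion along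
  -- `rot a`.
  have hten : Tendsto (fun ε : ℝ => ε * c) (𝓝[≠] 0) (𝓝[≠] 0) := by
    refine tendsto_nhdsWithin_iff.2 ⟨?_, ?_⟩
    · have : Continuous fun ε : ℝ => ε * c := by fun_prop
      simpa using (this.tendsto 0).mono_left nhdsWithin_le_nhds
    · filter_upwards [self_mem_nhdsWithin] with ε hε using mul_ne_zero hε hc
  filter_upwards [hten.eventually key] with ε hε
  rw [ha, rot_smul, smul_smul]
  exact hε

end loop

/-- Sight angles along a segment are additive. -/
theorem sightAngle_add {a b q x : Plane} (hq : q ∈ segment ℝ a b) (hx : x ∉ segment ℝ a b) :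
    sightAngle a q x + sightAngle q b x = sightAngle a b x := by
  rw [segment_eq_image_lineMap] at hq
  obtain ⟨θ, hθ, rfl⟩ := hq
  set l : ℝ → Plane := fun s => AffineMap.lineMap a b s
  have hl : Continuous l := AffineMap.lineMap_continuous
  have hseg : ∀ s ∈ Icc (0 : ℝ) 1, segment ℝ a (l s) ⊆ segment ℝ a b ∧
      segment ℝ (l s) b ⊆ segment ℝ a b := by
    intro s hs
    have hm : l s ∈ segment ℝ a b := by
      rw [segment_eq_image_lineMap]
      exact ⟨s, hs, rfl⟩
    exact ⟨(convex_segment a b).segment_subset (left_mem_segment ℝ a b) hm,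
      (convex_segment a b).segment_subset hm (right_mem_segment ℝ a b)⟩
  -- Slide the division point along the segment: the defect of additivity is continuous, takes
  -- values in the multiples of `2π`, and vanishes when the point is at `a`.
  have hc := (isPreconnected_Icc (a := (0 : ℝ)) (b := 1)).constant_of_mapsTo isDiscrete_angles
    (f := fun s => sightAngle a (l s) x + sightAngle (l s) b x - sightAngle a b x) ?_ ?_
    hθ (left_mem_Icc.2 zero_le_one)
  · simp only [l, AffineMap.lineMap_apply_zero, sightAngle_self] at hc
    linarith
  · intro s hs
    refine ContinuousWithinAt.sub (ContinuousWithinAt.add ?_ ?_) continuousWithinAt_const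
    · have h1 := ratio_mem_slitPlane (fun h => hx ((hseg s hs).1 h))
      refine ContinuousAt.continuousWithinAt (ContinuousAt.comp (g := Complex.arg)
        (f := fun s => (toC (l s) - toC x) / (toC a - toC x)) (Complex.continuousAt_arg h1) ?_)
      exact (((continuous_toC.comp hl).sub continuous_const).div_const _).continuousAt
    · have h1 := ratio_mem_slitPlane (fun h => hx ((hseg s hs).2 h))
      refine ContinuousAt.continuousWithinAt (ContinuousAt.comp (g := Complex.arg)
        (f := fun s => (toC b - toC x) / (toC (l s) - toC x)) (Complex.continuousAt_arg h1) ?_)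
      refine continuousAt_const.div ((continuous_toC.comp hl).sub continuous_const).continuousAt ?_
      refine toC_sub_ne_zero ?_
      rintro h
      exact hx ((hseg s hs).2 (h ▸ left_mem_segment ℝ _ _))
  · intro s hs
    have ha : a ≠ x := fun h => hx (h ▸ left_mem_segment ℝ _ _)
    have hb : b ≠ x := fun h => hx (h ▸ right_mem_segment ℝ _ _)
    have hls : l s ≠ x := fun h => hx ((hseg s hs).2 (h ▸ left_mem_segment ℝ _ _))
    have : ((sightAngle a (l s) x + sightAngle (l s) b x - sightAngle a b x : ℝ) : Real.Angle) =
        0 := by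
      rw [Real.Angle.coe_sub, Real.Angle.coe_add, coe_sightAngle ha hls, coe_sightAngle hls hb,
        coe_sightAngle ha hb]
      abel
    obtain ⟨n, hn⟩ := Real.Angle.coe_eq_zero_iff.1 this
    exact ⟨n, hn⟩

/-! ### Two rays cutting a disc into two connected pieces -/

/-- The ray from `y` in direction `a`. -/
def ray (y a : Plane) : Set Plane := {x | ∃ s : ℝ, 0 ≤ s ∧ x = y + s • a}

/-- The open half-plane to the left of the line through `y` in direction `w`. -/
def halfPlane (w y : Plane) : Set Plane := {x | 0 < cross w (x - y)}

theorem convex_halfPlane (w y : Plane) : Convex ℝ (halfPlane w y) := by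
  intro x hx z hz α β hα hβ hαβ
  have h : cross w (α • x + β • z - y) = α * cross w (x - y) + β * cross w (z - y) := by
    have : α • x + β • z - y = α • (x - y) + β • (z - y) := by
      rw [smul_sub, smul_sub, sub_add_sub_comm, ← add_smul, hαβ, one_smul]
    rw [this, cross_add_right, cross_smul_right, cross_smul_right]
  simp only [halfPlane, mem_ofPred_eq] at *
  rw [h]
  rcases hα.eq_or_lt with rfl | hα
  · obtain rfl : β = 1 := by linarith
    simpa using hz
  · have := mul_pos hα hx
    have := mul_nonneg hβ hz.le
    linarith

theorem tendsto_add_smul (x u : Plane) : Tendsto (fun ε : ℝ => x + ε • u) (𝓝[>] 0) (𝓝 x) := by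
  have : Continuous (fun ε : ℝ => x + ε • u) := by fun_prop
  simpa using (this.tendsto 0).mono_left nhdsWithin_le_nhds

theorem mem_closure_of_eventually_add_smul {x u : Plane} {U : Set Plane}
    (h : ∀ᶠ ε : ℝ in 𝓝[>] 0, x + ε • u ∈ U) : x ∈ closure U :=
  mem_closure_of_tendsto (tendsto_add_smul x u) h

theorem eventually_add_smul_mem {x : Plane} (u : Plane) {U : Set Plane} (hU : IsOpen U)
    (hx : x ∈ U) : ∀ᶠ ε : ℝ in 𝓝[>] 0, x + ε • u ∈ U :=
  (tendsto_add_smul x u).eventually (hU.mem_nhds hx)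

/-- `U` and `V` are the two connected pieces into which the rays from `y` in the directions `a`
and `b` cut the disc of radius `r` about `y`. -/
structure IsStarSplit (y a b : Plane) (r : ℝ) (U V : Set Plane) : Prop where
  preconnected_left : IsPreconnected U
  preconnected_right : IsPreconnected V
  union_eq : U ∪ V = Metric.ball y r \ (ray y a ∪ ray y b)
  subset_closure_left : Metric.ball y r ∩ (ray y a ∪ ray y b) ⊆ closure U
  subset_closure_right : Metric.ball y r ∩ (ray y a ∪ ray y b) ⊆ closure V
  cross_ray : ∀ s : ℝ, 0 < s → y + s • a ∈ Metric.ball y r → ∀ᶠ ε : ℝ in 𝓝[>] 0,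
    (y + s • a + ε • rot a ∈ U ∧ y + s • a - ε • rot a ∈ V) ∨
      (y + s • a + ε • rot a ∈ V ∧ y + s • a - ε • rot a ∈ U)

/-- The open angular sector between the directions `a` and `b`, by linear inequalities. -/
def sector (y a b : Plane) : Set Plane :=
  halfPlane (-(cross a b)⁻¹ • b) y ∩ halfPlane ((cross a b)⁻¹ • a) y

/-- The complement of the closed angular sector between the directions `a` and `b`. -/
def cosector (y a b : Plane) : Set Plane :=
  halfPlane ((cross a b)⁻¹ • b) y ∪ halfPlane (-(cross a b)⁻¹ • a) y

section indep

variable {a b : Plane} (h : cross a b ≠ 0)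
include h

/-- Cramer's rule. The functionals that define `sector` and `cosector` are the coordinates in the
basis `a`, `b`, so membership becomes a condition on signs. -/
theorem cross_coords (x : Plane) :
    x = cross (-(cross a b)⁻¹ • b) x • a + cross ((cross a b)⁻¹ • a) x • b := by
  have h1 := cross_decomp a b x
  rw [cross_smul_left, cross_smul_left, ← smul_right_injective _ h |>.eq_iff, h1]
  simp only [smul_add, smul_smul]
  rw [cross_swap b x]
  congr 2 <;> field_simp

theorem cross_coord_left (s t : ℝ) :
    cross (-(cross a b)⁻¹ • b) (s • a + t • b) = s := by
  rw [cross_add_right, cross_smul_right, cross_smul_right, cross_smul_left, cross_smul_left,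
    cross_self, cross_swap b a]
  field_simp
  ring

theorem cross_coord_right (s t : ℝ) :
    cross ((cross a b)⁻¹ • a) (s • a + t • b) = t := by
  rw [cross_add_right, cross_smul_right, cross_smul_right, cross_smul_left, cross_smul_left,
    cross_self]
  field_simp
  ring

theorem mem_sector_iff (y : Plane) (s t : ℝ) :
    y + (s • a + t • b) ∈ sector y a b ↔ 0 < s ∧ 0 < t := by
  simp only [sector, halfPlane, mem_inter_iff, mem_ofPred_eq, add_sub_cancel_left]
  rw [cross_coord_left h, cross_coord_right h]

theorem mem_cosector_iff (y : Plane) (s t : ℝ) :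
    y + (s • a + t • b) ∈ cosector y a b ↔ s < 0 ∨ t < 0 := by
  have e1 := cross_coord_left h s t
  have e2 := cross_coord_right h s t
  rw [neg_smul, cross_swap, ] at e1
  simp only [cosector, halfPlane, mem_union, mem_ofPred_eq, add_sub_cancel_left]
  rw [cross_smul_left] at *
  rw [cross_smul_left]
  have e3 : cross (-((cross a b)⁻¹ • b)) (s • a + t • b) =
    -((cross a b)⁻¹ * cross b (s • a + t • b)) := by
    rw [← neg_smul, cross_smul_left]; ring
  have e4 : -(cross a b)⁻¹ * cross a (s • a + t • b) =
    -((cross a b)⁻¹ * cross a (s • a + t • b)) := by ring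
  rw [cross_swap, e3] at e1
  rw [e4, e2]
  constructor <;> rintro (h' | h') <;> first | (left; linarith) | (right; linarith)

theorem exists_coords (y x : Plane) : ∃ s t : ℝ, x = y + (s • a + t • b) :=
  ⟨_, _, by rw [← cross_coords h (x - y)]; abel⟩

theorem sector_eq_openSector (y : Plane) : sector y a b = openSector (y + a) y (y + b) := by
  ext x
  obtain ⟨s, t, rfl⟩ := exists_coords h y x
  rw [mem_sector_iff h]
  simp only [openSector, mem_ofPred_eq, add_sub_cancel_left]
  constructor
  · rintro ⟨hs, ht⟩
    exact ⟨s, t, hs, ht, by abel⟩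
  · rintro ⟨s', t', hs', ht', he⟩
    rw [add_assoc, add_right_inj] at he
    have e1 := cross_coord_left h s t
    have e2 := cross_coord_right h s t
    rw [he, cross_coord_left h] at e1
    rw [he, cross_coord_right h] at e2
    exact ⟨e1 ▸ hs', e2 ▸ ht'⟩

theorem mem_rays_iff (y : Plane) (s t : ℝ) :
    y + (s • a + t • b) ∈ ray y a ∪ ray y b ↔ (0 ≤ s ∧ t = 0) ∨ (s = 0 ∧ 0 ≤ t) := by
  constructor
  · rintro (⟨s', hs', he⟩ | ⟨t', ht', he⟩)
    · left
      rw [add_right_inj] at he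
      have e1 := cross_coord_left h s t
      have e2 := cross_coord_right h s t
      have he' : s • a + t • b = s' • a + (0 : ℝ) • b := by rw [he]; simp
      rw [he', cross_coord_left h] at e1
      rw [he', cross_coord_right h] at e2
      exact ⟨e1 ▸ hs', e2.symm⟩
    · right
      rw [add_right_inj] at he
      have e1 := cross_coord_left h s t
      have e2 := cross_coord_right h s t
      have he' : s • a + t • b = (0 : ℝ) • a + t' • b := by rw [he]; simp
      rw [he', cross_coord_left h] at e1
      rw [he', cross_coord_right h] at e2
      exact ⟨e1.symm, e2 ▸ ht'⟩
  · rintro (⟨hs, rfl⟩ | ⟨rfl, ht⟩)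
    · exact Or.inl ⟨s, hs, by simp⟩
    · exact Or.inr ⟨t, ht, by simp⟩

theorem isStarSplit_sector (y : Plane) {r : ℝ} (hr : 0 < r) :
    IsStarSplit y a b r (sector y a b ∩ Metric.ball y r) (cosector y a b ∩ Metric.ball y r) where
  preconnected_left :=
    (((convex_halfPlane _ _).inter (convex_halfPlane _ _)).inter (convex_ball y r)).isPreconnected
  preconnected_right := by
    -- The cosector is a union of two convex sets; a small multiple of `-a - b` leads to a common
    -- point of both in the disc.
    have hev := eventually_add_smul_mem (-a - b) Metric.isOpen_ball (Metric.mem_ball_self hr)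
      (x := y)
    obtain ⟨ε, hε, hε0⟩ := (hev.and self_mem_nhdsWithin).exists
    have hε0 : 0 < ε := hε0
    have e : y + ε • (-a - b) = y + ((-ε) • a + (-ε) • b) := by
      rw [smul_sub, smul_neg, neg_smul, neg_smul, sub_eq_add_neg]
    have e1 := cross_coord_left h (-ε) (-ε)
    have e2 := cross_coord_right h (-ε) (-ε)
    rw [cross_smul_left] at e1 e2
    rw [cosector, union_inter_distrib_right]
    refine IsPreconnected.union (y + ε • (-a - b)) ⟨?_, hε⟩ ⟨?_, hε⟩
      ((convex_halfPlane _ _).inter (convex_ball y r)).isPreconnected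
      ((convex_halfPlane _ _).inter (convex_ball y r)).isPreconnected
    · simp only [halfPlane, mem_ofPred_eq, e, add_sub_cancel_left]
      rw [cross_smul_left]
      linarith
    · simp only [halfPlane, mem_ofPred_eq, e, add_sub_cancel_left]
      rw [cross_smul_left]
      linarith
  union_eq := by
    ext x
    obtain ⟨s, t, rfl⟩ := exists_coords h y x
    rw [mem_union, mem_inter_iff, mem_inter_iff, mem_sector_iff h, mem_cosector_iff h, Set.mem_sdiff,
      mem_rays_iff h, ← or_and_right, and_comm]
    refine and_congr_right fun _ => ?_
    constructor
    · rintro (⟨h1, h2⟩ | h1 | h1) (⟨h3, h4⟩ | ⟨h3, h4⟩) <;> linarith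
    · intro h1
      push Not at h1
      rcases lt_trichotomy s 0 with h2 | h2 | h2
      · exact Or.inr (Or.inl h2)
      · exact Or.inr (Or.inr (h1.2 h2))
      · rcases lt_trichotomy t 0 with h3 | h3 | h3
        · exact Or.inr (Or.inr h3)
        · exact absurd h3 (h1.1 h2.le)
        · exact Or.inl ⟨h2, h3⟩
  subset_closure_left := by
    rintro x ⟨hx, hx'⟩
    obtain ⟨s, t, rfl⟩ := exists_coords h y x
    rw [mem_rays_iff h] at hx'
    refine mem_closure_of_eventually_add_smul (u := a + b) ?_
    filter_upwards [eventually_add_smul_mem (a + b) Metric.isOpen_ball hx, self_mem_nhdsWithin]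
      with ε h1 h2
    refine ⟨?_, h1⟩
    have h2 : 0 < ε := h2
    have e : y + (s • a + t • b) + ε • (a + b) = y + ((s + ε) • a + (t + ε) • b) := by
      rw [smul_add, add_smul, add_smul]; abel
    rw [e, mem_sector_iff h]
    rcases hx' with ⟨h3, h4⟩ | ⟨h3, h4⟩ <;> constructor <;> linarith
  subset_closure_right := by
    rintro x ⟨hx, hx'⟩
    obtain ⟨s, t, rfl⟩ := exists_coords h y x
    rw [mem_rays_iff h] at hx'
    refine mem_closure_of_eventually_add_smul (u := -a - b) ?_
    filter_upwards [eventually_add_smul_mem (-a - b) Metric.isOpen_ball hx, self_mem_nhdsWithin]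
      with ε h1 h2
    refine ⟨?_, h1⟩
    have h2 : 0 < ε := h2
    have e : y + (s • a + t • b) + ε • (-a - b) = y + ((s - ε) • a + (t - ε) • b) := by
      rw [smul_sub, sub_smul, sub_smul, smul_neg]; abel
    rw [e, mem_cosector_iff h]
    rcases hx' with ⟨h3, h4⟩ | ⟨h3, h4⟩
    · right; linarith
    · left; linarith
  cross_ray := by
    intro s hs hx
    have ha : a ≠ 0 := by
      rintro rfl
      exact h (by simp [cross])
    -- The sign of `τ`, the coordinate of `rot a` along `b`, tells which side of the ray belongs to
    -- the sector. It is nonzero because `rot a` is not parallel to `a`.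
    obtain ⟨σ, τ, he⟩ := exists_coords h 0 (rot a)
    rw [zero_add] at he
    have hτ : τ ≠ 0 := by
      rintro rfl
      have := cross_rot_pos ha
      rw [he, zero_smul, add_zero, cross_smul_right, cross_self] at this
      linarith
    have hrot : ∀ ε : ℝ, y + s • a + ε • rot a = y + ((s + ε * σ) • a + (ε * τ) • b) := by
      intro ε
      rw [he, smul_add, add_smul, smul_smul, smul_smul]; abel
    have hrot' : ∀ ε : ℝ, y + s • a - ε • rot a = y + ((s - ε * σ) • a + (-(ε * τ)) • b) := by
      intro ε
      rw [he, smul_add, sub_smul, smul_smul, smul_smul, neg_smul]; abel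
    have h1 : ∀ᶠ ε : ℝ in 𝓝[>] 0, |ε * σ| < s := by
      have : Continuous fun ε : ℝ => |ε * σ| := by fun_prop
      exact ((this.tendsto 0).mono_left nhdsWithin_le_nhds).eventually_lt_const (by simpa using hs)
    have hb1 := eventually_add_smul_mem (rot a) Metric.isOpen_ball hx
    have hb2 := eventually_add_smul_mem (-rot a) Metric.isOpen_ball hx
    filter_upwards [h1, hb1, hb2, self_mem_nhdsWithin] with ε h2 h3 h4 h5
    have h5 : 0 < ε := h5
    rw [abs_lt] at h2
    rw [smul_neg, ← sub_eq_add_neg] at h4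
    rcases lt_or_gt_of_ne hτ with h6 | h6
    · right
      have h7 : ε * τ < 0 := mul_neg_of_pos_of_neg h5 h6
      refine ⟨⟨?_, h3⟩, ?_, h4⟩
      · rw [hrot, mem_cosector_iff h]
        exact Or.inr h7
      · rw [hrot', mem_sector_iff h]
        constructor <;> linarith
    · left
      have h7 : 0 < ε * τ := mul_pos h5 h6
      refine ⟨⟨?_, h3⟩, ?_, h4⟩
      · rw [hrot, mem_sector_iff h]
        constructor <;> linarith
      · rw [hrot', mem_cosector_iff h]
        right; linarith

end indep

/-- The case of opposite directions: the two rays make up a full line and the pieces are half-discs.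
-/
theorem isStarSplit_halfPlane {a b : Plane} (y : Plane) {r c : ℝ} (ha : a ≠ 0) (hc : c < 0)
    (hb : b = c • a) :
    IsStarSplit y a b r (halfPlane a y ∩ Metric.ball y r) (halfPlane (-a) y ∩ Metric.ball y r) := by
  have hneg : ∀ x, cross (-a) x = -cross a x := fun x => by simp [cross]; ring
  have hmem : ∀ x, x ∈ ray y a ∪ ray y b ↔ cross a (x - y) = 0 := by
    intro x
    constructor
    · rintro (⟨s, _, rfl⟩ | ⟨s, _, rfl⟩)
      · rw [add_sub_cancel_left, cross_smul_right, cross_self, mul_zero]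
      · rw [add_sub_cancel_left, hb, cross_smul_right, cross_smul_right, cross_self, mul_zero,
          mul_zero]
    · intro hx
      obtain ⟨s, hs⟩ := exists_smul_of_cross_eq_zero ha hx
      rcases le_or_gt 0 s with h | h
      · exact Or.inl ⟨s, h, by rw [← hs]; abel⟩
      · refine Or.inr ⟨s / c, div_nonneg_of_nonpos h.le hc.le, ?_⟩
        rw [hb, smul_smul, div_mul_cancel₀ _ hc.ne, ← hs]; abel
  have hstep : ∀ x u : Plane, ∀ ε : ℝ, cross a (x + ε • u - y) = cross a (x - y) + ε * cross a u := by
    intro x u ε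
    rw [← cross_smul_right, ← cross_add_right]; congr 1; abel
  have hpos := cross_rot_pos ha
  refine ⟨((convex_halfPlane _ _).inter (convex_ball y r)).isPreconnected,
    ((convex_halfPlane _ _).inter (convex_ball y r)).isPreconnected, ?_, ?_, ?_, ?_⟩
  · ext x
    rw [Set.mem_sdiff, hmem]
    simp only [halfPlane, mem_union, mem_inter_iff, mem_ofPred_eq, hneg]
    constructor
    · rintro (⟨h1, h2⟩ | ⟨h1, h2⟩)
      · exact ⟨h2, h1.ne'⟩
      · exact ⟨h2, by linarith [h1] |> fun h : cross a (x - y) < 0 => h.ne⟩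
    · rintro ⟨h1, h2⟩
      rcases lt_or_gt_of_ne h2 with h3 | h3
      · exact Or.inr ⟨by linarith, h1⟩
      · exact Or.inl ⟨h3, h1⟩
  · rintro x ⟨hx, hx'⟩
    rw [hmem] at hx'
    refine mem_closure_of_eventually_add_smul (u := rot a) ?_
    filter_upwards [eventually_add_smul_mem (rot a) Metric.isOpen_ball hx, self_mem_nhdsWithin]
      with ε h1 h2
    refine ⟨?_, h1⟩
    simp only [halfPlane, mem_ofPred_eq, hstep, hx']
    have := mul_pos (show 0 < ε from h2) hpos
    linarith
  · rintro x ⟨hx, hx'⟩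
    rw [hmem] at hx'
    refine mem_closure_of_eventually_add_smul (u := -rot a) ?_
    filter_upwards [eventually_add_smul_mem (-rot a) Metric.isOpen_ball hx, self_mem_nhdsWithin]
      with ε h1 h2
    refine ⟨?_, h1⟩
    simp only [halfPlane, mem_ofPred_eq, hneg]
    rw [smul_neg, ← neg_smul, hstep, hx']
    have := mul_pos (show 0 < ε from h2) hpos
    linarith
  · intro s hs hx
    filter_upwards [eventually_add_smul_mem (rot a) Metric.isOpen_ball hx,
      eventually_add_smul_mem (-rot a) Metric.isOpen_ball hx, self_mem_nhdsWithin] with ε h1 h2 h3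
    have := mul_pos (show 0 < ε from h3) hpos
    have h0 : cross a (y + s • a - y) = 0 := by
      rw [add_sub_cancel_left, cross_smul_right, cross_self, mul_zero]
    rw [smul_neg, ← sub_eq_add_neg] at h2
    refine Or.inl ⟨⟨?_, h1⟩, ?_, h2⟩
    · simp only [halfPlane, mem_ofPred_eq]
      rw [hstep, h0]
      linarith
    · simp only [halfPlane, mem_ofPred_eq, hneg]
      rw [sub_eq_add_neg (y + s • a), ← neg_smul, hstep, h0]
      linarith

theorem exists_isStarSplit {a b : Plane} (y : Plane) {r : ℝ} (hr : 0 < r) (ha : a ≠ 0)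
    (hb : b ≠ 0) (hab : ∀ c : ℝ, 0 < c → b ≠ c • a) : ∃ U V, IsStarSplit y a b r U V := by
  by_cases h : cross a b = 0
  · obtain ⟨c, hc⟩ := exists_smul_of_cross_eq_zero ha h
    have hc0 : c < 0 := by
      rcases lt_trichotomy c 0 with h1 | h1 | h1
      · exact h1
      · exact absurd (by rw [hc, h1, zero_smul]) hb
      · exact absurd hc (hab c h1)
    exact ⟨_, _, isStarSplit_halfPlane y ha hc0 hc⟩
  · exact ⟨_, _, isStarSplit_sector h y hr⟩

/-! ### Inside, region and exterior of a set -/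

/-- The points off `K` whose component in the complement of `K` is bounded. -/
def insideOf (K : Set Plane) : Set Plane :=
  {x | x ∈ Kᶜ ∧ Bornology.IsBounded (connectedComponentIn Kᶜ x)}

/-- `K` together with the bounded components of its complement. -/
def regionOf (K : Set Plane) : Set Plane := K ∪ insideOf K

section region

variable {K S : Set Plane} {x y : Plane}

theorem mem_insideOf_of_isPreconnected (hS : IsPreconnected S) (hd : Disjoint S K) (hx : x ∈ S)
    (hy : y ∈ S) (h : x ∈ insideOf K) : y ∈ insideOf K := by
  refine ⟨disjoint_left.1 hd hy, ?_⟩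
  have : y ∈ connectedComponentIn Kᶜ x :=
    hS.subset_connectedComponentIn hx (disjoint_left.1 hd) hy
  rw [← connectedComponentIn_eq this]
  exact h.2

theorem notMem_regionOf_of_isPreconnected (hS : IsPreconnected S) (hd : Disjoint S K)
    (hx : x ∈ S) (hy : y ∈ S) (h : x ∉ regionOf K) : y ∉ regionOf K := by
  rintro (h' | h')
  · exact disjoint_left.1 hd hy h'
  · exact h (Or.inr (mem_insideOf_of_isPreconnected hS hd hy hx h'))

/-- The component of `x` off `K` is unbounded and consists of points outside the region, so it
misses the loop. -/
theorem loopAngle_eq_zero_of_notMem_regionOf {z : ℕ → Plane} {N : ℕ} {q : Plane}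
    (hK : loopTrace z N q ⊆ regionOf K) (hx : x ∉ regionOf K) : loopAngle z N q x = 0 := by
  have hxK : x ∈ Kᶜ := fun h => hx (Or.inl h)
  refine loopAngle_eq_zero_of_unbounded (S := connectedComponentIn Kᶜ x)
    isPreconnected_connectedComponentIn ?_ ?_ (mem_connectedComponentIn hxK)
  · refine disjoint_left.2 fun y hy hyt => ?_
    exact notMem_regionOf_of_isPreconnected isPreconnected_connectedComponentIn
      (disjoint_left.2 fun y hy => connectedComponentIn_subset _ _ hy)
      (mem_connectedComponentIn hxK) hy hx (hK hyt)
  · exact fun hb => hx (Or.inr ⟨hxK, hb⟩)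

theorem mem_insideOf_of_loopAngle_ne_zero {z : ℕ → Plane} {N : ℕ} {q : Plane}
    (hK : loopTrace z N q ⊆ regionOf K) (hx : x ∉ K) (h : loopAngle z N q x ≠ 0) :
    x ∈ insideOf K := by
  by_contra h'
  exact h (loopAngle_eq_zero_of_notMem_regionOf hK (by rintro (h'' | h'') <;> contradiction))

/-- A half-plane beyond a ball that contains `K` is connected, unbounded and disjoint from `K`. -/
theorem exists_notMem_regionOf (hK : Bornology.IsBounded K) : ∃ x, x ∉ regionOf K := by
  obtain ⟨R, hR⟩ := hK.exists_norm_le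
  have hle : ∀ x : Plane, x 0 ≤ ‖x‖ := fun x =>
    (le_abs_self _).trans (PiLp.norm_apply_le x 0)
  set H : Set Plane := {x | R < x 0}
  have hH : Convex ℝ H := by
    intro x hx z hz α β hα hβ hαβ
    simp only [H, mem_ofPred_eq, PiLp.add_apply, PiLp.smul_apply, smul_eq_mul] at *
    rcases hα.eq_or_lt with rfl | hα
    · obtain rfl : β = 1 := by linarith
      simpa using hz
    · have h1 : R = α * R + β * R := by rw [← add_mul, hαβ, one_mul]
      rw [h1]
      exact add_lt_add_of_lt_of_le (mul_lt_mul_of_pos_left hx hα)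
        (mul_le_mul_of_nonneg_left hz.le hβ)
  have hd : H ⊆ Kᶜ := fun x hx hxK => absurd (hx : R < x 0) (not_lt.2 ((hle x).trans (hR x hxK)))
  have hmem : ∀ C : ℝ, R < C → (!₂[C, 0] : Plane) ∈ H := fun C hC => by simpa [H] using hC
  refine ⟨!₂[R + 1, 0], ?_⟩
  have h0 := hmem (R + 1) (by linarith)
  rintro (h | ⟨_, h⟩)
  · exact hd h0 h
  · obtain ⟨C, hC⟩ := (h.subset (hH.isPreconnected.subset_connectedComponentIn h0 hd)).exists_norm_le
    have h1 := (hle _).trans (hC _ (hmem (max R C + 1) (by linarith [le_max_left R C])))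
    have h2 : (!₂[max R C + 1, 0] : Plane) 0 = max R C + 1 := rfl
    linarith [le_max_right R C]

/-- The total angle is constant on each of the two pieces, so one jump across the ray distinguishes
all their values. -/
theorem loopAngle_ne_of_isStarSplit {z : ℕ → Plane} {N : ℕ} {q : Plane} {U V : Set Plane}
    {a b : Plane} {r s : ℝ} (h : IsStarSplit y a b r U V) (hU : Disjoint U (loopTrace z N q))
    (hV : Disjoint V (loopTrace z N q)) (hs : 0 < s) (hball : y + s • a ∈ Metric.ball y r)
    (hjump : ∀ᶠ ε : ℝ in 𝓝[≠] 0, loopAngle z N q (y + s • a + ε • rot a) ≠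
      loopAngle z N q (y + s • a - ε • rot a)) {u v : Plane} (hu : u ∈ U) (hv : v ∈ V) :
    loopAngle z N q u ≠ loopAngle z N q v := by
  have hj : ∀ᶠ ε : ℝ in 𝓝[>] 0, _ := hjump.filter_mono (nhdsWithin_mono 0 fun x hx => ne_of_gt hx)
  obtain ⟨ε, h1, h2⟩ := ((h.cross_ray s hs hball).and hj).exists
  have eU := fun {x} hx => loopAngle_eq_of_isPreconnected h.preconnected_left hU (x := x) hx hu
  have eV := fun {x} hx => loopAngle_eq_of_isPreconnected h.preconnected_right hV (x := x) hx hv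
  rcases h1 with ⟨h3, h4⟩ | ⟨h3, h4⟩
  · rwa [eU h3, eV h4] at h2
  · rw [eU h4, eV h3] at h2
    exact h2.symm

end region

/-! ### Parametrized polygonal lines -/

theorem range_polygonalPath (w : ℕ → Plane) (m : ℕ) :
    range (polygonalPath w m) = {w 0} ∪ ⋃ t ∈ Finset.range m, segment ℝ (w t) (w (t + 1)) := by
  induction m with
  | zero => simp [polygonalPath]
  | succ m ih =>
    rw [polygonalPath, Path.trans_range, ih, Path.range_segment, Finset.range_add_one,
      Finset.set_biUnion_insert, union_assoc, union_comm (⋃ t ∈ Finset.range m, _)]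

/-- The parametrization of an infinite polygonal line that is affine between consecutive
natural numbers. -/
noncomputable def param (p : ℕ → Plane) (s : ℝ) : Plane :=
  AffineMap.lineMap (p ⌊s⌋₊) (p (⌊s⌋₊ + 1)) (s - ⌊s⌋₊)

theorem param_natCast (p : ℕ → Plane) (t : ℕ) : param p t = p t := by simp [param]

/-- The end `s = t + 1` is included although the floor jumps there: the adjacent affine pieces agree
at the vertex. -/
theorem param_eq_lineMap (p : ℕ → Plane) {s : ℝ} {t : ℕ} (h1 : t ≤ s) (h2 : s ≤ t + 1) :
    param p s = AffineMap.lineMap (p t) (p (t + 1)) (s - t) := by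
  rcases h2.eq_or_lt with rfl | h2
  · rw [← Nat.cast_add_one, param_natCast]
    simp
  · have : ⌊s⌋₊ = t := (Nat.floor_eq_iff ((Nat.cast_nonneg t).trans h1)).2 ⟨h1, h2⟩
    rw [param, this]

theorem segment_param (p : ℕ → Plane) {s s' : ℝ} {t : ℕ} (h1 : t ≤ s) (h2 : s ≤ s')
    (h3 : s' ≤ t + 1) : segment ℝ (param p s) (param p s') = param p '' Icc s s' := by
  rw [param_eq_lineMap p h1 (h2.trans h3), param_eq_lineMap p (h1.trans h2) h3,
    ← image_segment, segment_eq_Icc (by linarith)]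
  ext x
  constructor
  · rintro ⟨u, hu, rfl⟩
    refine ⟨u + t, ⟨by linarith [hu.1], by linarith [hu.2]⟩, ?_⟩
    rw [param_eq_lineMap p (t := t) (by linarith [hu.1]) (by linarith [hu.2]), add_sub_cancel_right]
  · rintro ⟨u, hu, rfl⟩
    refine ⟨u - t, ⟨by linarith [hu.1], by linarith [hu.2]⟩, ?_⟩
    rw [param_eq_lineMap p (t := t) (by linarith [hu.1]) (by linarith [hu.2])]

theorem segment_eq_param (p : ℕ → Plane) (t : ℕ) :
    segment ℝ (p t) (p (t + 1)) = param p '' Icc (t : ℝ) (t + 1) := by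
  rw [← segment_param p le_rfl (by linarith) le_rfl, param_natCast, ← Nat.cast_add_one,
    param_natCast]

theorem biUnion_segment_eq_param (p : ℕ → Plane) {k l : ℕ} (h : k < l) :
    ⋃ t ∈ Finset.Ico k l, segment ℝ (p t) (p (t + 1)) = param p '' Icc (k : ℝ) l := by
  ext x
  simp only [mem_iUnion, Finset.mem_Ico, segment_eq_param]
  constructor
  · rintro ⟨t, ⟨h1, h2⟩, s, hs, rfl⟩
    refine ⟨s, ⟨le_trans (by exact_mod_cast h1) hs.1, hs.2.trans (by exact_mod_cast h2)⟩, rfl⟩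
  · rintro ⟨s, hs, rfl⟩
    rcases hs.2.eq_or_lt with rfl | h2
    · obtain ⟨l, rfl⟩ : ∃ l', l = l' + 1 := ⟨l - 1, by omega⟩
      exact ⟨l, ⟨by omega, by omega⟩, ((l + 1 : ℕ) : ℝ), by simp, rfl⟩
    · have h0 : 0 ≤ s := (Nat.cast_nonneg k).trans hs.1
      exact ⟨⌊s⌋₊, ⟨Nat.le_floor hs.1, (Nat.floor_lt h0).2 h2⟩, s,
        ⟨Nat.floor_le h0, (Nat.lt_floor_add_one s).le⟩, rfl⟩

/-! ### Simple loops: the local and global shape of the boundary -/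

/-- The vertices of a simple closed polygon, repeated periodically. -/
structure IsSimpleLoop (p : ℕ → Plane) (n : ℕ) : Prop where
  three_le : 3 ≤ n
  periodic : ∀ t, p (t + n) = p t
  param_ne : ∀ s s' : ℝ, 0 ≤ s → s < s' → s' < s + n → param p s ≠ param p s'

/-- The boundary of the polygon with vertices `p 0, …, p (n - 1)`, where `p n = p 0`. -/
def boundaryOf (p : ℕ → Plane) (n : ℕ) : Set Plane :=
  ⋃ t ∈ Finset.range n, segment ℝ (p t) (p (t + 1))

theorem isCompact_boundaryOf (p : ℕ → Plane) (n : ℕ) : IsCompact (boundaryOf p n) :=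
  (Finset.range n).isCompact_biUnion fun _ _ => isCompact_segment _ _

theorem boundaryOf_eq_range (p : ℕ → Plane) {n : ℕ} (hn : 0 < n) :
    boundaryOf p n = range (polygonalPath p n) := by
  rw [range_polygonalPath, eq_comm, boundaryOf, union_eq_right, singleton_subset_iff]
  exact mem_biUnion (Finset.mem_coe.2 (Finset.mem_range.2 hn)) (left_mem_segment ℝ _ _)

/-- The parts of the boundary near a point: the two adjacent pieces of edges are, in a small disc
about the point, two distinct rays, and the rest of the boundary stays away. -/
theorem exists_ball_inter_eq {F K : Set Plane} {y a b : Plane} (hF : IsClosed F) (hy : y ∉ F)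
    (ha : a ≠ 0) (hb : b ≠ 0) (hK : K = segment ℝ y (y + a) ∪ segment ℝ y (y + b) ∪ F) :
    ∃ r₀ > 0, ∀ r ≤ r₀, Metric.ball y r ∩ K = Metric.ball y r ∩ (ray y a ∪ ray y b) := by
  obtain ⟨r₁, hr₁, hball⟩ := Metric.isOpen_iff.1 hF.isOpen_compl y hy
  have hseg : ∀ u : Plane, segment ℝ y (y + u) ⊆ ray y u := by
    intro u x hx
    rw [segment_eq_image'] at hx
    obtain ⟨θ, hθ, rfl⟩ := hx
    exact ⟨θ, hθ.1, by simp⟩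
  have hray : ∀ u : Plane, u ≠ 0 → ∀ r ≤ ‖u‖, Metric.ball y r ∩ ray y u ⊆ segment ℝ y (y + u) := by
    rintro u hu r hr x ⟨hx, s, hs, rfl⟩
    rw [segment_eq_image']
    refine ⟨s, ⟨hs, ?_⟩, by simp⟩
    rw [mem_ball_iff_norm, add_sub_cancel_left, norm_smul, Real.norm_of_nonneg hs] at hx
    have hpos := norm_pos_iff.2 hu
    have : s * ‖u‖ < 1 * ‖u‖ := by linarith
    exact (lt_of_mul_lt_mul_right this hpos.le).le
  -- Radius `r₁` keeps the disc away from `F`; the two norms keep it from passing the far ends of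
  -- the segments.
  refine ⟨min r₁ (min ‖a‖ ‖b‖), by simp [hr₁, ha, hb], fun r hr => ?_⟩
  have h1 := hr.trans (min_le_left _ _)
  have h2 := hr.trans ((min_le_right _ _).trans (min_le_left _ _))
  have h3 := hr.trans ((min_le_right _ _).trans (min_le_right _ _))
  ext x
  rw [hK]
  constructor
  · rintro ⟨hx, (hxa | hxb) | hxF⟩
    · exact ⟨hx, Or.inl (hseg a hxa)⟩
    · exact ⟨hx, Or.inr (hseg b hxb)⟩
    · exact absurd hxF (hball (Metric.ball_subset_ball h1 hx))
  · rintro ⟨hx, hxa | hxb⟩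
    · exact ⟨hx, Or.inl (Or.inl (hray a ha r h2 ⟨hx, hxa⟩))⟩
    · exact ⟨hx, Or.inl (Or.inr (hray b hb r h3 ⟨hx, hxb⟩))⟩

theorem IsStarSplit.union_eq_sdiff {y a b : Plane} {r : ℝ} {U V K : Set Plane}
    (h : IsStarSplit y a b r U V)
    (hK : Metric.ball y r ∩ K = Metric.ball y r ∩ (ray y a ∪ ray y b)) :
    U ∪ V = Metric.ball y r \ K := by
  rw [h.union_eq, ← sdiff_self_inter, ← hK, sdiff_self_inter]

/-- `σ` lies between the numbers `t₁` and `t₂`, with distance at most `1` from both. -/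
structure IsNear (t₁ t₂ : ℕ) (σ : ℝ) : Prop where
  lt_left : t₁ < σ
  lt_right : σ < t₂
  le_left : σ ≤ t₁ + 1
  le_right : t₂ ≤ σ + 1

theorem exists_isNear {σ : ℝ} (h : 0 < σ) : ∃ t₁ t₂, IsNear t₁ t₂ σ := by
  have h1 : 0 < ⌈σ⌉₊ := Nat.ceil_pos.2 h
  have h2 := Nat.ceil_lt_add_one h.le
  have h3 := Nat.le_ceil σ
  have h4 : ((⌈σ⌉₊ - 1 : ℕ) : ℝ) = ⌈σ⌉₊ - 1 := by
    rw [Nat.cast_sub h1, Nat.cast_one]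
  -- If `σ` is an integer, these are `σ - 1` and `σ + 1`, so vertices and points within an edge are
  -- treated alike.
  refine ⟨⌈σ⌉₊ - 1, ⌊σ⌋₊ + 1, ?_, ?_, ?_, ?_⟩
  · rw [h4]; linarith
  · push_cast; exact Nat.lt_floor_add_one σ
  · rw [h4]; linarith
  · push_cast
    linarith [Nat.floor_le h.le]

namespace IsSimpleLoop

variable {p : ℕ → Plane} {n : ℕ} (hp : IsSimpleLoop p n)
include hp

theorem pos : 0 < n := lt_of_lt_of_le (by norm_num) hp.three_le

theorem param_add (s : ℝ) (hs : 0 ≤ s) : param p (s + n) = param p s := by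
  simp only [param, Nat.floor_add_natCast hs]
  rw [hp.periodic, add_right_comm, hp.periodic]
  congr 1
  push_cast
  ring

theorem param_eq_iff {s s' : ℝ} (hs : 0 ≤ s) (h1 : s ≤ s') (h2 : s' < s + n) :
    param p s = param p s' ↔ s = s' := by
  refine ⟨fun h => ?_, fun h => h ▸ rfl⟩
  by_contra hne
  exact hp.param_ne s s' hs (lt_of_le_of_ne h1 hne) h2 h

theorem ne_succ (t : ℕ) : p t ≠ p (t + 1) := by
  have := hp.param_ne t (t + 1 : ℕ) (Nat.cast_nonneg t) (by push_cast; linarith)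
    (by have : (3 : ℝ) ≤ n := by exact_mod_cast hp.three_le
        push_cast; linarith)
  rwa [param_natCast, param_natCast] at this

theorem boundaryOf_eq (k : ℕ) : boundaryOf p n = param p '' Icc (k : ℝ) (k + n) := by
  have h0 : boundaryOf p n = param p '' Icc (0 : ℝ) n := by
    have := biUnion_segment_eq_param p hp.pos
    rw [Nat.cast_zero] at this
    rw [← this, boundaryOf, Finset.range_eq_Ico]
  rw [h0]
  have hn : (0 : ℝ) < n := by exact_mod_cast hp.pos
  induction k with
  | zero => simp
  | succ k ih =>
    rw [ih]
    have h3 : (3 : ℝ) ≤ n := by exact_mod_cast hp.three_le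
    have hk : (0 : ℝ) ≤ k := Nat.cast_nonneg k
    push_cast
    ext x
    constructor
    · rintro ⟨s, hs, rfl⟩
      rcases le_total (k + 1 : ℝ) s with h | h
      · exact ⟨s, ⟨h, by linarith [hs.2]⟩, rfl⟩
      · exact ⟨s + n, ⟨by linarith [hs.1], by linarith⟩, hp.param_add s (hk.trans hs.1)⟩
    · rintro ⟨s, hs, rfl⟩
      rcases le_total s (k + n : ℝ) with h | h
      · exact ⟨s, ⟨by linarith [hs.1], h⟩, rfl⟩
      · refine ⟨s - n, ⟨by linarith, by linarith [hs.2]⟩, ?_⟩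
        rw [← hp.param_add _ (by linarith), sub_add_cancel]

theorem param_mem_boundaryOf {s : ℝ} (hs : 0 ≤ s) : param p s ∈ boundaryOf p n := by
  rw [hp.boundaryOf_eq ⌊s⌋₊]
  have h3 : (3 : ℝ) ≤ n := by exact_mod_cast hp.three_le
  exact ⟨s, ⟨Nat.floor_le hs, by linarith [Nat.lt_floor_add_one s]⟩, rfl⟩

theorem isPreconnected_boundaryOf : IsPreconnected (boundaryOf p n) := by
  rw [boundaryOf_eq_range p hp.pos]
  exact isPreconnected_range (polygonalPath p n).continuous

theorem loopTrace_eq : loopTrace p n (p 0) = boundaryOf p n := by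
  have h := hp.periodic 0
  rw [zero_add] at h
  rw [loopTrace, h, segment_same, union_assoc, union_self, ← boundaryOf, union_eq_left,
    singleton_subset_iff]
  rw [← param_natCast p 0]
  exact hp.param_mem_boundaryOf (Nat.cast_nonneg _)

section near

variable {t₁ t₂ : ℕ} {σ : ℝ} (h : IsNear t₁ t₂ σ)
include h

theorem near_lt : (t₂ : ℝ) < t₁ + n := by
  have h3 : (3 : ℝ) ≤ n := by exact_mod_cast hp.three_le
  linarith [h.le_left, h.le_right]

omit hp in
theorem segment_near_left : segment ℝ (param p σ) (p t₁) = param p '' Icc (t₁ : ℝ) σ := by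
  rw [segment_symm, ← param_natCast p t₁, segment_param p le_rfl h.lt_left.le h.le_left]

omit hp in
theorem segment_near_right : segment ℝ (param p σ) (p t₂) = param p '' Icc σ (t₂ : ℝ) := by
  have h0 : 0 < t₂ := by
    by_contra h0
    obtain rfl : t₂ = 0 := by omega
    have := h.lt_left
    have := h.lt_right
    have : (0 : ℝ) ≤ t₁ := Nat.cast_nonneg _
    push_cast at *
    linarith
  obtain ⟨t, rfl⟩ : ∃ t, t₂ = t + 1 := ⟨t₂ - 1, by omega⟩
  have h1 := h.le_right
  have h2 := h.lt_right
  push_cast at h1 h2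
  rw [← param_natCast p (t + 1), segment_param p (t := t) (by linarith) (by push_cast; linarith)
    (by push_cast; linarith)]

theorem near_left_ne : p t₁ - param p σ ≠ 0 := by
  have h0 : (0 : ℝ) ≤ t₁ := Nat.cast_nonneg _
  have := hp.near_lt h
  rw [sub_ne_zero, ← param_natCast p t₁]
  exact hp.param_ne _ _ h0 h.lt_left (by linarith [h.lt_right])

theorem near_right_ne : p t₂ - param p σ ≠ 0 := by
  have h0 : (0 : ℝ) ≤ t₁ := Nat.cast_nonneg _
  have := hp.near_lt h
  rw [sub_ne_zero, ← param_natCast p t₂]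
  exact (hp.param_ne _ _ (by linarith [h.lt_left]) h.lt_right (by linarith [h.lt_left])).symm

/-- Two pieces of edge that leave in the same direction would overlap, against injectivity of the
parametrization. The factor `ε` is small enough for both `ε` and `ε * c` to stay in `[0, 1]`. -/
theorem near_not_sameRay (c : ℝ) (hc : 0 < c) : p t₂ - param p σ ≠ c • (p t₁ - param p σ) := by
  intro he
  have hpos : 0 < max 1 c := lt_max_of_lt_left one_pos
  set ε := (max 1 c)⁻¹
  have hε : 0 < ε := inv_pos.2 hpos
  have hε1 : ε * 1 ≤ 1 := by
    rw [inv_mul_le_iff₀ hpos, mul_one]; exact le_max_left _ _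
  have hεc : ε * c ≤ 1 := by
    rw [inv_mul_le_iff₀ hpos, mul_one]; exact le_max_right _ _
  set y := param p σ
  set x := y + ε • (p t₂ - y)
  have h1 : x ∈ segment ℝ y (p t₂) := by
    rw [segment_eq_image']
    exact ⟨ε, ⟨hε.le, by linarith⟩, rfl⟩
  have h2 : x ∈ segment ℝ y (p t₁) := by
    rw [segment_eq_image']
    exact ⟨ε * c, ⟨by positivity, hεc⟩, by simp only [x]; rw [he, smul_smul]⟩
  rw [segment_near_right h] at h1
  rw [segment_near_left h] at h2
  obtain ⟨s, hs, hs'⟩ := h1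
  obtain ⟨s', hs1, hs2⟩ := h2
  have h0 : (0 : ℝ) ≤ t₁ := Nat.cast_nonneg _
  have hlt := hp.near_lt h
  have := (hp.param_eq_iff (h0.trans hs1.1) (hs1.2.trans hs.1) (by linarith [hs.2, hs1.1])).1
    (hs2.trans hs'.symm)
  have hσ : s = σ := le_antisymm (by linarith [hs1.2]) hs.1
  rw [hσ] at hs'
  have h3 : ε • (p t₂ - y) = 0 := by
    have : y = y + ε • (p t₂ - y) := hs'
    simpa using this
  rcases smul_eq_zero.1 h3 with h4 | h4
  · exact hε.ne' h4
  · exact hp.near_right_ne h h4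

theorem near_ball : ∃ r₀ > 0, ∀ r ≤ r₀,
    Metric.ball (param p σ) r ∩ boundaryOf p n = Metric.ball (param p σ) r ∩
      (ray (param p σ) (p t₁ - param p σ) ∪ ray (param p σ) (p t₂ - param p σ)) := by
  have h0 : (0 : ℝ) ≤ t₁ := Nat.cast_nonneg _
  have hlt := hp.near_lt h
  have hlt' : t₂ < t₁ + n := by exact_mod_cast hlt
  refine exists_ball_inter_eq (F := param p '' Icc (t₂ : ℝ) (t₁ + n)) ?_ ?_ (hp.near_left_ne h)
    (hp.near_right_ne h) ?_
  · have := biUnion_segment_eq_param p hlt'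
    push_cast at this
    rw [← this]
    exact ((Finset.Ico _ _).isCompact_biUnion fun _ _ => isCompact_segment _ _).isClosed
  · rintro ⟨s, hs, he⟩
    exact hp.param_ne σ s (by linarith [h.lt_left]) (by linarith [h.lt_right, hs.1])
      (by linarith [h.lt_left, hs.2]) he.symm
  · rw [add_sub_cancel, add_sub_cancel, segment_near_left h, segment_near_right h, ← image_union,
      ← image_union, Icc_union_Icc_eq_Icc h.lt_left.le h.lt_right.le,
      Icc_union_Icc_eq_Icc (by linarith [h.lt_left, h.lt_right]) hlt.le, hp.boundaryOf_eq t₁]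

end near

/-- The boundary is connected, and the part of it in the closure of a component `D` is nonempty,
closed, and relatively open by the local splitting into two pieces. So it is everything. -/
theorem boundaryOf_subset_closure_component {x : Plane} (hx : x ∉ boundaryOf p n) :
    boundaryOf p n ⊆ closure (connectedComponentIn (boundaryOf p n)ᶜ x) := by
  set K := boundaryOf p n
  set D := connectedComponentIn Kᶜ x
  have hDx : x ∈ D := mem_connectedComponentIn hx
  have hDK : D ⊆ Kᶜ := connectedComponentIn_subset _ _
  have hKo : IsOpen Kᶜ := (isCompact_boundaryOf p n).isClosed.isOpen_compl
  have hDo : IsOpen D := hKo.connectedComponentIn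
  have hp0 : p 0 ∈ K := by
    rw [← param_natCast p 0]
    exact hp.param_mem_boundaryOf (Nat.cast_nonneg _)
  -- Otherwise `D` would be both open and closed in the plane.
  have hne : (K ∩ closure D).Nonempty := by
    by_contra hemp
    have hsub : closure D ⊆ Kᶜ := fun y hy hyK => hemp ⟨y, hyK, hy⟩
    have hcl : closure D ⊆ D := (isPreconnected_connectedComponentIn.closure).subset_connectedComponentIn
      (subset_closure hDx) hsub
    have huniv : D = univ := IsClopen.eq_univ
      ⟨isClosed_of_closure_subset hcl, hDo⟩ ⟨x, hDx⟩
    exact hDK (huniv ▸ mem_univ (p 0)) hp0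
  -- Near `y` the component `D` meets one of the two connected pieces, hence contains it, and the
  -- closure of either piece contains all of `K` in the disc.
  have hloc : ∀ y ∈ K ∩ closure D, ∃ r > 0, Metric.ball y r ∩ K ⊆ closure D := by
    rintro y ⟨hyK, hyD⟩
    have hyK' : y ∈ boundaryOf p n := hyK
    -- A period that starts at `1` makes `σ` positive, so that there is a vertex number before it.
    rw [hp.boundaryOf_eq 1] at hyK'
    obtain ⟨σ, hσ, rfl⟩ := hyK'
    push_cast at hσ
    obtain ⟨t₁, t₂, hnear⟩ := exists_isNear (σ := σ) (by linarith [hσ.1])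
    obtain ⟨r, hr, hball⟩ := hp.near_ball hnear
    obtain ⟨U, V, hUV⟩ := exists_isStarSplit (param p σ) hr (hp.near_left_ne hnear)
      (hp.near_right_ne hnear) (hp.near_not_sameRay hnear)
    have hu := hUV.union_eq_sdiff (hball r le_rfl)
    obtain ⟨d, hd, hdD⟩ := mem_closure_iff.1 hyD _ Metric.isOpen_ball (Metric.mem_ball_self hr)
    have hdUV : d ∈ U ∪ V := hu ▸ ⟨hd, hDK hdD⟩
    have hDd : D = connectedComponentIn Kᶜ d := connectedComponentIn_eq hdD
    refine ⟨r, hr, ?_⟩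
    rw [hball r le_rfl]
    rcases hdUV with hdU | hdV
    · refine hUV.subset_closure_left.trans (closure_mono ?_)
      rw [hDd]
      exact hUV.preconnected_left.subset_connectedComponentIn hdU fun z hz =>
        (hu.subset (Or.inl hz)).2
    · refine hUV.subset_closure_right.trans (closure_mono ?_)
      rw [hDd]
      exact hUV.preconnected_right.subset_connectedComponentIn hdV fun z hz =>
        (hu.subset (Or.inr hz)).2
  choose! ρ hρ hρs using hloc
  set u : Set Plane := ⋃ y ∈ K ∩ closure D, Metric.ball y (ρ y)
  have huo : IsOpen u := isOpen_biUnion fun _ _ => Metric.isOpen_ball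
  have huK : u ∩ K ⊆ closure D := by
    rintro z ⟨hz, hzK⟩
    obtain ⟨y, hy, hzy⟩ := mem_iUnion₂.1 hz
    exact hρs y hy ⟨hzy, hzK⟩
  have hKu : K ∩ closure D ⊆ u := fun y hy =>
    mem_iUnion₂.2 ⟨y, hy, Metric.mem_ball_self (hρ y hy)⟩
  by_contra hnot
  obtain ⟨w, hwK, hw⟩ := not_subset.1 hnot
  obtain ⟨z, hzK, hz1, hz2⟩ := isPreconnected_closed_iff.1 hp.isPreconnected_boundaryOf
    (closure D) (uᶜ) isClosed_closure huo.isClosed_compl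
    (fun y hy => by
      by_cases h : y ∈ closure D
      · exact Or.inl h
      · exact Or.inr fun hyu => h (huK ⟨hyu, hy⟩))
    hne ⟨w, hwK, fun hwu => hw (huK ⟨hwu, hwK⟩)⟩
  exact hz2 (hKu ⟨hzK, hz1⟩)

/-- Every boundary point is a limit of points outside the polygon. -/
theorem boundaryOf_subset_closure_compl :
    boundaryOf p n ⊆ closure (regionOf (boundaryOf p n))ᶜ := by
  obtain ⟨x, hx⟩ := exists_notMem_regionOf (isCompact_boundaryOf p n).isBounded
  have hxK : x ∉ boundaryOf p n := fun h => hx (Or.inl h)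
  refine (hp.boundaryOf_subset_closure_component hxK).trans (closure_mono fun y hy => ?_)
  exact notMem_regionOf_of_isPreconnected isPreconnected_connectedComponentIn
    (disjoint_left.2 fun y hy => connectedComponentIn_subset _ _ hy)
    (mem_connectedComponentIn hxK) hy hx

/-- By simplicity an inner point of an edge lies on no other edge. The loop closes up already at `p
n = p 0`, so the two extra edges through `q = p 0` are degenerate. -/
theorem boundary_jump {t : ℕ} (ht : t < n) {y a : Plane}
    (hy : y ∈ openSegment ℝ (p t) (p (t + 1))) {c : ℝ} (hc : c ≠ 0)
    (ha : a = c • (p (t + 1) - p t)) :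
    ∀ᶠ ε : ℝ in 𝓝[≠] 0,
      loopAngle p n (p 0) (y + ε • rot a) ≠ loopAngle p n (p 0) (y - ε • rot a) := by
  have hpn : p n = p 0 := by simpa using hp.periodic 0
  have hparam : ∃ s : ℝ, t < s ∧ s < t + 1 ∧ y = param p s := by
    rw [openSegment_eq_image_lineMap] at hy
    obtain ⟨θ, hθ, rfl⟩ := hy
    refine ⟨t + θ, by linarith [hθ.1], by linarith [hθ.2], ?_⟩
    rw [param_eq_lineMap p (t := t) (by linarith [hθ.1]) (by linarith [hθ.2]), add_sub_cancel_left]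
  obtain ⟨s, hs1, hs2, hys⟩ := hparam
  have ht0 : (0 : ℝ) ≤ t := Nat.cast_nonneg _
  have hother : ∀ s' < n, s' ≠ t → y ∉ segment ℝ (p s') (p (s' + 1)) := by
    intro s' hs' hne hmem
    rw [segment_eq_param] at hmem
    obtain ⟨σ, hσ, he⟩ := hmem
    have hs'0 : (0 : ℝ) ≤ s' := Nat.cast_nonneg _
    have h1 : (s' : ℝ) + 1 ≤ n := by exact_mod_cast hs'
    have h2 : (t : ℝ) + 1 ≤ n := by exact_mod_cast ht
    rcases lt_or_gt_of_ne hne with h | h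
    · have h3 : (s' : ℝ) + 1 ≤ t := by exact_mod_cast h
      exact hp.param_ne σ s (hs'0.trans hσ.1) (by linarith [hσ.2]) (by linarith [hσ.1])
        (he.trans hys)
    · have h3 : (t : ℝ) + 1 ≤ s' := by exact_mod_cast h
      exact hp.param_ne s σ (by linarith) (by linarith [hσ.1]) (by linarith [hσ.2])
        (hys.symm.trans he.symm)
  have h0 : y ≠ p 0 := by
    rw [hys, ← param_natCast p 0]
    have h2 : (t : ℝ) + 1 ≤ n := by exact_mod_cast ht
    exact (hp.param_ne _ _ (by simp) (by simp; linarith) (by simp; linarith)).symm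
  refine loopAngle_jump ht (hp.ne_succ t) hy hother ?_ ?_ hc ha
  · rw [hpn, segment_same]; exact h0
  · rw [segment_same]; exact h0

theorem loopAngle_ne_of_near {t₁ t₂ : ℕ} {σ r : ℝ} (h : IsNear t₁ t₂ σ) (ht : t₁ < n) (hr : 0 < r)
    {U V : Set Plane}
    (hUV : IsStarSplit (param p σ) (p t₁ - param p σ) (p t₂ - param p σ) r U V)
    (hK : U ∪ V = Metric.ball (param p σ) r \ boundaryOf p n) {u v : Plane} (hu : u ∈ U)
    (hv : v ∈ V) : loopAngle p n (p 0) u ≠ loopAngle p n (p 0) v := by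
  set y := param p σ
  have hev := eventually_add_smul_mem (p t₁ - y) Metric.isOpen_ball (Metric.mem_ball_self hr)
    (x := y)
  have hlt1 : ∀ᶠ s : ℝ in 𝓝[>] 0, s < 1 :=
    nhdsWithin_le_nhds (eventually_lt_nhds one_pos)
  obtain ⟨s, ⟨hs, hs1⟩, hs0⟩ := ((hev.and hlt1).and self_mem_nhdsWithin).exists
  have hs0 : 0 < s := hs0
  have hy : y = p t₁ + (σ - t₁) • (p (t₁ + 1) - p t₁) := by
    simp only [y]
    rw [param_eq_lineMap p h.lt_left.le h.le_left, AffineMap.lineMap_apply_module']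
    abel
  have hd : ∀ w ∈ U ∪ V, w ∉ loopTrace p n (p 0) := by
    rw [hK, hp.loopTrace_eq]
    exact fun w hw => hw.2
  have hpos : 0 < σ - t₁ := by linarith [h.lt_left]
  refine loopAngle_ne_of_isStarSplit hUV (disjoint_left.2 fun w hw => hd w (Or.inl hw))
    (disjoint_left.2 fun w hw => hd w (Or.inr hw)) hs0 hs
    -- The winding number is tested where the edge from `p t₁` is crossed slightly before `y`; the
    -- direction `p t₁ - y` is `-(σ - t₁)` times that edge.
    (hp.boundary_jump ht (c := -(σ - t₁)) ?_ (neg_ne_zero.2 hpos.ne') ?_) hu hv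
  · rw [openSegment_eq_image']
    have hle : σ - t₁ ≤ 1 := by linarith [h.le_left]
    refine ⟨(1 - s) * (σ - t₁), ⟨mul_pos (by linarith) hpos, ?_⟩, ?_⟩
    · nlinarith
    · rw [hy]
      module
  · rw [hy]
    module

/-- The total angle of the boundary is a nonzero constant on the inside. -/
theorem exists_loopAngle_eq : ∃ c ≠ 0, ∀ x ∈ insideOf (boundaryOf p n),
    loopAngle p n (p 0) x = c := by
  set K := boundaryOf p n
  have htr : loopTrace p n (p 0) ⊆ regionOf K := by
    rw [hp.loopTrace_eq]
    exact subset_union_left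
  have hnear : IsNear 0 1 (1 / 2) := by constructor <;> norm_num
  obtain ⟨r, hr, hball⟩ := hp.near_ball hnear
  obtain ⟨U, V, hUV⟩ := exists_isStarSplit (param p (1 / 2)) hr (hp.near_left_ne hnear)
    (hp.near_right_ne hnear) (hp.near_not_sameRay hnear)
  have hu := hUV.union_eq_sdiff (hball r le_rfl)
  have hjump := fun {u v} => hp.loopAngle_ne_of_near hnear hp.pos hr hUV hu (u := u) (v := v)
  set y := param p (1 / 2)
  have hyK : y ∈ K := hp.param_mem_boundaryOf (by norm_num)
  have hUK : Disjoint U K := disjoint_left.2 fun z hz => (hu.subset (Or.inl hz)).2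
  have hVK : Disjoint V K := disjoint_left.2 fun z hz => (hu.subset (Or.inr hz)).2
  -- Every component has all boundary points in its closure, so it reaches the disc about the
  -- midpoint of one fixed edge. It suffices to look at `U` and `V`.
  have hmeet : ∀ x ∈ insideOf K, ∃ d ∈ U ∪ V, d ∈ insideOf K ∧
      loopAngle p n (p 0) x = loopAngle p n (p 0) d := by
    intro x hx
    obtain ⟨d, hd, hdD⟩ := mem_closure_iff.1 (hp.boundaryOf_subset_closure_component hx.1 hyK) _
      Metric.isOpen_ball (Metric.mem_ball_self hr)
    have hDK : Disjoint (connectedComponentIn Kᶜ x) K :=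
      disjoint_left.2 fun y hy => connectedComponentIn_subset _ _ hy
    refine ⟨d, hu ▸ ⟨hd, disjoint_left.1 hDK hdD⟩, ?_, ?_⟩
    · exact mem_insideOf_of_isPreconnected isPreconnected_connectedComponentIn hDK
        (mem_connectedComponentIn hx.1) hdD hx
    · refine loopAngle_eq_of_isPreconnected isPreconnected_connectedComponentIn ?_
        (mem_connectedComponentIn hx.1) hdD
      rwa [hp.loopTrace_eq]
  -- One piece contains an outside point `o`, so it lies outside with value `0`. The other piece
  -- then has a nonzero value, and only it can meet the inside.
  obtain ⟨o, ho, hoK⟩ := mem_closure_iff.1 (hp.boundaryOf_subset_closure_compl hyK) _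
    Metric.isOpen_ball (Metric.mem_ball_self hr)
  have hoUV : o ∈ U ∪ V := hu ▸ ⟨ho, fun h => hoK (Or.inl h)⟩
  have hyU : (U.Nonempty) ∧ V.Nonempty := by
    have hy : y ∈ Metric.ball y r ∩ (ray y (p 0 - y) ∪ ray y (p 1 - y)) :=
      ⟨Metric.mem_ball_self hr, Or.inl ⟨0, le_rfl, by simp⟩⟩
    exact ⟨closure_nonempty_iff.1 ⟨y, hUV.subset_closure_left hy⟩,
      closure_nonempty_iff.1 ⟨y, hUV.subset_closure_right hy⟩⟩
  have ho0 := loopAngle_eq_zero_of_notMem_regionOf htr hoK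
  rcases hoUV with hoU | hoV
  · obtain ⟨v, hv⟩ := hyU.2
    refine ⟨loopAngle p n (p 0) v, fun h0 => hjump hoU hv (ho0.trans h0.symm), fun x hx => ?_⟩
    obtain ⟨d, hd, hdin, he⟩ := hmeet x hx
    rcases hd with hd | hd
    · exact absurd (Or.inr hdin)
        (notMem_regionOf_of_isPreconnected hUV.preconnected_left hUK hoU hd hoK)
    · rw [he]
      refine loopAngle_eq_of_isPreconnected hUV.preconnected_right ?_ hd hv
      rwa [hp.loopTrace_eq]
  · obtain ⟨v, hv⟩ := hyU.1
    refine ⟨loopAngle p n (p 0) v, fun h0 => hjump hv hoV (h0.trans ho0.symm), fun x hx => ?_⟩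
    obtain ⟨d, hd, hdin, he⟩ := hmeet x hx
    rcases hd with hd | hd
    · rw [he]
      refine loopAngle_eq_of_isPreconnected hUV.preconnected_left ?_ hd hv
      rwa [hp.loopTrace_eq]
    · exact absurd (Or.inr hdin)
        (notMem_regionOf_of_isPreconnected hUV.preconnected_right hVK hoV hd hoK)

end IsSimpleLoop

/-! ### Extreme corners: a chord cannot return to a reflex arc -/

theorem inner_plane (u v : Plane) : inner ℝ u v = u 0 * v 0 + u 1 * v 1 := by
  rw [PiLp.inner_apply, Fin.sum_univ_two]
  simp
  ring

theorem sector_comm (y a b : Plane) : sector y b a = sector y a b := by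
  rw [sector, sector, inter_comm, cross_swap b a]
  simp [inv_neg]

theorem cosector_comm (y a b : Plane) : cosector y b a = cosector y a b := by
  rw [cosector, cosector, union_comm, cross_swap b a]
  simp [inv_neg]

theorem isPreconnected_ray_Ici (y u : Plane) (s₀ : ℝ) :
    IsPreconnected ((fun s : ℝ => y + s • u) '' Ici s₀) :=
  isPreconnected_Ici.image _ (by fun_prop)

theorem not_isBounded_ray_Ici (y : Plane) {u : Plane} (hu : u ≠ 0) (s₀ : ℝ) :
    ¬ Bornology.IsBounded ((fun s : ℝ => y + s • u) '' Ici s₀) := by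
  intro h
  obtain ⟨C, hC⟩ := h.exists_norm_le
  have hpos := norm_pos_iff.2 hu
  set s := max s₀ ((|C| + ‖y‖ + 1) / ‖u‖)
  have h1 := hC _ ⟨s, mem_Ici.2 (le_max_left _ _), rfl⟩
  have h2 : (|C| + ‖y‖ + 1) / ‖u‖ ≤ s := le_max_right _ _
  rw [div_le_iff₀ hpos] at h2
  have h3 : ‖s • u‖ ≤ ‖y + s • u‖ + ‖y‖ := by
    calc ‖s • u‖ = ‖(y + s • u) - y‖ := by rw [add_sub_cancel_left]
      _ ≤ _ := norm_sub_le _ _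
  rw [norm_smul, Real.norm_eq_abs] at h3
  have h4 : s * ‖u‖ ≤ |s| * ‖u‖ := mul_le_mul_of_nonneg_right (le_abs_self s) hpos.le
  linarith [le_abs_self C]

theorem convex_cross_le (d y : Plane) (c : ℝ) : Convex ℝ {x | cross d (x - y) ≤ c} := by
  intro x hx z hz α β hα hβ hαβ
  have h : cross d (α • x + β • z - y) = α * cross d (x - y) + β * cross d (z - y) := by
    have : α • x + β • z - y = α • (x - y) + β • (z - y) := by
      rw [smul_sub, smul_sub, sub_add_sub_comm, ← add_smul, hαβ, one_smul]
    rw [this, cross_add_right, cross_smul_right, cross_smul_right]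
  simp only [mem_ofPred_eq] at *
  rw [h]
  have h1 := mul_le_mul_of_nonneg_left hx hα
  have h2 := mul_le_mul_of_nonneg_left hz hβ
  have h3 : α * c + β * c = c := by rw [← add_mul, hαβ, one_mul]
  linarith

/-- A corner of the polygonal line `z` at which the complement of `K` takes up the smaller of the
two angles, or at which the line is straight. -/
def IsCorner (K : Set Plane) (x y w : Plane) : Prop :=
  (∃ c < (0 : ℝ), w - y = c • (x - y)) ∨ (cross (x - y) (w - y) ≠ 0 ∧
    ∃ r > 0, sector y (x - y) (w - y) ∩ Metric.ball y r ⊆ (regionOf K)ᶜ ∧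
      Disjoint (cosector y (x - y) (w - y) ∩ Metric.ball y r) K)

theorem IsCorner.symm {K : Set Plane} {x y w : Plane} (h : IsCorner K x y w) :
    IsCorner K w y x := by
  rcases h with ⟨c, hc, h⟩ | ⟨h, r, hr, h1, h2⟩
  · exact Or.inl ⟨c⁻¹, inv_lt_zero.2 hc, by rw [h, smul_smul, inv_mul_cancel₀ hc.ne, one_smul]⟩
  · refine Or.inr ⟨?_, r, hr, ?_, ?_⟩
    · rw [cross_swap]; exact neg_ne_zero.2 h
    · rwa [sector_comm]
    · rwa [cosector_comm]

section chord

variable {K : Set Plane} {z : ℕ → Plane} {N : ℕ} {q : Plane}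
  (hedge : ∀ t ≤ N, segment ℝ (z t) (z (t + 1)) ⊆ K) (hq : q ∈ segment ℝ (z N) (z (N + 1)))
include hedge hq

theorem loopTrace_subset_union : loopTrace z N q ⊆ K ∪ segment ℝ q (z 0) := by
  rintro x ((hx | hx) | hx)
  · obtain ⟨t, ht, hx⟩ := mem_iUnion₂.1 hx
    exact Or.inl (hedge t (Finset.mem_range.1 (Finset.mem_coe.1 ht)).le hx)
  · exact Or.inl (hedge N le_rfl ((convex_segment _ _).segment_subset (left_mem_segment ℝ _ _) hq hx))
  · exact Or.inr hx

variable (hchordR : segment ℝ q (z 0) ⊆ regionOf K)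
  (hchord : ∀ x ∈ segment ℝ q (z 0), x ∈ K → x = q ∨ x = z 0) (hne : ∀ t ≤ N, z t ≠ z (t + 1))
  (hdisj : ∀ s ≤ N, ∀ t ≤ N, s ≠ t →
    Disjoint (openSegment ℝ (z t) (z (t + 1))) (segment ℝ (z s) (z (s + 1))))
include hchordR hchord hne hdisj

/-- At a corner the polygonal line together with the chord cannot lie strictly on one side of a
line through the corner. -/
theorem not_isCorner_of_cross_le {d : Plane} {t : ℕ} (ht1 : 1 ≤ t) (htN : t ≤ N)
    (hlt : cross d (z (t - 1) - z 0) < cross d (z t - z 0))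
    (hle : cross d (z (t + 1) - z 0) ≤ cross d (z t - z 0))
    (hmax : ∀ s ≤ N, cross d (z s - z 0) ≤ cross d (z t - z 0))
    (hqd : cross d (q - z 0) = 0) (hpos : 0 < cross d (z t - z 0)) :
    ¬ IsCorner K (z (t - 1)) (z t) (z (t + 1)) := by
  have hda : cross d (z (t - 1) - z t) < 0 := by
    have : z (t - 1) - z t = (z (t - 1) - z 0) - (z t - z 0) := by abel
    rw [this, cross_sub_right]
    linarith
  have hdb : cross d (z (t + 1) - z t) ≤ 0 := by
    have : z (t + 1) - z t = (z (t + 1) - z 0) - (z t - z 0) := by abel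
    rw [this, cross_sub_right]
    linarith
  rintro (⟨c, hc, he⟩ | ⟨hab, r, hr, hsec, hcos⟩)
  -- At a straight corner the line would keep rising, past the maximum.
  · rw [he, cross_smul_right] at hdb
    have := mul_pos_of_neg_of_neg hc hda
    linarith
  set y := z t
  set a := z (t - 1) - y
  set b := z (t + 1) - y
  have hd0 : d ≠ 0 := by
    rintro rfl
    simp [cross] at hpos
  have hconv := convex_cross_le d (z 0) (cross d (y - z 0))
  have hz0 : cross d (z 0 - z 0) ≤ cross d (y - z 0) := hmax 0 (Nat.zero_le _)
  have hq0 : cross d (q - z 0) ≤ cross d (y - z 0) := by rw [hqd]; exact hpos.le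
  have htrace : loopTrace z N q ⊆ {x | cross d (x - z 0) ≤ cross d (y - z 0)} := by
    rintro x ((hx | hx) | hx)
    · obtain ⟨s, hs, hx⟩ := mem_iUnion₂.1 hx
      have hs : s < N := Finset.mem_range.1 (Finset.mem_coe.1 hs)
      exact hconv.segment_subset (hmax s hs.le) (hmax (s + 1) hs) hx
    · exact hconv.segment_subset (hmax N le_rfl) hq0 hx
    · exact hconv.segment_subset hq0 hz0 hx
  have hreg : loopTrace z N q ⊆ regionOf K :=
    (loopTrace_subset_union hedge hq).trans (union_subset subset_union_left hchordR)
  -- The chord has height `0`, whereas `y` has positive height.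
  have hychord : y ∉ segment ℝ q (z 0) := by
    intro hy
    have h1 := (convex_cross_le d (z 0) 0).segment_subset (x := q) (y := z 0) hqd.le
      (by simp [cross]) hy
    exact absurd h1 (not_le.2 hpos)
  obtain ⟨r', hr', hball'⟩ := Metric.isOpen_iff.1 (isCompact_segment q (z 0)).isClosed.isOpen_compl
    y hychord
  set ρ := min r r'
  have hρ : 0 < ρ := lt_min hr hr'
  have hρr : Metric.ball y ρ ⊆ Metric.ball y r := Metric.ball_subset_ball (min_le_left _ _)
  have hρr' : Metric.ball y ρ ⊆ Metric.ball y r' := Metric.ball_subset_ball (min_le_right _ _)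
  have hsplit := isStarSplit_sector hab y hρ
  have hUR : sector y a b ∩ Metric.ball y ρ ⊆ (regionOf K)ᶜ :=
    (inter_subset_inter_right _ hρr).trans hsec
  have hU : Disjoint (sector y a b ∩ Metric.ball y ρ) (loopTrace z N q) :=
    disjoint_left.2 fun x hx hxt => hUR hx (hreg hxt)
  have hV : Disjoint (cosector y a b ∩ Metric.ball y ρ) (loopTrace z N q) := by
    refine disjoint_left.2 fun x hx hxt => ?_
    rcases loopTrace_subset_union hedge hq hxt with h | h
    · exact disjoint_left.1 hcos ⟨hx.1, hρr hx.2⟩ h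
    · exact hball' (hρr' hx.2) h
  obtain ⟨t', rfl⟩ : ∃ t', t = t' + 1 := ⟨t - 1, by omega⟩
  have hev := eventually_add_smul_mem a Metric.isOpen_ball (Metric.mem_ball_self hρ) (x := y)
  have hlt1 : ∀ᶠ s : ℝ in 𝓝[>] 0, s < 1 :=
    nhdsWithin_le_nhds (eventually_lt_nhds one_pos)
  obtain ⟨s, ⟨hs, hs1⟩, hs0⟩ := ((hev.and hlt1).and self_mem_nhdsWithin).exists
  have hs0 : 0 < s := hs0
  have hop : y + s • a ∈ openSegment ℝ (z t') (z (t' + 1)) := by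
    rw [openSegment_eq_image']
    refine ⟨1 - s, ⟨by linarith, by linarith⟩, ?_⟩
    simp only [a, y, Nat.add_sub_cancel]
    module
  have hopK : y + s • a ∈ K := hedge t' (by omega) (openSegment_subset_segment ℝ _ _ hop)
  have hlast : y + s • a ∉ segment ℝ (z N) (z (N + 1)) :=
    disjoint_left.1 (hdisj N le_rfl t' (by omega) (by omega)) hop
  have hjump := loopAngle_jump (z := z) (q := q) (N := N) (t := t') (by omega)
    (hne t' (by omega)) hop
    (fun s hs hst => disjoint_left.1 (hdisj s hs.le t' (by omega) hst) hop)
    (fun h => hlast ((convex_segment _ _).segment_subset (left_mem_segment ℝ _ _) hq h))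
    (fun h => by
      rcases hchord _ h hopK with h | h
      · exact hlast (h ▸ hq)
      · rcases Nat.eq_zero_or_pos t' with rfl | h'
        · rw [h, left_mem_openSegment_iff] at hop
          exact hne 0 (by omega) hop
        · exact disjoint_left.1 (hdisj 0 (by omega) t' (by omega) (by omega)) hop
            (h ▸ left_mem_segment ℝ _ _))
    (a := a) (c := -1) (by norm_num) (by simp only [a, y, Nat.add_sub_cancel]; module)
  have hn : 0 < cross d (rot d) := cross_rot_pos hd0
  obtain ⟨α, β, hαβ⟩ := exists_coords hab 0 (rot d)
  rw [zero_add] at hαβ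
  -- Neither edge rises from `y`, so the upward direction `rot d` is no nonnegative combination of
  -- `a` and `b`, and it points into the cosector.
  have hneg : α < 0 ∨ β < 0 := by
    by_contra! h
    rw [hαβ, cross_add_right, cross_smul_right, cross_smul_right] at hn
    have h1 := mul_nonpos_of_nonneg_of_nonpos h.1 hda.le
    have h2 := mul_nonpos_of_nonneg_of_nonpos h.2 hdb
    linarith
  obtain ⟨ε, hε, hε0⟩ := ((eventually_add_smul_mem (rot d) Metric.isOpen_ball
    (Metric.mem_ball_self hρ) (x := y)).and self_mem_nhdsWithin).exists
  have hε0 : 0 < ε := hε0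
  have hvV : y + ε • rot d ∈ cosector y a b ∩ Metric.ball y ρ := by
    refine ⟨?_, hε⟩
    have : y + ε • rot d = y + ((ε * α) • a + (ε * β) • b) := by
      rw [hαβ, smul_add, smul_smul, smul_smul]
    rw [this, mem_cosector_iff hab]
    exact hneg.imp (mul_neg_of_pos_of_neg hε0) (mul_neg_of_pos_of_neg hε0)
  -- The upward ray stays above the whole loop and is unbounded. On the other side of the corner the
  -- sector is outside the region, so both winding numbers vanish, contrary to the jump.
  have hv0 : loopAngle z N q (y + ε • rot d) = 0 := by
    refine loopAngle_eq_zero_of_unbounded (isPreconnected_ray_Ici y (rot d) ε) ?_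
      (not_isBounded_ray_Ici y ?_ ε) ⟨ε, mem_Ici.2 le_rfl, rfl⟩
    · refine disjoint_left.2 ?_
      rintro _ ⟨s, hs, rfl⟩ hst
      have h1 : cross d (y + s • rot d - z 0) ≤ cross d (y - z 0) := htrace hst
      have h2 : y + s • rot d - z 0 = (y - z 0) + s • rot d := by abel
      rw [h2, cross_add_right, cross_smul_right] at h1
      have := mul_pos (hε0.trans_le hs) hn
      linarith
    · intro h
      rw [h] at hn
      simp [cross] at hn
  have huU : (sector y a b ∩ Metric.ball y ρ).Nonempty := by
    have hy : y ∈ Metric.ball y ρ ∩ (ray y a ∪ ray y b) :=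
      ⟨Metric.mem_ball_self hρ, Or.inl ⟨0, le_rfl, by simp⟩⟩
    exact closure_nonempty_iff.1 ⟨y, hsplit.subset_closure_left hy⟩
  obtain ⟨u, hu⟩ := huU
  refine loopAngle_ne_of_isStarSplit hsplit hU hV hs0 hs hjump hu hvV ?_
  rw [hv0, loopAngle_eq_zero_of_notMem_regionOf hreg (hUR hu)]

/-- A chord cannot return to a polygonal line all of whose inner corners point away from the
region. -/
theorem false_of_chord_returns {d : Plane} (hqd : cross d (q - z 0) = 0)
    (h1 : cross d (z 1 - z 0) ≠ 0) (hN : 1 ≤ N)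
    (hcorner : ∀ t, 1 ≤ t → t ≤ N → IsCorner K (z (t - 1)) (z t) (z (t + 1))) : False := by
  -- `cross d (x - z 0)` is a multiple of the signed height of `x` over the line of the chord;
  -- changing the sign of `d` makes the first edge rise.
  wlog hpos : 0 < cross d (z 1 - z 0) generalizing d
  · have hneg : ∀ x, cross (-d) x = -cross d x := fun x => by simp [cross]; ring
    refine this (d := -d) ?_ ?_ ?_
    · rw [hneg, hqd, neg_zero]
    · rw [hneg]; exact neg_ne_zero.2 h1
    · rw [hneg]
      have := lt_of_le_of_ne (not_lt.1 hpos) h1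
      linarith
  obtain ⟨t₀, ht₀, hmax₀⟩ := Finset.exists_max_image (Finset.Icc 1 N)
    (fun t => cross d (z t - z 0)) ⟨1, Finset.mem_Icc.2 ⟨le_rfl, hN⟩⟩
  have hex : ∃ t, 1 ≤ t ∧ t ≤ N ∧ cross d (z t₀ - z 0) ≤ cross d (z t - z 0) :=
    ⟨t₀, (Finset.mem_Icc.1 ht₀).1, (Finset.mem_Icc.1 ht₀).2, le_rfl⟩
  classical
  -- The first index with maximal height, so that the previous vertex is strictly lower.
  set t := Nat.find hex
  obtain ⟨ht1, htN, htmax⟩ := Nat.find_spec hex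
  have hmin := fun {s} => Nat.find_min hex (m := s)
  have hmax1 : ∀ s, 1 ≤ s → s ≤ N → cross d (z s - z 0) ≤ cross d (z t - z 0) := fun s hs hsN =>
    (hmax₀ s (Finset.mem_Icc.2 ⟨hs, hsN⟩)).trans htmax
  have htpos : 0 < cross d (z t - z 0) := hpos.trans_le (hmax1 1 le_rfl hN)
  have h00 : cross d (z 0 - z 0) = 0 := by simp [cross]
  have hmax : ∀ s ≤ N, cross d (z s - z 0) ≤ cross d (z t - z 0) := by
    intro s hs
    rcases Nat.eq_zero_or_pos s with rfl | h
    · rw [h00]; exact htpos.le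
    · exact hmax1 s h hs
  refine not_isCorner_of_cross_le hedge hq hchordR hchord hne hdisj ht1 htN ?_ ?_ hmax hqd htpos
    (hcorner t ht1 htN)
  · rcases Nat.eq_or_lt_of_le ht1 with h | h
    · rw [← h, Nat.sub_self, h00, h]
      exact htpos
    · have := hmin (s := t - 1) (by omega)
      push Not at this
      exact (this (by omega) (by omega)).trans_le htmax
  · rcases Nat.eq_or_lt_of_le htN with h | h
    -- For `t = N` the next vertex is not among those compared; but the last edge contains `q` at
    -- height `0`, so it cannot rise from the positive height of `z N`.
    · obtain ⟨α, β, hα, hβ, hαβ, hqe⟩ := hq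
      have hqe' : q - z 0 = α • (z N - z 0) + β • (z (N + 1) - z 0) := by
        rw [← hqe, smul_sub, smul_sub, sub_add_sub_comm, ← add_smul, hαβ, one_smul]
      rw [hqe', cross_add_right, cross_smul_right, cross_smul_right] at hqd
      change t = N at h
      change cross d (z (t + 1) - z 0) ≤ cross d (z t - z 0)
      rw [h] at htpos ⊢
      by_contra! hlt
      have h2 := mul_le_mul_of_nonneg_left hlt.le hβ
      have h3 : α * cross d (z N - z 0) + β * cross d (z N - z 0) = cross d (z N - z 0) := by
        rw [← add_mul, hαβ, one_mul]
      linarith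
    · exact hmax1 (t + 1) (by omega) h

end chord

/-! ### Reflex vertices and directions into the polygon -/

/-- The vertex `p k`, `k ≥ 1`, has interior angle at least `π`. -/
def IsReflexAt (p : ℕ → Plane) (n k : ℕ) : Prop :=
  cross (p (k - 1) - p k) (p (k + 1) - p k) = 0 ∨
    ¬ ∀ᶠ x in 𝓝[openSector (p (k - 1)) (p k) (p (k + 1))] (p k), x ∈ insideOf (boundaryOf p n)

namespace IsSimpleLoop

variable {p : ℕ → Plane} {n : ℕ} (hp : IsSimpleLoop p n)
include hp

theorem disjoint_openSegment {s t : ℕ} (hs : s < n) (ht : t < n) (hst : s ≠ t) :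
    Disjoint (openSegment ℝ (p t) (p (t + 1))) (segment ℝ (p s) (p (s + 1))) := by
  refine disjoint_left.2 fun y hy hmem => ?_
  rw [openSegment_eq_image_lineMap] at hy
  obtain ⟨θ, hθ, rfl⟩ := hy
  rw [segment_eq_param] at hmem
  obtain ⟨σ, hσ, he⟩ := hmem
  have he' : param p σ = param p (t + θ) := by
    rw [he, param_eq_lineMap p (t := t) (by linarith [hθ.1]) (by linarith [hθ.2]),
      add_sub_cancel_left]
  have hs0 : (0 : ℝ) ≤ s := Nat.cast_nonneg _
  have ht0 : (0 : ℝ) ≤ t := Nat.cast_nonneg _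
  have h1 : (s : ℝ) + 1 ≤ n := by exact_mod_cast hs
  have h2 : (t : ℝ) + 1 ≤ n := by exact_mod_cast ht
  rcases lt_or_gt_of_ne hst with h | h
  · have h3 : (s : ℝ) + 1 ≤ t := by exact_mod_cast h
    exact hp.param_ne σ (t + θ) (hs0.trans hσ.1) (by linarith [hσ.2, hθ.1])
      (by linarith [hσ.1, hθ.2]) he'
  · have h3 : (t : ℝ) + 1 ≤ s := by exact_mod_cast h
    exact hp.param_ne (t + θ) σ (by linarith [hθ.1]) (by linarith [hσ.1, hθ.2])
      (by linarith [hσ.2, hθ.1]) he'.symm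

theorem segment_subset_boundaryOf (t : ℕ) : segment ℝ (p t) (p (t + 1)) ⊆ boundaryOf p n := by
  rw [segment_eq_param]
  rintro _ ⟨s, hs, rfl⟩
  exact hp.param_mem_boundaryOf ((Nat.cast_nonneg t).trans hs.1)

theorem vertex_mem_boundaryOf (t : ℕ) : p t ∈ boundaryOf p n :=
  hp.segment_subset_boundaryOf t (left_mem_segment ℝ _ _)

section vertex

variable {k : ℕ} (hk : 1 ≤ k)
include hk

omit hp in
theorem isNear_natCast : IsNear (k - 1) (k + 1) k := by
  constructor <;> push_cast [hk] <;> linarith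

theorem vertex_cases : (∃ c < (0 : ℝ), p (k + 1) - p k = c • (p (k - 1) - p k)) ∨
    cross (p (k - 1) - p k) (p (k + 1) - p k) ≠ 0 := by
  by_cases h : cross (p (k - 1) - p k) (p (k + 1) - p k) = 0
  · left
    have h1 := hp.near_left_ne (isNear_natCast hk)
    have h2 := hp.near_right_ne (isNear_natCast hk)
    have h3 := hp.near_not_sameRay (isNear_natCast hk)
    rw [param_natCast] at h1 h2 h3
    obtain ⟨c, hc⟩ := exists_smul_of_cross_eq_zero h1 h
    refine ⟨c, ?_, hc⟩
    rcases lt_trichotomy c 0 with h4 | h4 | h4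
    · exact h4
    · rw [h4, zero_smul] at hc
      exact absurd hc h2
    · exact absurd hc (h3 c h4)
  · exact Or.inr h

theorem exists_vertex_sector (h : cross (p (k - 1) - p k) (p (k + 1) - p k) ≠ 0) :
    ∃ r > 0, sector (p k) (p (k - 1) - p k) (p (k + 1) - p k) ∩ Metric.ball (p k) r ∪
      cosector (p k) (p (k - 1) - p k) (p (k + 1) - p k) ∩ Metric.ball (p k) r =
      Metric.ball (p k) r \ boundaryOf p n := by
  obtain ⟨r, hr, hball⟩ := hp.near_ball (isNear_natCast hk)
  rw [param_natCast] at hball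
  exact ⟨r, hr, (isStarSplit_sector h (p k) hr).union_eq_sdiff (hball r le_rfl)⟩

omit hp hk in
-- The sector within the disc is connected and misses the boundary: once one of its points is not
-- inside, all of them are outside the region.
theorem sector_subset_compl (h : cross (p (k - 1) - p k) (p (k + 1) - p k) ≠ 0)
    (hrefl : IsReflexAt p n k) {r : ℝ} (hr : 0 < r)
    (hr' : sector (p k) (p (k - 1) - p k) (p (k + 1) - p k) ∩ Metric.ball (p k) r ∪
      cosector (p k) (p (k - 1) - p k) (p (k + 1) - p k) ∩ Metric.ball (p k) r =
      Metric.ball (p k) r \ boundaryOf p n) :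
    sector (p k) (p (k - 1) - p k) (p (k + 1) - p k) ∩ Metric.ball (p k) r ⊆
      (regionOf (boundaryOf p n))ᶜ := by
  have hd : Disjoint (sector (p k) (p (k - 1) - p k) (p (k + 1) - p k) ∩ Metric.ball (p k) r)
      (boundaryOf p n) := disjoint_left.2 fun x hx => (hr'.subset (Or.inl hx)).2
  have hpre := (isStarSplit_sector h (p k) hr).preconnected_left
  rcases hrefl with h0 | hrefl
  · exact absurd h0 h
  have : ∃ x ∈ sector (p k) (p (k - 1) - p k) (p (k + 1) - p k) ∩ Metric.ball (p k) r,
      x ∉ insideOf (boundaryOf p n) := by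
    by_contra! hall
    apply hrefl
    have hs := sector_eq_openSector h (p k)
    rw [add_sub_cancel, add_sub_cancel] at hs
    rw [← hs]
    filter_upwards [self_mem_nhdsWithin, nhdsWithin_le_nhds (Metric.ball_mem_nhds (p k) hr)]
      with x h1 h2 using hall x ⟨h1, h2⟩
  obtain ⟨x, hx, hxin⟩ := this
  intro y hy
  refine notMem_regionOf_of_isPreconnected hpre hd hx hy ?_
  rintro (h' | h')
  · exact disjoint_left.1 hd hx h'
  · exact hxin h'

theorem isCorner (hrefl : IsReflexAt p n k) :
    IsCorner (boundaryOf p n) (p (k - 1)) (p k) (p (k + 1)) := by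
  rcases hp.vertex_cases hk with h | h
  · exact Or.inl h
  · obtain ⟨r, hr, hr'⟩ := hp.exists_vertex_sector hk h
    exact Or.inr ⟨h, r, hr, sector_subset_compl h hrefl hr hr',
      disjoint_left.2 fun x hx => (hr'.subset (Or.inr hx)).2⟩

/-- From a reflex vertex one can enter the polygon in a direction that makes angles of at least
`π / 2` with both edges. -/
theorem exists_direction (hkn : k ≤ n) (hrefl : IsReflexAt p n k) : ∃ d : Plane,
    cross (p k - p (k - 1)) d ≠ 0 ∧ cross d (p (k + 1) - p k) ≠ 0 ∧
    0 ≤ inner ℝ (p k - p (k - 1)) d ∧ inner ℝ (p (k + 1) - p k) d ≤ 0 ∧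
    ∀ᶠ s : ℝ in 𝓝[>] 0, p k + s • d ∈ insideOf (boundaryOf p n) := by
  have hnear := isNear_natCast hk
  obtain ⟨r, hr, hball⟩ := hp.near_ball hnear
  have hane := hp.near_left_ne hnear
  have hbne := hp.near_right_ne hnear
  have hjump := fun {U V} => hp.loopAngle_ne_of_near hnear (by omega) hr (U := U) (V := V)
  rw [param_natCast] at hball hane hbne
  simp only [param_natCast] at hjump
  have htr : loopTrace p n (p 0) ⊆ regionOf (boundaryOf p n) := by
    rw [hp.loopTrace_eq]
    exact subset_union_left
  have hneg : p k - p (k - 1) = -(p (k - 1) - p k) := by abel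
  set y := p k
  set a := p (k - 1) - y
  set b := p (k + 1) - y
  have hyray : y ∈ Metric.ball y r ∩ (ray y a ∪ ray y b) :=
    ⟨Metric.mem_ball_self hr, Or.inl ⟨0, le_rfl, by simp⟩⟩
  have hball' := fun u => eventually_add_smul_mem u Metric.isOpen_ball (Metric.mem_ball_self hr)
    (x := y)
  rw [hneg]
  rcases hp.vertex_cases hk with ⟨c, hc, hb⟩ | h
  · have hsplit := isStarSplit_halfPlane (r := r) y hane hc hb
    have hu := hsplit.union_eq_sdiff (hball r le_rfl)
    obtain ⟨u, hu1⟩ := closure_nonempty_iff.1 ⟨y, hsplit.subset_closure_left hyray⟩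
    obtain ⟨v, hv1⟩ := closure_nonempty_iff.1 ⟨y, hsplit.subset_closure_right hyray⟩
    have hne := hjump hsplit hu hu1 hv1
    have hU : Disjoint (halfPlane a y ∩ Metric.ball y r) (boundaryOf p n) :=
      disjoint_left.2 fun x hx => (hu.subset (Or.inl hx)).2
    have hV : Disjoint (halfPlane (-a) y ∩ Metric.ball y r) (boundaryOf p n) :=
      disjoint_left.2 fun x hx => (hu.subset (Or.inr hx)).2
    have hcp := cross_rot_pos hane
    have hcr : cross (-a) (rot a) ≠ 0 := by
      have : cross (-a) (rot a) = -cross a (rot a) := by simp [cross]; ring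
      rw [this]; exact neg_ne_zero.2 hcp.ne'
    have hcr' : cross (-a) (-rot a) ≠ 0 := by
      have : cross (-a) (-rot a) = cross a (rot a) := by simp [cross]
      rw [this]; exact hcp.ne'
    have hbr : cross (rot a) b ≠ 0 := by
      change cross (rot a) (p (k + 1) - y) ≠ 0
      rw [hb, cross_smul_right, cross_swap]
      exact mul_ne_zero hc.ne (neg_ne_zero.2 hcp.ne')
    have hbr' : cross (-rot a) b ≠ 0 := by
      have : cross (-rot a) b = -cross (rot a) b := by simp [cross]; ring
      rw [this]; exact neg_ne_zero.2 hbr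
    have hi : inner ℝ a (rot a) = 0 := by rw [inner_plane]; simp; ring
    have hi' : inner ℝ b (rot a) = 0 := by
      change inner ℝ (p (k + 1) - y) (rot a) = 0
      rw [hb, inner_smul_left, hi, mul_zero]
    -- The winding numbers on the two half-discs differ, so one is nonzero and that side is inside;
    -- the normal is chosen to point there.
    by_cases h0 : loopAngle p n (p 0) u = 0
    · have hv0 : loopAngle p n (p 0) v ≠ 0 := fun h' => hne (h0.trans h'.symm)
      have hvin := mem_insideOf_of_loopAngle_ne_zero htr (disjoint_left.1 hV hv1) hv0
      refine ⟨-rot a, hcr', hbr', by simp [hi], by simp [hi'], ?_⟩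
      filter_upwards [hball' (-rot a), self_mem_nhdsWithin] with s h1 h2
      refine mem_insideOf_of_isPreconnected hsplit.preconnected_right hV hv1 ⟨?_, h1⟩ hvin
      have h2 : 0 < s := h2
      simp only [halfPlane, mem_ofPred_eq, add_sub_cancel_left, cross_smul_right]
      have : cross (-a) (-rot a) = cross a (rot a) := by simp [cross]
      rw [this]
      exact mul_pos h2 hcp
    · have huin := mem_insideOf_of_loopAngle_ne_zero htr (disjoint_left.1 hU hu1) h0
      refine ⟨rot a, hcr, hbr, by simp [hi], by simp [hi'], ?_⟩
      filter_upwards [hball' (rot a), self_mem_nhdsWithin] with s h1 h2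
      refine mem_insideOf_of_isPreconnected hsplit.preconnected_left hU hu1 ⟨?_, h1⟩ huin
      have h2 : 0 < s := h2
      simp only [halfPlane, mem_ofPred_eq, add_sub_cancel_left, cross_smul_right]
      exact mul_pos h2 hcp
  · have hsplit := isStarSplit_sector h y hr
    have hu := hsplit.union_eq_sdiff (hball r le_rfl)
    have hout := sector_subset_compl h hrefl hr hu
    obtain ⟨u, hu1⟩ := closure_nonempty_iff.1 ⟨y, hsplit.subset_closure_left hyray⟩
    have hu0 := loopAngle_eq_zero_of_notMem_regionOf htr (hout hu1)
    have ha' := norm_pos_iff.2 hane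
    have hb' := norm_pos_iff.2 hbne
    have hCS := abs_le.1 (abs_real_inner_le_norm a b)
    -- The reversed bisector of the angle between `a` and `b`; the required signs of its inner
    -- products are the Cauchy–Schwarz inequality.
    refine ⟨(-‖b‖) • a + (-‖a‖) • b, ?_, ?_, ?_, ?_, ?_⟩
    · have : cross (-a) ((-‖b‖) • a + (-‖a‖) • b) = ‖a‖ * cross a b := by
        rw [cross_add_right, cross_smul_right, cross_smul_right]
        have h1 : cross (-a) a = 0 := by simp [cross]; ring
        have h2 : cross (-a) b = -cross a b := by simp [cross]; ring
        rw [h1, h2]; ring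
      rw [this]
      exact mul_ne_zero ha'.ne' h
    · rw [cross_add_left, cross_smul_left, cross_smul_left, cross_self, mul_zero, add_zero]
      exact mul_ne_zero (neg_ne_zero.2 hb'.ne') h
    · rw [inner_add_right, inner_smul_right, inner_smul_right, inner_neg_left, inner_neg_left,
        real_inner_self_eq_norm_sq]
      nlinarith [mul_nonneg ha'.le (show 0 ≤ ‖a‖ * ‖b‖ + inner ℝ a b by linarith [hCS.1])]
    · rw [inner_add_right, inner_smul_right, inner_smul_right, real_inner_self_eq_norm_sq,
        real_inner_comm]
      nlinarith [mul_nonneg hb'.le (show 0 ≤ ‖a‖ * ‖b‖ + inner ℝ a b by linarith [hCS.1])]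
    · filter_upwards [hball' ((-‖b‖) • a + (-‖a‖) • b), self_mem_nhdsWithin] with s h1 h2
      have h2 : 0 < s := h2
      have hv : y + s • ((-‖b‖) • a + (-‖a‖) • b) ∈ cosector y a b ∩ Metric.ball y r := by
        refine ⟨?_, h1⟩
        rw [smul_add, smul_smul, smul_smul, mem_cosector_iff h]
        left
        have := mul_pos h2 hb'
        linarith
      have hne := hjump hsplit hu hu1 hv
      rw [hu0] at hne
      exact mem_insideOf_of_loopAngle_ne_zero htr (hu.subset (Or.inr hv)).2 hne.symm

end vertex

end IsSimpleLoop

/-! ### Chords from reflex vertices to the opposite arc -/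

/-- A ray that starts into the inside of `K` reaches `K` after a segment in the inside. -/
theorem exists_first_hit {K : Set Plane} (hK : IsClosed K) {y d : Plane} (hd : d ≠ 0)
    (h : ∀ᶠ s : ℝ in 𝓝[>] 0, y + s • d ∈ insideOf K) :
    ∃ s > (0 : ℝ), y + s • d ∈ K ∧ ∀ s' : ℝ, 0 < s' → s' < s → y + s' • d ∈ insideOf K := by
  obtain ⟨ε₀, hε₀, hin⟩ := mem_nhdsGT_iff_exists_Ioo_subset.1 h
  have hε₀ : 0 < ε₀ := hε₀
  set ε := ε₀ / 2
  have hε : 0 < ε := half_pos hε₀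
  have hεin : y + ε • d ∈ insideOf K := hin ⟨hε, half_lt_self hε₀⟩
  have hcont : Continuous fun s : ℝ => y + s • d := by fun_prop
  -- The search starts at `ε`, because `y` itself may lie in `K`. It succeeds since a ray missing
  -- `K` would be an unbounded connected set in a bounded component.
  set T : Set ℝ := Ici ε ∩ (fun s : ℝ => y + s • d) ⁻¹' K
  have hTc : IsClosed T := isClosed_Ici.inter (hK.preimage hcont)
  have hTb : BddBelow T := ⟨ε, fun s hs => hs.1⟩
  have hTne : T.Nonempty := by
    by_contra hemp
    have hd' : Disjoint ((fun s : ℝ => y + s • d) '' Ici ε) K := by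
      refine disjoint_left.2 ?_
      rintro _ ⟨s, hs, rfl⟩ hsK
      exact hemp ⟨s, hs, hsK⟩
    exact not_isBounded_ray_Ici y hd ε (hεin.2.subset
      ((isPreconnected_ray_Ici y d ε).subset_connectedComponentIn ⟨ε, mem_Ici.2 le_rfl, rfl⟩
        (disjoint_left.1 hd')))
  have hs := hTc.csInf_mem hTne hTb
  refine ⟨sInf T, hε.trans_le hs.1, hs.2, fun s' h0 hlt => ?_⟩
  rcases lt_or_ge s' ε with h1 | h1
  · exact hin ⟨h0, h1.trans (half_lt_self hε₀)⟩
  · refine mem_insideOf_of_isPreconnected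
      (isPreconnected_Icc.image (fun s : ℝ => y + s • d) hcont.continuousOn) (disjoint_left.2 ?_)
      ⟨ε, left_mem_Icc.2 h1, rfl⟩ ⟨s', right_mem_Icc.2 h1, rfl⟩ hεin
    rintro _ ⟨s, hs', rfl⟩ hsK
    exact absurd (csInf_le hTb ⟨hs'.1, hsK⟩) (not_le.2 (hs'.2.trans_lt hlt))

/-- `s` is the length parameter at which the ray from `y` in direction `d` first meets `K`; up to
there it runs in the inside of `K`. -/
structure IsChord (K : Set Plane) (y d : Plane) (s : ℝ) : Prop where
  start_mem : y ∈ K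
  pos : 0 < s
  end_mem : y + s • d ∈ K
  mem_insideOf : ∀ s' : ℝ, 0 < s' → s' < s → y + s' • d ∈ insideOf K

section chord

variable {K : Set Plane} {y d : Plane} {s : ℝ} (h : IsChord K y d s)
include h

omit h in
theorem mem_segment_chord (hs : 0 ≤ s) {x : Plane} (hx : x ∈ segment ℝ (y + s • d) y) :
    ∃ s', 0 ≤ s' ∧ s' ≤ s ∧ x = y + s' • d := by
  rw [segment_symm, segment_eq_image'] at hx
  obtain ⟨θ, hθ, rfl⟩ := hx
  refine ⟨θ * s, mul_nonneg hθ.1 hs, mul_le_of_le_one_left hs hθ.2, ?_⟩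
  simp only [add_sub_cancel_left, smul_smul]

theorem IsChord.eq_or_eq {x : Plane} (hx : x ∈ segment ℝ (y + s • d) y) (hxK : x ∈ K) :
    x = y + s • d ∨ x = y := by
  obtain ⟨s', h1, h2, rfl⟩ := mem_segment_chord h.pos.le hx
  rcases h1.eq_or_lt with rfl | h1
  · right; simp
  · rcases h2.eq_or_lt with rfl | h2
    · left; rfl
    · exact absurd hxK (h.mem_insideOf s' h1 h2).1

theorem IsChord.subset_regionOf : segment ℝ (y + s • d) y ⊆ regionOf K := by
  intro x hx
  obtain ⟨s', h1, h2, rfl⟩ := mem_segment_chord h.pos.le hx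
  rcases h1.eq_or_lt with rfl | h1
  · left; simpa using h.start_mem
  · rcases h2.eq_or_lt with rfl | h2
    · exact Or.inl h.end_mem
    · exact Or.inr (h.mem_insideOf s' h1 h2)

end chord

namespace IsSimpleLoop

variable {p : ℕ → Plane} {n : ℕ} (hp : IsSimpleLoop p n)
include hp

/-- A chord from an inner vertex of a boundary path with reflex inner vertices does not end on
that path. -/
theorem chord_end_notMem {m k l : ℕ} (hmn : m < n) (hk : 1 ≤ k) (hlm : l < m) (hkm : k < m)
    (hrefl : ∀ t, 1 ≤ t → t < m → IsReflexAt p n t) {d : Plane} {s : ℝ}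
    (hd1 : cross (p k - p (k - 1)) d ≠ 0) (hd2 : cross d (p (k + 1) - p k) ≠ 0)
    (hch : IsChord (boundaryOf p n) (p k) d s) :
    p k + s • d ∉ segment ℝ (p l) (p (l + 1)) := by
  intro hq
  have hqd : cross d (p k + s • d - p k) = 0 := by
    rw [add_sub_cancel_left, cross_smul_right, cross_self, mul_zero]
  have hd0 : d ≠ 0 := by
    rintro rfl
    simp [cross] at hd2
  -- The chord is transversal to both edges at its starting vertex, so it cannot end on either of
  -- them.
  have hzero : ∀ v : Plane, cross d v ≠ 0 → p k + s • d ∉ segment ℝ (p k) (p k + v) := by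
    intro v hv hmem
    rw [segment_eq_image'] at hmem
    obtain ⟨θ, hθ, he⟩ := hmem
    rw [add_sub_cancel_left, add_right_inj] at he
    have := congrArg (cross d) he
    rw [cross_smul_right, cross_smul_right, cross_self, mul_zero] at this
    have hθ0 := (mul_eq_zero.1 this).resolve_right hv
    rw [hθ0, zero_smul] at he
    exact (smul_ne_zero hch.pos.ne' hd0) he.symm
  have hd1' : cross d (p (k - 1) - p k) ≠ 0 := by
    have : cross d (p (k - 1) - p k) = cross (p k - p (k - 1)) d := by simp [cross]; ring
    rwa [this]
  rcases lt_trichotomy l k with hlk | rfl | hkl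
  · obtain ⟨N, rfl⟩ : ∃ N, k = l + 1 + N := ⟨k - (l + 1), by omega⟩
    rcases Nat.eq_zero_or_pos N with rfl | hN
    · refine hzero _ hd1' ?_
      rw [add_sub_cancel, segment_symm]
      exact hq
    · have hidx : ∀ t ≤ N, ∃ j, l + 1 + N - t = j + 1 ∧ l + 1 + N - (t + 1) = j ∧ j < m ∧
          j + t = l + N := fun t ht =>
        ⟨l + N - t, by omega, by omega, by omega, by omega⟩
      -- If the chord ends before its start along the arc, the arc is run backwards from `p k`.
      refine false_of_chord_returns (K := boundaryOf p n) (z := fun t => p (l + 1 + N - t))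
        (N := N) (q := p (l + 1 + N) + s • d) ?_ ?_ hch.subset_regionOf
        (fun x hx hxK => hch.eq_or_eq hx hxK) ?_ ?_ hqd hd1' hN ?_
      · intro t ht
        obtain ⟨j, h1, h2, -⟩ := hidx t ht
        simp only [h1, h2]
        rw [segment_symm]
        exact hp.segment_subset_boundaryOf j
      · have h1 : l + 1 + N - N = l + 1 := by omega
        have h2 : l + 1 + N - (N + 1) = l := by omega
        simp only [h1, h2]
        rwa [segment_symm]
      · intro t ht
        obtain ⟨j, h1, h2, -⟩ := hidx t ht
        simp only [h1, h2]
        exact (hp.ne_succ j).symm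
      · intro t' ht' t ht hne
        obtain ⟨j, h1, h2, h3, h4⟩ := hidx t ht
        obtain ⟨j', h1', h2', h3', h4'⟩ := hidx t' ht'
        simp only [h1, h2, h1', h2']
        rw [segment_symm, openSegment_symm]
        exact hp.disjoint_openSegment (by omega) (by omega) (by omega)
      · intro t ht1 htN
        obtain ⟨j, h1, h2, h3, h4⟩ := hidx t htN
        have h5 : l + 1 + N - (t - 1) = j + 1 + 1 := by omega
        simp only [h1, h2, h5]
        exact (hp.isCorner (k := j + 1) (by omega) (hrefl _ (by omega) (by omega))).symm
  · exact hzero _ hd2 (by rwa [add_sub_cancel])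
  · obtain ⟨N, rfl⟩ : ∃ N, l = k + N := ⟨l - k, by omega⟩
    refine false_of_chord_returns (K := boundaryOf p n) (z := fun t => p (k + t))
        (N := N) (q := p k + s • d) ?_ hq hch.subset_regionOf
        (fun x hx hxK => hch.eq_or_eq hx hxK) ?_ ?_ hqd hd2 (by omega) ?_
    · exact fun t _ => hp.segment_subset_boundaryOf (k + t)
    · exact fun t _ => hp.ne_succ (k + t)
    · exact fun t' ht' t ht hne => hp.disjoint_openSegment (by omega) (by omega) (by omega)
    · intro t ht1 htN
      have := hp.isCorner (k := k + t) (by omega) (hrefl _ (by omega) (by omega))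
      have h1 : k + t - 1 = k + (t - 1) := by omega
      rw [h1] at this
      exact this

/-- From each inner vertex of a boundary path with reflex inner vertices there is a chord that
makes angles of at least `π / 2` with both edges and ends on the other boundary path. -/
theorem exists_chord {m k : ℕ} (hmn : m < n) (hk : 1 ≤ k) (hkm : k < m)
    (hrefl : ∀ t, 1 ≤ t → t < m → IsReflexAt p n t) : ∃ (d : Plane) (s τ : ℝ),
    0 ≤ inner ℝ (p k - p (k - 1)) d ∧ inner ℝ (p (k + 1) - p k) d ≤ 0 ∧
    IsChord (boundaryOf p n) (p k) d s ∧ m < τ ∧ τ < n ∧ p k + s • d = param p τ := by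
  obtain ⟨d, hd1, hd2, h1, h2, hev⟩ := hp.exists_direction hk (by omega) (hrefl k hk hkm)
  have hd0 : d ≠ 0 := by
    rintro rfl
    simp [cross] at hd2
  obtain ⟨s, hs, hsK, hin⟩ := exists_first_hit (isCompact_boundaryOf p n).isClosed hd0 hev
  have hch : IsChord (boundaryOf p n) (p k) d s := ⟨hp.vertex_mem_boundaryOf k, hs, hsK, hin⟩
  have hsK' := hsK
  rw [hp.boundaryOf_eq 0] at hsK'
  obtain ⟨τ, hτ, hτe⟩ := hsK'
  push_cast at hτ
  rw [zero_add] at hτ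
  have hnot : ∀ τ : ℝ, 0 ≤ τ → τ ≤ m → p k + s • d ≠ param p τ := by
    intro τ h0 hm he
    have : param p τ ∈ param p '' Icc ((0 : ℕ) : ℝ) m := ⟨τ, ⟨by simpa using h0, hm⟩, rfl⟩
    rw [← biUnion_segment_eq_param p (by omega)] at this
    obtain ⟨l, hl, hmem⟩ := mem_iUnion₂.1 this
    rw [← he] at hmem
    exact hp.chord_end_notMem hmn hk (Finset.mem_Ico.1 hl).2 hkm hrefl hd1 hd2 hch hmem
  refine ⟨d, s, τ, h1, h2, hch, ?_, ?_, hτe.symm⟩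
  · by_contra! h
    exact hnot τ hτ.1 h hτe.symm
  -- The parameter `n` gives the vertex `p 0`, which lies on the given path.
  · refine lt_of_le_of_ne hτ.2 ?_
    rintro rfl
    refine hnot 0 le_rfl (Nat.cast_nonneg m) ?_
    rw [← hτe, ← hp.param_add 0 le_rfl, zero_add]

end IsSimpleLoop

/-! ### A chord separates the two boundary arcs -/

theorem isOpen_loopAngle_eq_zero (z : ℕ → Plane) (N : ℕ) (q : Plane) :
    IsOpen {x | x ∉ loopTrace z N q ∧ loopAngle z N q x = 0} := by
  have hc : ContinuousOn (loopAngle z N q) (loopTrace z N q)ᶜ := fun x hx =>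
    (continuousAt_loopAngle hx).continuousWithinAt
  have := hc.isOpen_inter_preimage (isCompact_loopTrace z N q).isClosed.isOpen_compl
    (isOpen_lt continuous_abs continuous_const : IsOpen {a : ℝ | |a| < 2 * Real.pi})
  convert this using 1
  ext x
  constructor
  · rintro ⟨h1, h2⟩
    exact ⟨h1, by simp [h2, Real.pi_pos]⟩
  · rintro ⟨h1, h2⟩
    exact ⟨h1, loopAngle_eq_zero_of_abs_lt h1 h2⟩

theorem iUnion_segment_union_param (p : ℕ → Plane) (k N : ℕ) {σ : ℝ} (h : (k + N : ℕ) ≤ σ) :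
    (⋃ t ∈ Finset.range N, segment ℝ (p (k + t)) (p (k + t + 1))) ∪
      param p '' Icc ((k + N : ℕ) : ℝ) σ = param p '' Icc (k : ℝ) σ := by
  induction N with
  | zero => simp
  | succ N ih =>
    push_cast at h ih ⊢
    rw [Finset.range_add_one, Finset.set_biUnion_insert, union_comm (segment ℝ _ _), union_assoc,
      segment_eq_param, ← image_union]
    push_cast
    rw [← add_assoc, Icc_union_Icc_eq_Icc (by linarith) (by linarith), ih (by linarith)]

theorem sum_range_shift {f : ℕ → ℝ} {n : ℕ} (hf : ∀ t, f (t + n) = f t) (k : ℕ) :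
    ∑ t ∈ Finset.range n, f (k + t) = ∑ t ∈ Finset.range n, f t := by
  induction k with
  | zero => simp
  | succ k ih =>
    rw [← ih]
    have h1 := Finset.sum_range_succ (fun t => f (k + t)) n
    have h2 := Finset.sum_range_succ' (fun t => f (k + t)) n
    rw [h1, hf, add_zero] at h2
    have h3 : ∀ t, k + 1 + t = k + (t + 1) := fun t => by omega
    simp only [h3]
    linarith

namespace IsSimpleLoop

variable {p : ℕ → Plane} {n : ℕ} (hp : IsSimpleLoop p n)
include hp

/-- Boundary points are limits of outside points, where the total angle vanishes; off the loop it is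
continuous. -/
theorem loopAngle_eq_zero_of_mem_boundaryOf {z : ℕ → Plane} {N : ℕ} {q x : Plane}
    (htr : loopTrace z N q ⊆ regionOf (boundaryOf p n)) (hx : x ∈ boundaryOf p n)
    (hxt : x ∉ loopTrace z N q) : loopAngle z N q x = 0 := by
  by_contra hne
  have hev := (continuousAt_loopAngle hxt).eventually_ne hne
  obtain ⟨y, hy, hyo⟩ := mem_closure_iff_nhds.1 (hp.boundaryOf_subset_closure_compl hx) _ hev
  exact hy (loopAngle_eq_zero_of_notMem_regionOf htr hyo)

/-- A chord with ends `param p k` and `param p τ` separates the two arcs of the boundary within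
the polygon. -/
theorem false_of_isPreconnected_of_chord {k : ℕ} {d : Plane} {s τ : ℝ} (hkτ : k < τ)
    (hτ : τ < k + n) (hch : IsChord (boundaryOf p n) (p k) d s) (hq : p k + s • d = param p τ)
    {S : Set Plane} (hS : IsPreconnected S) (hSR : S ⊆ regionOf (boundaryOf p n))
    (hSd : Disjoint S (segment ℝ (p k + s • d) (p k))) {s₁ s₂ : ℝ} (h1 : k < s₁) (h1' : s₁ < τ)
    (h2 : τ < s₂) (h2' : s₂ < k + n) (hs1 : param p s₁ ∈ S) (hs2 : param p s₂ ∈ S) : False := by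
  set q := p k + s • d
  set C := segment ℝ q (p k)
  have hk0 : (0 : ℝ) ≤ k := Nat.cast_nonneg k
  have hτ0 : 0 ≤ τ := hk0.trans hkτ.le
  obtain ⟨N₁, hN₁⟩ : ∃ N, ⌊τ⌋₊ = k + N := by
    have : k ≤ ⌊τ⌋₊ := Nat.le_floor hkτ.le
    exact ⟨⌊τ⌋₊ - k, by omega⟩
  have hle := Nat.floor_le hτ0
  have hlt := Nat.lt_floor_add_one τ
  rw [hN₁] at hle hlt
  obtain ⟨N₂, hN₂⟩ : ∃ N, n = N₁ + 1 + N := by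
    have : (k + N₁ : ℕ) < (k + n : ℝ) := by linarith
    have : k + N₁ < k + n := by exact_mod_cast this
    exact ⟨n - (N₁ + 1), by omega⟩
  have hN₂' : k + N₁ + 1 + N₂ = k + n := by omega
  -- The point `q` lies on the edge from `p (k + N₁)`. The first loop follows the arc from `p k` to
  -- `q`, the second the arc from the vertex after `q` round to `p k`. They run through the chord in
  -- opposite directions.
  set z₁ : ℕ → Plane := fun t => p (k + t)
  set z₂ : ℕ → Plane := fun t => p (k + N₁ + 1 + t)
  have hz₂ : z₂ N₂ = p k := by
    simp only [z₂, hN₂']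
    exact hp.periodic k
  have hT₁ : loopTrace z₁ N₁ q = param p '' Icc (k : ℝ) τ ∪ C := by
    rw [← iUnion_segment_union_param p k N₁ hle, loopTrace]
    congr 2
    rw [← segment_param p (t := k + N₁) le_rfl hle hlt.le, ← hq, param_natCast]
  have hT₂ : loopTrace z₂ N₂ q = param p '' Icc τ (k + n : ℝ) ∪ C := by
    have h3 : param p '' Icc (τ : ℝ) (k + N₁ + 1 : ℕ) = segment ℝ q (z₂ 0) := by
      rw [hq, ← segment_param p hle (by push_cast at hlt ⊢; exact hlt.le) (by push_cast; exact le_rfl),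
        param_natCast]
    have h4 := iUnion_segment_union_param p (k + N₁ + 1) N₂ (le_refl ((k + N₁ + 1 + N₂ : ℕ) : ℝ))
    rw [Icc_self, image_singleton, param_natCast, show p (k + N₁ + 1 + N₂) = p k from hz₂] at h4
    have h5 : param p '' Icc τ (k + n : ℝ) = param p '' Icc (τ : ℝ) (k + N₁ + 1 : ℕ) ∪
        param p '' Icc ((k + N₁ + 1 : ℕ) : ℝ) (k + N₁ + 1 + N₂ : ℕ) := by
      rw [← image_union, Icc_union_Icc_eq_Icc (by push_cast at hlt ⊢; exact hlt.le)
        (by exact_mod_cast (Nat.le_add_right _ _)), hN₂']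
      push_cast
      rfl
    rw [h5, ← h4, h3, loopTrace, hz₂, segment_symm ℝ (p k) q]
    have h6 : p k ∈ C := right_mem_segment ℝ _ _
    ext x
    simp only [mem_union, mem_singleton_iff, z₂]
    constructor
    · rintro ((h | h) | h)
      · exact Or.inl (Or.inr (Or.inl h))
      · exact Or.inr h
      · exact Or.inl (Or.inl h)
    · rintro ((h | (h | rfl)) | h)
      · exact Or.inr h
      · exact Or.inl (Or.inl h)
      · exact Or.inl (Or.inr h6)
      · exact Or.inl (Or.inr h)
  have hK : boundaryOf p n = param p '' Icc (k : ℝ) τ ∪ param p '' Icc τ (k + n : ℝ) := by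
    rw [← image_union, Icc_union_Icc_eq_Icc hkτ.le hτ.le, hp.boundaryOf_eq k]
  have hpk : param p (k + n : ℝ) = p k := by rw [hp.param_add _ hk0, param_natCast]
  have hinter : ∀ x, x ∈ param p '' Icc (k : ℝ) τ → x ∈ param p '' Icc τ (k + n : ℝ) → x ∈ C := by
    rintro _ ⟨a, ha, rfl⟩ ⟨b, hb, he⟩
    rcases hb.2.eq_or_lt with rfl | hb2
    · rw [← he, hpk]
      exact right_mem_segment ℝ _ _
    · have := (hp.param_eq_iff (hk0.trans ha.1) (ha.2.trans hb.1) (by linarith [ha.1])).1 he.symm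
      have : a = τ := le_antisymm ha.2 (by linarith [hb.1])
      rw [this, ← hq]
      exact left_mem_segment ℝ _ _
  have hCR : C ⊆ regionOf (boundaryOf p n) := hch.subset_regionOf
  have hR₁ : loopTrace z₁ N₁ q ⊆ regionOf (boundaryOf p n) := by
    rw [hT₁, hK] at *
    exact union_subset (subset_union_left.trans subset_union_left) hCR
  have hR₂ : loopTrace z₂ N₂ q ⊆ regionOf (boundaryOf p n) := by
    rw [hT₂, hK] at *
    exact union_subset (subset_union_right.trans subset_union_left) hCR
  -- The two contributions of the chord cancel, and the two parts of the edge containing `q` add up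
  -- to that edge.
  have hsum : ∀ x ∉ boundaryOf p n, x ∉ C →
      loopAngle z₁ N₁ q x + loopAngle z₂ N₂ q x = loopAngle p n (p 0) x := by
    intro x hxK hxC
    have hpn : p n = p 0 := by simpa using hp.periodic 0
    have hseg : q ∈ segment ℝ (p (k + N₁)) (p (k + N₁ + 1)) := by
      rw [segment_eq_param, hq]
      exact ⟨τ, ⟨hle, hlt.le⟩, rfl⟩
    have e1 := sightAngle_add hseg (fun h => hxK (hp.segment_subset_boundaryOf _ h))
    have e2 := sightAngle_swap hxC
    have e3 := sum_range_shift (f := fun t => sightAngle (p t) (p (t + 1)) x) (n := n)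
      (fun t => by rw [add_right_comm, hp.periodic, hp.periodic]) k
    have e4 : ∑ t ∈ Finset.range n, sightAngle (p (k + t)) (p (k + t + 1)) x =
        ∑ t ∈ Finset.range N₁, sightAngle (p (k + t)) (p (k + t + 1)) x +
        sightAngle (p (k + N₁)) (p (k + N₁ + 1)) x +
        ∑ t ∈ Finset.range N₂, sightAngle (p (k + N₁ + 1 + t)) (p (k + N₁ + 1 + t + 1)) x := by
      rw [hN₂, Finset.sum_range_add, Finset.sum_range_succ]
      simp only [add_assoc]
    rw [loopAngle, loopAngle, loopAngle, hpn, sightAngle_self, add_zero, add_zero, hz₂, ← e3, e4]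
    simp only [z₁, z₂, add_zero, ← add_assoc] at *
    linarith
  obtain ⟨c, hc, hcin⟩ := hp.exists_loopAngle_eq
  -- Each open arc belongs to one of these open sets, since the total angle of the opposite loop is
  -- `0` there. At inside points the two totals add up to `c`, so at least one of the conditions
  -- holds, but never exactly the pair defining `G₀ ∩ G₁`.
  set G₀ : Set Plane := (loopTrace z₂ N₂ q)ᶜ ∩ loopAngle z₂ N₂ q ⁻¹' {c}ᶜ
  set G₁ : Set Plane := {x | x ∉ loopTrace z₁ N₁ q ∧ loopAngle z₁ N₁ q x = 0}
  have hG₀ : IsOpen G₀ :=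
    ContinuousOn.isOpen_inter_preimage (fun x hx => (continuousAt_loopAngle hx).continuousWithinAt)
      (isCompact_loopTrace _ _ _).isClosed.isOpen_compl isOpen_compl_singleton
  have hG₁ : IsOpen G₁ := isOpen_loopAngle_eq_zero _ _ _
  have hG₀K : ∀ x ∈ param p '' Icc (k : ℝ) τ, x ∉ C → x ∈ G₀ := by
    intro x hx hxC
    have hxt : x ∉ loopTrace z₂ N₂ q := by
      rw [hT₂]
      rintro (h | h)
      · exact hxC (hinter x hx h)
      · exact hxC h
    refine ⟨hxt, ?_⟩
    have := hp.loopAngle_eq_zero_of_mem_boundaryOf hR₂ (hK ▸ Or.inl hx) hxt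
    rw [mem_preimage, this]
    exact hc.symm
  have hG₁K : ∀ x ∈ param p '' Icc τ (k + n : ℝ), x ∉ C → x ∈ G₁ := by
    intro x hx hxC
    have hxt : x ∉ loopTrace z₁ N₁ q := by
      rw [hT₁]
      rintro (h | h)
      · exact hxC (hinter x h hx)
      · exact hxC h
    exact ⟨hxt, hp.loopAngle_eq_zero_of_mem_boundaryOf hR₁ (hK ▸ Or.inr hx) hxt⟩
  have hSC : ∀ x ∈ S, x ∉ C := fun x hx => disjoint_left.1 hSd hx
  have hcover : S ⊆ G₀ ∪ G₁ := by
    intro x hx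
    rcases hSR hx with h | h
    · rw [hK] at h
      rcases h with h | h
      · exact Or.inl (hG₀K x h (hSC x hx))
      · exact Or.inr (hG₁K x h (hSC x hx))
    · have h3 := hsum x h.1 (hSC x hx)
      rw [hcin x h] at h3
      have h4 : x ∉ param p '' Icc (k : ℝ) τ ∧ x ∉ param p '' Icc τ (k + n : ℝ) := by
        have := h.1
        rw [hK] at this
        exact ⟨fun h => this (Or.inl h), fun h => this (Or.inr h)⟩
      by_cases h5 : loopAngle z₂ N₂ q x = c
      · refine Or.inr ⟨?_, by linarith⟩
        rw [hT₁]
        rintro (h6 | h6)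
        · exact h4.1 h6
        · exact hSC x hx h6
      · refine Or.inl ⟨?_, h5⟩
        rw [hT₂]
        rintro (h6 | h6)
        · exact h4.2 h6
        · exact hSC x hx h6
  obtain ⟨x, hx, hx0, hx1⟩ := hS G₀ G₁ hG₀ hG₁ hcover
    ⟨_, hs1, hG₀K _ ⟨s₁, ⟨h1.le, h1'.le⟩, rfl⟩ (hSC _ hs1)⟩
    ⟨_, hs2, hG₁K _ ⟨s₂, ⟨h2.le, h2'.le⟩, rfl⟩ (hSC _ hs2)⟩
  have hxK : x ∉ boundaryOf p n := by
    have h3 := hx0.1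
    have h4 := hx1.1
    rw [mem_compl_iff, hT₂] at h3
    rw [hT₁] at h4
    rw [hK]
    rintro (h | h)
    · exact h4 (Or.inl h)
    · exact h3 (Or.inl h)
  have hxin : x ∈ insideOf (boundaryOf p n) := (hSR hx).resolve_left hxK
  have h3 := hsum x hxK (hSC x hx)
  rw [hcin x hxin, hx1.2, zero_add] at h3
  exact hx0.2 h3

end IsSimpleLoop

/-! ### Length estimates for paths that cross the chords -/

theorem edist_add_edist_le_eVariationOn {δ : unitInterval → Plane} {a b v : unitInterval}
    (hv : v ∈ Icc a b) : edist (δ a) (δ v) + edist (δ v) (δ b) ≤ eVariationOn δ (Icc a b) := by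
  rw [← univ_inter (Icc a b), ← eVariationOn.Icc_add_Icc δ hv.1 hv.2 (mem_univ v)]
  simp only [univ_inter]
  exact add_le_add
    (eVariationOn.edist_le δ (left_mem_Icc.2 hv.1) (right_mem_Icc.2 hv.1))
    (eVariationOn.edist_le δ (left_mem_Icc.2 hv.2) (right_mem_Icc.2 hv.2))

theorem sum_eVariationOn_eq_pathLength {x y : Plane} (δ : Path x y) {u : ℕ → unitInterval}
    (hu : Monotone u) {m : ℕ} (h0 : u 0 = 0) (hm : u m = 1) :
    ∑ k ∈ Finset.range m, eVariationOn δ (Icc (u k) (u (k + 1))) = pathLength δ := by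
  rw [eVariationOn.sum' _ hu, h0, hm, pathLength]
  congr 1
  ext v
  simp only [mem_Icc, mem_univ, iff_true]
  exact ⟨v.2.1, v.2.2⟩

/-- A vector whose component along `e` is at least that of `e` is at least as long as `e`. -/
theorem norm_le_of_inner_le {e x : Plane} (he : e ≠ 0) (h : inner ℝ e e ≤ inner ℝ e x) :
    ‖e‖ ≤ ‖x‖ := by
  rw [real_inner_self_eq_norm_sq] at h
  have h1 := real_inner_le_norm e x
  have h2 := norm_pos_iff.2 he
  have h3 : ‖e‖ * ‖e‖ ≤ ‖e‖ * ‖x‖ := by nlinarith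
  exact le_of_mul_le_mul_left h3 h2

/-- Expanding the square, `‖x - e‖ ^ 2 = ‖x‖ ^ 2 - 2 ⟪x, e⟫ + ‖e‖ ^ 2` is at most `0`. -/
theorem eq_of_inner_le {e x : Plane} (h : inner ℝ e e ≤ inner ℝ e x) (hn : ‖x‖ ≤ ‖e‖) :
    x = e := by
  rw [← sub_eq_zero, ← norm_eq_zero]
  rw [real_inner_self_eq_norm_sq] at h
  have h1 := norm_sub_sq_real x e
  rw [real_inner_comm] at h1
  have h2 : ‖x‖ ^ 2 ≤ ‖e‖ ^ 2 := by gcongr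
  have h3 : ‖x - e‖ ^ 2 ≤ 0 := by linarith
  nlinarith [norm_nonneg (x - e)]

/-- The path `δ` passes, in order, points `p k + w` with `w` at an angle of at least `π / 2` to the
adjacent edges of the polygonal line `p 0, …, p m`. -/
structure IsCrossing (p : ℕ → Plane) (m : ℕ) (δ : Path (p 0) (p m)) (u : ℕ → unitInterval) :
    Prop where
  monotone : Monotone u
  zero : u 0 = 0
  last : u m = 1
  inner_left : ∀ k < m, 0 ≤ inner ℝ (p (k + 1) - p k) (δ (u (k + 1)) - p (k + 1))
  inner_right : ∀ k < m, inner ℝ (p (k + 1) - p k) (δ (u k) - p k) ≤ 0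

namespace IsCrossing

variable {p : ℕ → Plane} {m : ℕ} {δ : Path (p 0) (p m)} {u : ℕ → unitInterval}
  (h : IsCrossing p m δ u) (hne : ∀ k < m, p k ≠ p (k + 1))
include h

/-- The two crossing points lie beyond the two ends of the edge in its direction, so the projection
of their difference covers the edge. -/
theorem inner_le {k : ℕ} (hk : k < m) : inner ℝ (p (k + 1) - p k) (p (k + 1) - p k) ≤
    inner ℝ (p (k + 1) - p k) (δ (u (k + 1)) - δ (u k)) := by
  have h1 := h.inner_left k hk
  have h2 := h.inner_right k hk
  have h3 : δ (u (k + 1)) - δ (u k) = (p (k + 1) - p k) + (δ (u (k + 1)) - p (k + 1)) -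
      (δ (u k) - p k) := by abel
  rw [h3, inner_sub_right _ _ (δ (u k) - p k), inner_add_right]
  linarith

include hne

theorem edist_le {k : ℕ} (hk : k < m) :
    edist (p k) (p (k + 1)) ≤ eVariationOn δ (Icc (u k) (u (k + 1))) := by
  have h1 := norm_le_of_inner_le (sub_ne_zero.2 (hne k hk).symm) (h.inner_le hk)
  have h2 : dist (p k) (p (k + 1)) ≤ dist (δ (u k)) (δ (u (k + 1))) := by
    rw [dist_comm, dist_eq_norm, dist_comm, dist_eq_norm]
    exact h1
  refine le_trans ?_ (eVariationOn.edist_le δ (left_mem_Icc.2 (h.monotone k.le_succ))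
    (right_mem_Icc.2 (h.monotone k.le_succ)))
  rw [edist_dist, edist_dist]
  exact ENNReal.ofReal_le_ofReal h2

theorem sum_edist_le :
    ∑ k ∈ Finset.range m, edist (p k) (p (k + 1)) ≤ pathLength δ := by
  rw [← sum_eVariationOn_eq_pathLength δ h.monotone h.zero h.last]
  exact Finset.sum_le_sum fun k hk => h.edist_le hne (Finset.mem_range.1 hk)

variable (hlen : pathLength δ ≤ ∑ k ∈ Finset.range m, edist (p k) (p (k + 1)))
include hlen

/-- The termwise inequalities add up to an equality of finite sums, so none of them is strict. -/
theorem eVariationOn_le {k : ℕ} (hk : k < m) :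
    eVariationOn δ (Icc (u k) (u (k + 1))) ≤ edist (p k) (p (k + 1)) := by
  by_contra! hlt
  rw [← sum_eVariationOn_eq_pathLength δ h.monotone h.zero h.last] at hlen
  refine absurd hlen (not_le.2 ?_)
  rw [← Finset.add_sum_erase _ _ (Finset.mem_range.2 hk),
    ← Finset.add_sum_erase (Finset.range m) (fun k => eVariationOn δ _) (Finset.mem_range.2 hk)]
  refine ENNReal.add_lt_add_of_lt_of_le ?_ hlt (Finset.sum_le_sum fun k hk =>
    h.edist_le hne (Finset.mem_range.1 (Finset.mem_of_mem_erase hk)))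
  exact (ENNReal.sum_lt_top.2 fun _ _ => edist_lt_top _ _).ne

theorem dist_add_dist_le {k : ℕ} (hk : k < m) {v : unitInterval}
    (hv : v ∈ Icc (u k) (u (k + 1))) :
    dist (δ (u k)) (δ v) + dist (δ v) (δ (u (k + 1))) ≤ dist (p k) (p (k + 1)) := by
  have h1 := (edist_add_edist_le_eVariationOn (δ := δ) hv).trans (h.eVariationOn_le hne hlen hk)
  rw [edist_dist, edist_dist, edist_dist, ← ENNReal.ofReal_add dist_nonneg dist_nonneg] at h1
  exact (ENNReal.ofReal_le_ofReal_iff dist_nonneg).1 h1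

/-- By induction: from `p k` on, the next displacement is no longer than the edge and projects onto
all of it, hence equals it. -/
theorem apply_eq {k : ℕ} (hk : k ≤ m) : δ (u k) = p k := by
  induction k with
  | zero => rw [h.zero, δ.source]
  | succ k ih =>
    have h1 := h.dist_add_dist_le hne hlen hk (v := u (k + 1))
      (right_mem_Icc.2 (h.monotone k.le_succ))
    rw [dist_self, add_zero, dist_comm, dist_eq_norm, dist_comm, dist_eq_norm] at h1
    have h2 := eq_of_inner_le (h.inner_le hk) h1
    rw [ih (by omega), sub_left_inj] at h2
    exact h2

/-- Equality in the triangle inequality. -/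
theorem apply_mem_segment {k : ℕ} (hk : k < m) {v : unitInterval}
    (hv : v ∈ Icc (u k) (u (k + 1))) : δ v ∈ segment ℝ (p k) (p (k + 1)) := by
  have h1 := h.dist_add_dist_le hne hlen hk hv
  rw [h.apply_eq hne hlen hk.le, h.apply_eq hne hlen hk] at h1
  rw [mem_segment_iff_wbtw, ← dist_add_dist_eq_iff]
  exact le_antisymm h1 (dist_triangle _ _ _)

theorem range_eq (hm : 0 < m) :
    range δ = ⋃ k ∈ Finset.range m, segment ℝ (p k) (p (k + 1)) := by
  apply subset_antisymm
  · rintro _ ⟨v, rfl⟩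
    have hex : ∀ j ≤ m, v ≤ u j → 0 < j → ∃ k < m, v ∈ Icc (u k) (u (k + 1)) := by
      intro j
      induction j with
      | zero => intro _ _ h'; omega
      | succ j ih =>
        intro hj hv _
        by_cases hvj : v ≤ u j
        · rcases Nat.eq_zero_or_pos j with rfl | hj0
          · rw [h.zero] at hvj
            exact ⟨0, hm, by rw [h.zero]; exact v.2.1, hv⟩
          · exact ih (by omega) hvj hj0
        · exact ⟨j, hj, (not_le.1 hvj).le, hv⟩
    obtain ⟨k, hk, hv⟩ := hex m le_rfl (by rw [h.last]; exact v.2.2) hm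
    exact mem_iUnion₂.2 ⟨k, Finset.mem_coe.2 (Finset.mem_range.2 hk), h.apply_mem_segment hne hlen hk hv⟩
  · refine iUnion₂_subset fun k hk => ?_
    have hk : k < m := Finset.mem_range.1 (Finset.mem_coe.1 hk)
    intro y hy
    rw [segment_eq_image'] at hy
    obtain ⟨θ, hθ, rfl⟩ := hy
    set e := p (k + 1) - p k with he
    have hepos : 0 < inner ℝ e e := by
      rw [real_inner_self_eq_norm_sq]
      have := norm_pos_iff.2 (sub_ne_zero.2 (hne k hk).symm)
      positivity
    -- The path stays on the edge, where a point is determined by its projection to `e`; the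
    -- intermediate value theorem gives every such value.
    have hcont : ContinuousOn (fun v => inner ℝ e (δ v - p k)) (Icc (u k) (u (k + 1))) := by
      have := δ.continuous
      fun_prop
    have hivt := intermediate_value_Icc (h.monotone k.le_succ) hcont
    rw [h.apply_eq hne hlen hk.le, h.apply_eq hne hlen hk, sub_self, inner_zero_right, ← he] at hivt
    obtain ⟨v, hv, hveq⟩ := hivt (show θ * inner ℝ e e ∈ _ from
      ⟨mul_nonneg hθ.1 hepos.le, mul_le_of_le_one_left hepos.le hθ.2⟩)
    have hmem := h.apply_mem_segment hne hlen hk hv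
    rw [segment_eq_image'] at hmem
    obtain ⟨θ', _, hθ'⟩ := hmem
    simp only at hveq hθ'
    rw [← hθ', add_sub_cancel_left, inner_smul_right] at hveq
    have : θ' = θ := mul_right_cancel₀ hepos.ne' hveq
    exact ⟨v, by rw [← hθ', this]⟩

end IsCrossing

/-! ### Crossing the chords in order -/

namespace IsSimpleLoop

variable {p : ℕ → Plane} {n : ℕ} (hp : IsSimpleLoop p n)
include hp

/-- Every path in the polygon with the same endpoints as a boundary path with reflex inner vertices
crosses the chords at those vertices in order. -/
theorem exists_isCrossing {m : ℕ} (hm : 0 < m) (hmn : m < n)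
    (hrefl : ∀ t, 1 ≤ t → t < m → IsReflexAt p n t) (δ : Path (p 0) (p m))
    (hδ : ∀ v, δ v ∈ regionOf (boundaryOf p n)) : ∃ u, IsCrossing p m δ u := by
  have hchord := fun k (hk : 1 ≤ k ∧ k < m) => hp.exists_chord hmn hk.1 hk.2 hrefl
  choose! d s τ hin1 hin2 hch hτm hτn hq using hchord
  -- The barriers to be met in order: the chords, and at both ends the single endpoint in place of a
  -- chord.
  set C : ℕ → Set Plane := fun k =>
    if k = 0 then {p 0} else if k < m then segment ℝ (p k + s k • d k) (p k) else {p m}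
  have hC0 : C 0 = {p 0} := by simp [C]
  have hCm : ∀ k, m ≤ k → C k = {p m} := fun k hk => by
    simp only [C]
    rw [if_neg (by omega), if_neg (by omega)]
  have hCk : ∀ k, 1 ≤ k → k < m → C k = segment ℝ (p k + s k • d k) (p k) := fun k h1 h2 => by
    simp only [C]
    rw [if_neg (by omega), if_pos h2]
  have hCmem : ∀ k ≤ m, p k ∈ C k := by
    intro k hk
    rcases Nat.eq_zero_or_pos k with rfl | h0
    · rw [hC0]; rfl
    · rcases hk.eq_or_lt with rfl | h1
      · rw [hCm k le_rfl]; rfl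
      · rw [hCk k h0 h1]; exact right_mem_segment ℝ _ _
  have hCpre : ∀ k, IsPreconnected (C k) := by
    intro k
    simp only [C]
    split_ifs
    · exact isPreconnected_singleton
    · exact (convex_segment _ _).isPreconnected
    · exact isPreconnected_singleton
  have hCR : ∀ k, C k ⊆ regionOf (boundaryOf p n) := by
    intro k
    simp only [C]
    split_ifs with h1 h2
    · exact singleton_subset_iff.2 (Or.inl (hp.vertex_mem_boundaryOf 0))
    · exact (hch k ⟨by omega, h2⟩).subset_regionOf
    · exact singleton_subset_iff.2 (Or.inl (hp.vertex_mem_boundaryOf m))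
  have hleft : ∀ k < m, ∀ x ∈ C (k + 1), 0 ≤ inner ℝ (p (k + 1) - p k) (x - p (k + 1)) := by
    intro k hk x hx
    rcases (show k + 1 ≤ m from hk).eq_or_lt with h1 | h1
    · rw [hCm _ h1.ge, mem_singleton_iff] at hx
      rw [hx, h1, sub_self, inner_zero_right]
    · rw [hCk _ (by omega) h1] at hx
      have hk1 : 1 ≤ k + 1 ∧ k + 1 < m := ⟨by omega, h1⟩
      obtain ⟨s', h2, -, rfl⟩ := mem_segment_chord (hch _ hk1).pos.le hx
      rw [add_sub_cancel_left, inner_smul_right]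
      exact mul_nonneg h2 (hin1 (k + 1) hk1)
  have hright : ∀ k < m, ∀ x ∈ C k, inner ℝ (p (k + 1) - p k) (x - p k) ≤ 0 := by
    intro k hk x hx
    rcases Nat.eq_zero_or_pos k with rfl | h0
    · rw [hC0, mem_singleton_iff] at hx
      rw [hx, sub_self, inner_zero_right]
    · rw [hCk _ h0 hk] at hx
      obtain ⟨s', h2, -, rfl⟩ := mem_segment_chord (hch _ ⟨h0, hk⟩).pos.le hx
      rw [add_sub_cancel_left, inner_smul_right]
      exact mul_nonpos_of_nonneg_of_nonpos h2 (hin2 k ⟨h0, hk⟩)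
  have hstep : ∀ k (v : unitInterval), k < m → δ v ∈ C k → ∃ v', v ≤ v' ∧ δ v' ∈ C (k + 1) := by
    intro k v hk hv
    rcases (show k + 1 ≤ m from hk).eq_or_lt with h1 | h1
    · exact ⟨1, v.2.2, by rw [hCm _ h1.ge, δ.target]; rfl⟩
    by_contra! hno
    have hk1 : 1 ≤ k + 1 ∧ k + 1 < m := ⟨by omega, h1⟩
    -- If the rest of the path missed the next chord, it would join the present barrier to `p m`
    -- without meeting that chord, although `p k` and `p m` lie on different arcs.
    set S : Set Plane := C k ∪ δ '' Icc v 1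
    have hS : IsPreconnected S :=
      (hCpre k).union (δ v) hv ⟨v, left_mem_Icc.2 v.2.2, rfl⟩
        (isPreconnected_Icc.image _ δ.continuous.continuousOn)
    have hSR : S ⊆ regionOf (boundaryOf p n) := by
      refine union_subset (hCR k) ?_
      rintro _ ⟨v', _, rfl⟩
      exact hδ v'
    have hSd : Disjoint S (C (k + 1)) := by
      refine disjoint_left.2 ?_
      rintro x (hx | ⟨v', hv', rfl⟩) hx'
      -- Consecutive barriers are disjoint: the strip orthogonal to the edge from `p k` lies between
      -- them.
      · have e1 := hright k hk x hx
        have e2 := hleft k hk x hx'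
        have e3 : x - p k = (p (k + 1) - p k) + (x - p (k + 1)) := by abel
        rw [e3, inner_add_right, real_inner_self_eq_norm_sq] at e1
        have := norm_pos_iff.2 (sub_ne_zero.2 (hp.ne_succ k).symm)
        have : 0 < ‖p (k + 1) - p k‖ ^ 2 := by positivity
        linarith
      · exact hno v' hv'.1 hx'
    rw [hCk _ hk1.1 h1] at hSd
    have e1 : ((k + 1 : ℕ) : ℝ) < m := by exact_mod_cast h1
    have e2 := hτm (k + 1) hk1
    have e3 := hτn (k + 1) hk1
    have hk0 : (0 : ℝ) ≤ k := Nat.cast_nonneg k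
    refine hp.false_of_isPreconnected_of_chord (k := k + 1) (s₁ := m) (s₂ := k + n)
      (e1.trans e2) (by push_cast; linarith) (hch _ hk1) (hq _ hk1) hS hSR hSd e1 e2
      (by linarith) (by push_cast; linarith) ?_ ?_
    · rw [param_natCast]
      exact Or.inr ⟨1, right_mem_Icc.2 v.2.2, δ.target⟩
    · rw [hp.param_add _ hk0, param_natCast]
      exact Or.inl (hCmem k hk.le)
  choose! f hf1 hf2 using hstep
  set u : ℕ → unitInterval := fun k => Nat.rec 0 (fun k v => if k < m then f k v else 1) k
  have hu0 : u 0 = 0 := rfl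
  have husucc : ∀ k, u (k + 1) = if k < m then f k (u k) else 1 := fun k => rfl
  have huC : ∀ k ≤ m, δ (u k) ∈ C k := by
    intro k
    induction k with
    | zero => intro _; rw [hu0, hC0, δ.source]; rfl
    | succ k ih =>
      intro hk
      rw [husucc, if_pos (Nat.lt_of_succ_le hk)]
      exact hf2 k _ hk (ih (by omega))
  have huu : Monotone u := by
    refine monotone_nat_of_le_succ fun k => ?_
    rw [husucc]
    split_ifs with h1
    · exact hf1 k _ h1 (huC k h1.le)
    · exact (u k).2.2
  -- The recursion may reach `p m` before time `1`; from index `m` on the times are reset to `1`.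
  set u' : ℕ → unitInterval := fun k => if k < m then u k else 1
  have hu'm : ∀ k, m ≤ k → u' k = 1 := fun k hk => if_neg (by omega)
  have hu'C : ∀ k ≤ m, δ (u' k) ∈ C k := by
    intro k hk
    rcases hk.eq_or_lt with rfl | h1
    · rw [hu'm k le_rfl, hCm k le_rfl, δ.target]; rfl
    · simp only [u', if_pos h1]
      exact huC k hk
  refine ⟨u', ?_, ?_, hu'm m le_rfl, fun k hk => hleft k hk _ (hu'C (k + 1) hk),
    fun k hk => hright k hk _ (hu'C k hk.le)⟩
  · intro a b hab
    simp only [u']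
    split_ifs with h1 h2
    · exact huu hab
    · exact (u a).2.2
    · omega
    · exact le_rfl
  · simp only [u', if_pos hm, hu0]

end IsSimpleLoop

/-! ### Lengths of polygonal paths -/

theorem pathLength_symm {x y : Plane} (γ : Path x y) : pathLength γ.symm = pathLength γ := by
  have h := eVariationOn.comp_eq_of_antitoneOn (γ : unitInterval → Plane) (t := univ)
    unitInterval.symm fun a _ b _ hab => unitInterval.symm_le_symm.2 hab
  rwa [image_univ, (Function.Involutive.surjective unitInterval.symm_symm).range_eq] at h

/-- On each half of the unit interval the concatenation is a monotone reparametrization of one of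
the paths. -/
theorem pathLength_trans {x y z : Plane} (γ : Path x y) (γ' : Path y z) :
    pathLength (γ.trans γ') = pathLength γ + pathLength γ' := by
  set h : unitInterval := ⟨1 / 2, by norm_num, by norm_num⟩
  have hu : (univ : Set unitInterval) = Iic h ∪ Ici h := Iic_union_Ici.symm
  rw [pathLength, hu, eVariationOn.union _ isGreatest_Iic isLeast_Ici]
  set φ : unitInterval → unitInterval := fun t => projIcc 0 1 zero_le_one (2 * t)
  set ψ : unitInterval → unitInterval := fun t => projIcc 0 1 zero_le_one (2 * t - 1)
  have hφ : Monotone φ := fun a b hab => monotone_projIcc _ (by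
    have : (a : ℝ) ≤ b := hab
    linarith)
  have hψ : Monotone ψ := fun a b hab => monotone_projIcc _ (by
    have : (a : ℝ) ≤ b := hab
    linarith)
  have h1 : EqOn (γ.trans γ') (γ ∘ φ) (Iic h) := by
    intro t ht
    have ht : (t : ℝ) ≤ 1 / 2 := ht
    simp only [Path.trans_apply, dif_pos ht, Function.comp, φ]
    rw [projIcc_of_mem]
  have h2 : EqOn (γ.trans γ') (γ' ∘ ψ) (Ici h) := by
    intro t ht
    have ht : 1 / 2 ≤ (t : ℝ) := ht
    rcases ht.eq_or_lt with ht' | ht'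
    · have e1 : (t : ℝ) ≤ 1 / 2 := ht'.ge
      simp only [Path.trans_apply, Function.comp, ψ, ← ht']
      norm_num
    · simp only [Path.trans_apply, dif_neg (not_le.2 ht'), Function.comp, ψ]
      rw [projIcc_of_mem]
  have h3 : φ '' Iic h = univ := by
    refine eq_univ_of_forall fun t => ⟨⟨t / 2, by linarith [t.2.1], by linarith [t.2.2]⟩, ?_, ?_⟩
    · change (t : ℝ) / 2 ≤ 1 / 2
      linarith [t.2.2]
    · simp only [φ, mul_div_cancel₀ (t : ℝ) (two_ne_zero)]
      exact projIcc_val _ t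
  have h4 : ψ '' Ici h = univ := by
    refine eq_univ_of_forall fun t => ⟨⟨(t + 1) / 2, by linarith [t.2.1], by linarith [t.2.2]⟩,
      ?_, ?_⟩
    · change 1 / 2 ≤ ((t : ℝ) + 1) / 2
      linarith [t.2.1]
    · have : 2 * (((t : ℝ) + 1) / 2) - 1 = t := by ring
      simp only [ψ, this]
      exact projIcc_val _ t
  rw [eVariationOn.congr h1, eVariationOn.congr h2,
    eVariationOn.comp_eq_of_monotoneOn _ _ (hφ.monotoneOn _),
    eVariationOn.comp_eq_of_monotoneOn _ _ (hψ.monotoneOn _), h3, h4]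
  rfl

theorem pathLength_segment (a b : Plane) : pathLength (Path.segment a b) = edist a b := by
  apply le_antisymm
  · refine iSup_le fun ⟨N, u, hu, _⟩ => ?_
    have h1 : ∀ k, edist (Path.segment a b (u (k + 1))) (Path.segment a b (u k)) =
        ENNReal.ofReal (((u (k + 1) : ℝ) - u k) * dist a b) := by
      intro k
      have h0 : (u k : ℝ) ≤ u (k + 1) := hu k.le_succ
      rw [edist_dist, Path.segment_apply, Path.segment_apply, dist_lineMap_lineMap, Real.dist_eq,
        abs_of_nonneg (by linarith)]
    have h2 : ∑ k ∈ Finset.range N, ENNReal.ofReal (((u (k + 1) : ℝ) - u k) * dist a b) =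
        ENNReal.ofReal (∑ k ∈ Finset.range N, ((u (k + 1) : ℝ) - u k) * dist a b) := by
      rw [ENNReal.ofReal_sum_of_nonneg]
      intro k _
      have h0 : (u k : ℝ) ≤ u (k + 1) := hu k.le_succ
      exact mul_nonneg (by linarith) dist_nonneg
    simp only [h1]
    rw [h2, ← Finset.sum_mul, Finset.sum_range_sub (fun k => (u k : ℝ)), edist_dist]
    refine ENNReal.ofReal_le_ofReal (mul_le_of_le_one_left dist_nonneg ?_)
    linarith [(u N).2.2, (u 0).2.1]
  · have := eVariationOn.edist_le (Path.segment a b) (mem_univ (0 : unitInterval)) (mem_univ 1)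
    rwa [Path.source, Path.target] at this

theorem pathLength_polygonalPath (w : ℕ → Plane) (m : ℕ) :
    pathLength (polygonalPath w m) = ∑ t ∈ Finset.range m, edist (w t) (w (t + 1)) := by
  induction m with
  | zero =>
    rw [polygonalPath, ← Path.segment_same, pathLength_segment]
    simp
  | succ m ih => rw [polygonalPath, pathLength_trans, ih, pathLength_segment, Finset.sum_range_succ]

/-- Lagrange's identity makes the Cauchy–Schwarz inequality strict for independent vectors. -/
theorem norm_sub_lt {a b : Plane} (h : cross a b ≠ 0) : ‖a - b‖ < ‖a‖ + ‖b‖ := by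
  have hL : cross a b ^ 2 + (inner ℝ a b) ^ 2 = (‖a‖ * ‖b‖) ^ 2 := by
    rw [mul_pow, ← real_inner_self_eq_norm_sq, ← real_inner_self_eq_norm_sq, inner_plane,
      inner_plane, inner_plane, cross]
    ring
  have h1 : 0 < cross a b ^ 2 := by positivity
  have h2 : |inner ℝ a b| < ‖a‖ * ‖b‖ :=
    abs_lt_of_sq_lt_sq (by linarith) (by positivity)
  have h3 := norm_sub_sq_real a b
  have h4 := (abs_lt.1 h2).1
  refine lt_of_pow_lt_pow_left₀ 2 (by positivity) ?_
  nlinarith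

theorem IsShortestPathIn.symm {K : Set Plane} {x y : Plane} {γ : Path x y}
    (h : IsShortestPathIn K γ) : IsShortestPathIn K γ.symm := by
  refine ⟨fun t => h.1 _, fun δ hδ => ?_⟩
  rw [pathLength_symm, ← pathLength_symm δ]
  exact h.2 _ fun t => hδ _

/-- `γ` is a shortest path in `K` if and only if `p` holds, and then all shortest paths have the
same image. -/
def IsUniquelyShortestIff (K : Set Plane) {x y : Plane} (γ : Path x y) (p : Prop) : Prop :=
  (IsShortestPathIn K γ ↔ p) ∧
    (IsShortestPathIn K γ → ∀ δ : Path x y, IsShortestPathIn K δ → range δ = range γ)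

theorem IsUniquelyShortestIff.cast {K : Set Plane} {x y x' y' : Plane} {γ : Path x y} {p : Prop}
    (h : IsUniquelyShortestIff K γ p) (hx : x' = x) (hy : y' = y) :
    IsUniquelyShortestIff K (γ.cast hx hy) p := by
  subst hx hy
  exact h

theorem IsUniquelyShortestIff.symm {K : Set Plane} {x y : Plane} {γ : Path x y} {p : Prop}
    (h : IsUniquelyShortestIff K γ p) : IsUniquelyShortestIff K γ.symm p := by
  have hs : IsShortestPathIn K γ.symm ↔ IsShortestPathIn K γ :=
    ⟨fun h => by simpa using IsShortestPathIn.symm h, IsShortestPathIn.symm⟩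
  refine ⟨hs.trans h.1, fun hγ δ hδ => ?_⟩
  have := h.2 (hs.1 hγ) δ.symm (IsShortestPathIn.symm hδ)
  rwa [Path.symm_range] at this ⊢

/-! ### Cutting corners, and the criterion for simple loops -/

namespace IsSimpleLoop

variable {p : ℕ → Plane} {n : ℕ} (hp : IsSimpleLoop p n)
include hp

/-- A corner that is not reflex can be cut off. -/
theorem exists_shorter {k r : ℕ} (hrefl : ¬ IsReflexAt p n (k + 1)) :
    ∃ δ : Path (p 0) (p (k + 2 + r)), (∀ v, δ v ∈ regionOf (boundaryOf p n)) ∧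
      pathLength δ < ∑ t ∈ Finset.range (k + 2 + r), edist (p t) (p (t + 1)) := by
  rw [IsReflexAt, not_or, not_not, Nat.add_sub_cancel] at hrefl
  obtain ⟨hcross, hev⟩ := hrefl
  set y := p (k + 1)
  set a := p k - y with ha
  set b := p (k + 1 + 1) - y with hb
  obtain ⟨ρ, hρ, hsub⟩ := Metric.mem_nhdsWithin_iff.1 hev
  -- The corner is cut at fraction `ε` of both edges, so close to the vertex that the shortcut stays
  -- in the disc where the sector is known to be inside.
  obtain ⟨ε, hε0, hε1, hερ⟩ : ∃ ε : ℝ, 0 < ε ∧ ε < 1 ∧ ε * (‖a‖ + ‖b‖) < ρ := by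
    have h1 : Tendsto (fun ε : ℝ => ε * (‖a‖ + ‖b‖)) (𝓝[>] 0) (𝓝 0) := by
      have : Continuous fun ε : ℝ => ε * (‖a‖ + ‖b‖) := by fun_prop
      simpa using (this.tendsto 0).mono_left nhdsWithin_le_nhds
    obtain ⟨ε, ⟨h2, h3⟩, h4⟩ := (((h1.eventually_lt_const hρ).and
      (nhdsWithin_le_nhds (eventually_lt_nhds one_pos))).and self_mem_nhdsWithin).exists
    exact ⟨ε, h4, h3, h2⟩
  set a' := y + ε • a
  set b' := y + ε • b
  have ha' : a' ∈ segment ℝ (p k) y := by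
    rw [segment_symm, segment_eq_image']
    exact ⟨ε, ⟨hε0.le, hε1.le⟩, rfl⟩
  have hb' : b' ∈ segment ℝ y (p (k + 1 + 1)) := by
    rw [segment_eq_image']
    exact ⟨ε, ⟨hε0.le, hε1.le⟩, rfl⟩
  have hK : ∀ t, segment ℝ (p t) (p (t + 1)) ⊆ regionOf (boundaryOf p n) := fun t =>
    (hp.segment_subset_boundaryOf t).trans subset_union_left
  have hpoly : ∀ (w : ℕ → Plane) (r : ℕ),
      (∀ t, segment ℝ (w t) (w (t + 1)) ⊆ regionOf (boundaryOf p n)) →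
      range (polygonalPath w r) ⊆ regionOf (boundaryOf p n) := by
    intro w r hw
    rw [range_polygonalPath]
    exact union_subset (singleton_subset_iff.2 (hw 0 (left_mem_segment ℝ _ _)))
      (iUnion₂_subset fun t _ => hw t)
  refine ⟨((((polygonalPath p k).trans (Path.segment (p k) a')).trans (Path.segment a' b')).trans
    (Path.segment b' (p (k + 1 + 1)))).trans (polygonalPath (fun t => p (k + 2 + t)) r), ?_, ?_⟩
  · rw [← range_subset_iff]
    simp only [Path.trans_range, Path.range_segment]
    refine union_subset (union_subset (union_subset (union_subset (hpoly p k hK) ?_) ?_) ?_)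
      (hpoly (fun t => p (k + 2 + t)) r fun t => hK (k + 2 + t))
    · exact ((convex_segment _ _).segment_subset (left_mem_segment ℝ _ _) ha').trans (hK k)
    · intro x hx
      rw [segment_eq_image] at hx
      obtain ⟨θ, hθ, rfl⟩ := hx
      simp only
      -- The ends of the shortcut are not in the open sector; they lie on the boundary.
      rcases hθ.1.eq_or_lt with rfl | hθ0
      · rw [sub_zero, one_smul, zero_smul, add_zero]
        exact hK k ha'
      rcases hθ.2.eq_or_lt with rfl | hθ1
      · rw [sub_self, one_smul, zero_smul, zero_add]
        exact hK (k + 1) hb'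
      have he : (1 - θ) • a' + θ • b' = y + (((1 - θ) * ε) • a + (θ * ε) • b) := by
        simp only [a', b']
        module
      refine Or.inr (hsub ⟨?_, (1 - θ) * ε, θ * ε, mul_pos (by linarith) hε0, mul_pos hθ0 hε0, ?_⟩)
      · rw [he, mem_ball_iff_norm, add_sub_cancel_left]
        refine (norm_add_le _ _).trans_lt (lt_of_le_of_lt ?_ hερ)
        rw [norm_smul, norm_smul, Real.norm_of_nonneg (by nlinarith),
          Real.norm_of_nonneg (by positivity), mul_add]
        refine add_le_add (mul_le_mul_of_nonneg_right ?_ (norm_nonneg _))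
          (mul_le_mul_of_nonneg_right ?_ (norm_nonneg _)) <;> nlinarith
      · rw [he, add_assoc]
    · exact ((convex_segment _ _).segment_subset hb' (right_mem_segment ℝ _ _)).trans (hK (k + 1))
  · rw [pathLength_trans, pathLength_trans, pathLength_trans, pathLength_trans,
      pathLength_polygonalPath, pathLength_polygonalPath, pathLength_segment, pathLength_segment,
      pathLength_segment, Finset.sum_range_add, Finset.sum_range_succ, Finset.sum_range_succ]
    have hfin : ∀ w : ℕ → Plane, ∀ r, ∑ t ∈ Finset.range r, edist (w t) (w (t + 1)) ≠ ⊤ :=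
      fun w r => (ENNReal.sum_lt_top.2 fun _ _ => edist_lt_top _ _).ne
    refine ENNReal.add_lt_add_right (hfin (fun t => p (k + 2 + t)) r) ?_
    suffices hlt : edist (p k) a' + edist a' b' + edist b' (p (k + 1 + 1)) <
        edist (p k) y + edist y (p (k + 1 + 1)) by
      simpa only [add_assoc] using! ENNReal.add_lt_add_left (hfin p k) hlt
    have e1 : dist (p k) a' = (1 - ε) * ‖a‖ := by
      have : p k - a' = (1 - ε) • a := by simp only [a', ha]; module
      rw [dist_eq_norm, this, norm_smul, Real.norm_of_nonneg (by linarith)]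
    have e2 : dist a' b' = ε * ‖a - b‖ := by
      have : a' - b' = ε • (a - b) := by simp only [a', b']; module
      rw [dist_eq_norm, this, norm_smul, Real.norm_of_nonneg hε0.le]
    have e3 : dist b' (p (k + 1 + 1)) = (1 - ε) * ‖b‖ := by
      have : b' - p (k + 1 + 1) = -((1 - ε) • b) := by simp only [b', hb]; module
      rw [dist_eq_norm, this, norm_neg, norm_smul, Real.norm_of_nonneg (by linarith)]
    have e4 : dist (p k) y = ‖a‖ := dist_eq_norm _ _
    have e5 : dist y (p (k + 1 + 1)) = ‖b‖ := by rw [dist_comm, dist_eq_norm]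
    rw [edist_dist, edist_dist, edist_dist, edist_dist, edist_dist,
      ← ENNReal.ofReal_add dist_nonneg dist_nonneg, ← ENNReal.ofReal_add (by positivity) dist_nonneg,
      ← ENNReal.ofReal_add dist_nonneg dist_nonneg, e1, e2, e3, e4, e5]
    have hpos : 0 < ‖a‖ + ‖b‖ := (norm_nonneg _).trans_lt (norm_sub_lt hcross)
    refine (ENNReal.ofReal_lt_ofReal_iff hpos).2 ?_
    have := mul_lt_mul_of_pos_left (norm_sub_lt hcross) hε0
    linarith

theorem isUniquelyShortestIff {m : ℕ} (hm : 0 < m) (hmn : m < n) :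
    IsUniquelyShortestIff (regionOf (boundaryOf p n)) (polygonalPath p m)
      (∀ t, 1 ≤ t → t < m → IsReflexAt p n t) := by
  have hne : ∀ k < m, p k ≠ p (k + 1) := fun k _ => hp.ne_succ k
  have hrange : range (polygonalPath p m) = ⋃ t ∈ Finset.range m, segment ℝ (p t) (p (t + 1)) :=
    (boundaryOf_eq_range p hm).symm
  have hB : ∀ v, polygonalPath p m v ∈ regionOf (boundaryOf p n) := by
    rw [← range_subset_iff, hrange]
    exact iUnion₂_subset fun t _ => (hp.segment_subset_boundaryOf t).trans subset_union_left
  have hiff : IsShortestPathIn (regionOf (boundaryOf p n)) (polygonalPath p m) ↔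
      ∀ t, 1 ≤ t → t < m → IsReflexAt p n t := by
    constructor
    · intro hs t ht1 htm
      by_contra hrefl
      obtain ⟨k, rfl⟩ : ∃ k, t = k + 1 := ⟨t - 1, by omega⟩
      obtain ⟨r, rfl⟩ : ∃ r, m = k + 2 + r := ⟨m - (k + 2), by omega⟩
      obtain ⟨δ, hδ, hlt⟩ := hp.exists_shorter (r := r) hrefl
      rw [← pathLength_polygonalPath] at hlt
      exact absurd (hs.2 δ hδ) (not_le.2 hlt)
    · intro hrefl
      refine ⟨hB, fun δ hδ => ?_⟩
      obtain ⟨u, hu⟩ := hp.exists_isCrossing hm hmn hrefl δ hδ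
      rw [pathLength_polygonalPath]
      exact hu.sum_edist_le hne
  refine ⟨hiff, fun hs δ hδ => ?_⟩
  obtain ⟨u, hu⟩ := hp.exists_isCrossing hm hmn (hiff.1 hs) δ hδ.1
  rw [hrange]
  refine hu.range_eq hne ?_ hm
  rw [← pathLength_polygonalPath]
  exact hδ.2 _ hB

end IsSimpleLoop

end PlanePolygon

/-! ### Translation to polygons indexed by `Fin n` -/

namespace Polygon

open PlanePolygon

variable {n : ℕ} [NeZero n] (P : Polygon Plane n)

/-- The vertices of the polygon, numbered from `i` on and repeated periodically. -/
def vertexSeq (i : Fin n) (t : ℕ) : Plane := P (i + Fin.ofNat n t)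

theorem finRotate_add_ofNat (i : Fin n) (t : ℕ) :
    finRotate n (i + Fin.ofNat n t) = i + Fin.ofNat n (t + 1) := by
  rw [finRotate_apply, add_assoc]
  congr 1
  ext
  simp [Fin.val_add]

theorem edgeSet_add_ofNat (i : Fin n) (t : ℕ) :
    P.edgeSet ℝ (i + Fin.ofNat n t) = segment ℝ (P.vertexSeq i t) (P.vertexSeq i (t + 1)) := by
  rw [edgeSet, affineSegment_eq_segment, finRotate_add_ofNat]
  rfl

theorem ofNat_eq_ofNat {s t : ℕ} : Fin.ofNat n s = Fin.ofNat n t ↔ s % n = t % n := by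
  rw [Fin.ext_iff]
  rfl

theorem add_ofNat_val_sub (i k : Fin n) : i + Fin.ofNat n (k - i).val = k := by
  have : Fin.ofNat n (k - i).val = k - i := by
    ext
    exact Nat.mod_eq_of_lt (k - i).2
  rw [this, add_sub_cancel]

theorem boundary_eq (i : Fin n) : P.boundary ℝ = boundaryOf (P.vertexSeq i) n := by
  ext x
  simp only [boundary, boundaryOf, mem_iUnion, Finset.mem_range]
  constructor
  · rintro ⟨k, hk⟩
    refine ⟨(k - i).val, (k - i).2, ?_⟩
    rwa [← edgeSet_add_ofNat, add_ofNat_val_sub]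
  · rintro ⟨t, _, ht⟩
    exact ⟨_, (P.edgeSet_add_ofNat i t).symm ▸ ht⟩

theorem inside_eq (i : Fin n) : P.inside = insideOf (boundaryOf (P.vertexSeq i) n) := by
  rw [inside, insideOf, P.boundary_eq i]

theorem region_eq (i : Fin n) : P.region = regionOf (boundaryOf (P.vertexSeq i) n) := by
  rw [region, regionOf, P.boundary_eq i, P.inside_eq i]

variable {P}

theorem IsSimple.isSimpleLoop (hP : P.IsSimple) (i : Fin n) :
    IsSimpleLoop (P.vertexSeq i) n where
  three_le := hP.three_le
  periodic t := by
    have : Fin.ofNat n (t + n) = Fin.ofNat n t := ofNat_eq_ofNat.2 (Nat.add_mod_right t n)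
    simp only [vertexSeq, this]
  param_ne s s' hs hss' hs'n heq := by
    have hs' : 0 ≤ s' := hs.trans hss'.le
    set a := ⌊s⌋₊ with ha
    set a' := ⌊s'⌋₊ with ha'
    have h1 := Nat.floor_le hs
    have h2 := Nat.lt_floor_add_one s
    have h1' := Nat.floor_le hs'
    have h2' := Nat.lt_floor_add_one s'
    rw [← ha] at h1 h2
    rw [← ha'] at h1' h2'
    have hne : ∀ t, P.vertexSeq i t ≠ P.vertexSeq i (t + 1) := fun t => by
      have := hP.nondegenerate (i + Fin.ofNat n t)
      rwa [finRotate_add_ofNat] at this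
    have hmem : ∀ {σ : ℝ} {t : ℕ}, (t : ℝ) ≤ σ → σ < t + 1 →
        param (P.vertexSeq i) σ ∈ P.edgeSet ℝ (i + Fin.ofNat n t) := by
      intro σ t h h'
      rw [edgeSet_add_ofNat, segment_eq_param]
      exact ⟨σ, ⟨h, h'.le⟩, rfl⟩
    -- A point with parameter in `[t, t + 1)` is not the final vertex of its edge, the only point
    -- shared with the next edge.
    have hlast : ∀ {σ : ℝ} {t : ℕ}, (t : ℝ) ≤ σ → σ < t + 1 →
        param (P.vertexSeq i) σ ≠ P.vertexSeq i (t + 1) := by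
      intro σ t h h' he
      rw [param_eq_lineMap _ h h'.le] at he
      have := AffineMap.lineMap_injective ℝ (hne t)
        (he.trans (AffineMap.lineMap_apply_one _ _).symm)
      linarith
    -- On a common edge the fractional parts agree, and the integer parts differ by `0` or `n`; this
    -- gives `s' = s` or `s' = s + n`, both excluded.
    by_cases c1 : i + Fin.ofNat n a = i + Fin.ofNat n a'
    · have e1 : P.vertexSeq i a = P.vertexSeq i a' := by simp only [vertexSeq, c1]
      have e2 : P.vertexSeq i (a + 1) = P.vertexSeq i (a' + 1) := by
        simp only [vertexSeq, ← finRotate_add_ofNat, c1]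
      rw [param_eq_lineMap _ h1 h2.le, param_eq_lineMap _ h1' h2'.le, ← e1, ← e2] at heq
      have h3 := AffineMap.lineMap_injective ℝ (hne a) heq
      have h4 : a ≤ a' := Nat.floor_le_floor hss'.le
      have h5 : a' ≤ a + n := by
        have : (a' : ℝ) < a + n + 1 := by linarith
        exact Nat.lt_succ_iff.1 (by exact_mod_cast this)
      have h6 : a % n = a' % n := ofNat_eq_ofNat.1 (add_left_cancel c1)
      obtain ⟨c, hc⟩ := (Nat.modEq_iff_dvd' h4).1 h6
      have hc2 : c = 0 ∨ c = 1 := by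
        by_contra! h
        have : 2 ≤ c := by omega
        have h7 : n * 2 ≤ n * c := Nat.mul_le_mul_left n this
        have := hP.three_le
        omega
      rcases hc2 with rfl | rfl
      · have : a' = a := by omega
        rw [this] at h3
        linarith
      · have : a' = a + n := by omega
        rw [this] at h3
        push_cast at h3
        linarith
    by_cases c2 : i + Fin.ofNat n a' = finRotate n (i + Fin.ofNat n a)
    · have h3 : param (P.vertexSeq i) s ∈ P.edgeSet ℝ (i + Fin.ofNat n a) ∩
          P.edgeSet ℝ (finRotate n (i + Fin.ofNat n a)) := ⟨hmem h1 h2, by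
        rw [← c2, heq]; exact hmem h1' h2'⟩
      rw [hP.consecutive, finRotate_add_ofNat, mem_singleton_iff] at h3
      exact hlast h1 h2 h3
    by_cases c3 : i + Fin.ofNat n a = finRotate n (i + Fin.ofNat n a')
    · have h3 : param (P.vertexSeq i) s' ∈ P.edgeSet ℝ (i + Fin.ofNat n a') ∩
          P.edgeSet ℝ (finRotate n (i + Fin.ofNat n a')) := ⟨hmem h1' h2', by
        rw [← c3, ← heq]; exact hmem h1 h2⟩
      rw [hP.consecutive, finRotate_add_ofNat, mem_singleton_iff] at h3
      exact hlast h1' h2' h3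
    exact disjoint_left.1 (hP.nonconsecutive _ _ (Ne.symm c1) c2 c3) (hmem h1 h2)
      (heq ▸ hmem h1' h2')

/-- At a straight vertex both candidates for the interior angle are `π`. Otherwise the unoriented
angle is below `π` and its complement above, so only the position of the sector matters. -/
theorem IsSimple.isReflex_iff (hP : P.IsSimple) (i : Fin n) {t : ℕ} (ht : 1 ≤ t) :
    P.IsReflex (i + Fin.ofNat n t) ↔ IsReflexAt (P.vertexSeq i) n t := by
  have hp := hP.isSimpleLoop i
  obtain ⟨k, rfl⟩ : ∃ k, t = k + 1 := ⟨t - 1, by omega⟩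
  have hsymm : (finRotate n).symm (i + Fin.ofNat n (k + 1)) = i + Fin.ofNat n k := by
    rw [Equiv.symm_apply_eq, finRotate_add_ofNat]
  rw [IsReflex, interiorAngle, IsReflexAt, hsymm, finRotate_add_ofNat, P.inside_eq i]
  have hne1 := hp.ne_succ k
  have hcases := hp.vertex_cases (k := k + 1) (by omega)
  classical
  change _ ≤ (if ∀ᶠ x in 𝓝[openSector (P.vertexSeq i k) (P.vertexSeq i (k + 1))
    (P.vertexSeq i (k + 1 + 1))] (P.vertexSeq i (k + 1)), _ then
    EuclideanGeometry.angle (P.vertexSeq i k) (P.vertexSeq i (k + 1)) (P.vertexSeq i (k + 1 + 1))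
    else 2 * Real.pi - EuclideanGeometry.angle (P.vertexSeq i k) (P.vertexSeq i (k + 1))
      (P.vertexSeq i (k + 1 + 1))) ↔ _
  simp only [Nat.add_sub_cancel] at hcases ⊢
  set a := P.vertexSeq i k
  set y := P.vertexSeq i (k + 1)
  set b := P.vertexSeq i (k + 1 + 1)
  rcases hcases with ⟨c, hc, hb⟩ | hcross
  · have hpi : EuclideanGeometry.angle a y b = Real.pi :=
      InnerProductGeometry.angle_eq_pi_iff.2 ⟨sub_ne_zero.2 hne1, c, hc, hb⟩
    have h0 : cross (a - y) (b - y) = 0 := by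
      rw [hb, cross_smul_right, cross_self, mul_zero]
    rw [hpi]
    refine iff_of_true ?_ (Or.inl h0)
    split_ifs <;> linarith
  · have hlt : EuclideanGeometry.angle a y b < Real.pi := by
      refine lt_of_le_of_ne (EuclideanGeometry.angle_le_pi _ _ _) fun h => hcross ?_
      obtain ⟨_, c, _, hb⟩ := InnerProductGeometry.angle_eq_pi_iff.1 h
      change b - y = c • (a - y) at hb
      rw [hb, cross_smul_right, cross_self, mul_zero]
    split_ifs with hev
    · exact iff_of_false (not_le.2 hlt) (by rintro (h | h) <;> contradiction)
    · exact iff_of_true (by linarith) (Or.inr hev)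

theorem range_forwardArc (i j : Fin n) :
    range (P.forwardArc i j) = range (polygonalPath (P.vertexSeq i) (j - i).val) := rfl

/-- Injectivity of the parametrization over one period: a vertex on the arc can be there only at its
own index. -/
theorem IsSimple.isInteriorVertex_iff (hP : P.IsSimple) {i j : Fin n} (hij : i ≠ j) (k : Fin n) :
    P.IsInteriorVertex (P.forwardArc i j) k ↔
      ∃ t, 1 ≤ t ∧ t < (j - i).val ∧ k = i + Fin.ofNat n t := by
  have hp := hP.isSimpleLoop i
  have hm : 0 < (j - i).val := Nat.pos_of_ne_zero fun h => hij (by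
    rw [Fin.val_eq_zero_iff, sub_eq_zero] at h
    exact h.symm)
  have hmn : (j - i).val < n := (j - i).2
  have hj := add_ofNat_val_sub i j
  set m := (j - i).val
  have hrange : range (P.forwardArc i j) = param (P.vertexSeq i) '' Icc ((0 : ℕ) : ℝ) m := by
    rw [range_forwardArc, ← boundaryOf_eq_range _ hm, ← biUnion_segment_eq_param _ hm, boundaryOf,
      Finset.range_eq_Ico]
  rw [IsInteriorVertex, hrange]
  have hmod : ∀ {s t : ℕ}, s < n → t < n → i + Fin.ofNat n s = i + Fin.ofNat n t → s = t := by
    intro s t hs ht h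
    have := ofNat_eq_ofNat.1 (add_left_cancel h)
    rwa [Nat.mod_eq_of_lt hs, Nat.mod_eq_of_lt ht] at this
  have hi : i + Fin.ofNat n 0 = i := by simp
  constructor
  · rintro ⟨hki, hkj, s, hs, he⟩
    have hk := add_ofNat_val_sub i k
    have hkn := (k - i).2
    set t := (k - i).val
    have he' : param (P.vertexSeq i) s = param (P.vertexSeq i) t := by
      rw [he, param_natCast, vertexSeq, hk]
    have ht0 : t ≠ 0 := by
      intro h
      rw [h, hi] at hk
      exact hki hk.symm
    have htm : t ≠ m := by
      intro h
      rw [h, hj] at hk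
      exact hkj hk.symm
    have hs0 : 0 ≤ s := by simpa using hs.1
    have h1 : (m : ℝ) < n := by exact_mod_cast hmn
    have h2 : (t : ℝ) < n := by exact_mod_cast hkn
    have hst : s = t := by
      rcases le_total s t with h | h
      · exact (hp.param_eq_iff hs0 h (by linarith)).1 he'
      · exact ((hp.param_eq_iff (Nat.cast_nonneg t) h (by
          linarith [hs.2, (Nat.cast_nonneg t : (0 : ℝ) ≤ t)])).1 he'.symm).symm
    have : t ≤ m := by
      have := hs.2
      rw [hst] at this
      exact_mod_cast this
    exact ⟨t, by omega, by omega, hk.symm⟩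
  · rintro ⟨t, h1, h2, rfl⟩
    refine ⟨fun h => ?_, fun h => ?_, t, ⟨by simp, by exact_mod_cast h2.le⟩, param_natCast _ t⟩
    · have := hmod (s := t) (t := 0) (by omega) (by omega) (h.trans hi.symm)
      omega
    · have := hmod (s := t) (t := m) (by omega) hmn (h.trans hj.symm)
      omega

theorem IsSimple.isUniquelyShortestIff_forwardArc (hP : P.IsSimple) {i j : Fin n} (hij : i ≠ j) :
    IsUniquelyShortestIff P.region (P.forwardArc i j)
      (∀ k, P.IsInteriorVertex (P.forwardArc i j) k → P.IsReflex k) := by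
  have hp := hP.isSimpleLoop i
  have hm : 0 < (j - i).val := Nat.pos_of_ne_zero fun h => hij (by
    rw [Fin.val_eq_zero_iff, sub_eq_zero] at h
    exact h.symm)
  have hiff : (∀ k, P.IsInteriorVertex (P.forwardArc i j) k → P.IsReflex k) ↔
      ∀ t, 1 ≤ t → t < (j - i).val → IsReflexAt (P.vertexSeq i) n t := by
    simp only [hP.isInteriorVertex_iff hij]
    constructor
    · intro h t h1 h2
      exact (hP.isReflex_iff i h1).1 (h _ ⟨t, h1, h2, rfl⟩)
    · rintro h _ ⟨t, h1, h2, rfl⟩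
      exact (hP.isReflex_iff i h1).2 (h t h1 h2)
  rw [hiff, P.region_eq i]
  exact (hp.isUniquelyShortestIff hm (j - i).2).cast _ _

end Polygon

/-- A boundary arc `B` of a simple polygon is the shortest path in the polygon between its
endpoints iff all its interior vertices are reflex; and then no other curve is a shortest path. -/
theorem proposition2p3 {n : ℕ} [NeZero n] (P : Polygon Plane n) (hP : P.IsSimple)
    (i j : Fin n) (hij : i ≠ j) (B : Path (P i) (P j)) (hB : P.IsBoundaryArc B) :
    (IsShortestPathIn P.region B ↔ ∀ k, P.IsInteriorVertex B k → P.IsReflex k) ∧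
    (IsShortestPathIn P.region B → ∀ δ : Path (P i) (P j),
      IsShortestPathIn P.region δ → Set.range δ = Set.range B) := by
  rcases hB with rfl | rfl
  · exact hP.isUniquelyShortestIff_forwardArc hij
  -- The other arc is the reverse of the forward arc from `j` to `i`; reversal preserves length and
  -- image.
  · have h := (hP.isUniquelyShortestIff_forwardArc hij.symm).symm
    have hiff : (∀ k, P.IsInteriorVertex (P.forwardArc j i).symm k → P.IsReflex k) ↔
        ∀ k, P.IsInteriorVertex (P.forwardArc j i) k → P.IsReflex k := by
      refine forall_congr' fun k => ?_
      rw [Polygon.IsInteriorVertex, Polygon.IsInteriorVertex, Path.symm_range, and_left_comm]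
    rw [hiff]
    exact h
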